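/- \textbf{Notation.} An index is a finite tuple $\boldsymbol{k}=(k_1,\dots,k_r)$ of positive integers; it is admissible if it is empty or $k_r\ge 2$, and then $\zeta(\boldsymbol{k})=\sum_{0<n_1<\cdots<n_r}n_1^{-k_1}\cdots n_r^{-k_r}$ (with $\zeta(\varnothing)=1$). \emph{The case $\mathcal F=\mathcal A$.} For a positive integer $n$ let $\mathcal{A}_n=\prod_p\mathbb{Z}/p^n\mathbb{Z}\big/\bigoplus_p\mathbb{Z}/p^n\mathbb{Z}$, with $p$ running over all primes; it is a $\mathbb{Q}$-algebra. Put \[ \zeta_{\mathcal{A}_n}(\boldsymbol{k})=\Bigl(\sum_{0<n_1<\cdots<n_r<p}\tfrac{1}{n_1^{k_1}\cdots n_r^{k_r}}\bmod p^n\Bigr)_p,\qquad \zeta^\star_{\mathcal{A}_n}(\boldsymbol{k})=\Bigl(\sum_{1\le n_1\le\cdots\le n_r\le p-1}\tfrac{1}{n_1^{k_1}\cdots n_r^{k_r}}\bmod p^n\Bigr)_p, \] $x_{\mathcal{A}_n}=(p\bmod p^n)_p$ and, for $k\ge 2$, $\mathfrak{Z}_{\mathcal{A}_n}(k)=\Bigl(\frac{B_{p^{n-1}(p-1)-k+1}}{k-1+p^{n-1}}\bmod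 p^n\Bigr)_p$, where $B_j$ is the $j$-th Bernoulli number (the finitely many $p$ for which a component makes no sense are irrelevant). \emph{The case $\mathcal F=\mathcal S$.} Let $\mathcal{Z}\subset\mathbb{R}$ be the $\mathbb{Q}$-algebra generated by all $\zeta(\boldsymbol{k})$ with $\boldsymbol k$ admissible, and $\overline{\mathcal{Z}}=\mathcal{Z}/\zeta(2)\mathcal{Z}$. Let $\mathfrak{H}^1=\mathbb{Q}+e_1\mathbb{Q}\langle e_0,e_1\rangle$, with the basis $e_{\boldsymbol{k}}=e_{k_1}\cdots e_{k_r}$, $e_k=e_1e_0^{k-1}$, and let $\mathfrak{H}^0\subset\mathfrak{H}^1$ be spanned by the $e_{\boldsymbol{k}}$ with $\boldsymbol{k}$ admissible. For $\bullet$ either the harmonic or the shuffle product, every $a\in\mathfrak{H}^1$ is uniquely $\sum_i a_i\bullet e_1^{\bullet i}$ with $a_i\in\mathfrak{H}^0$; put $\mathrm{reg}_\bullet(a)=a_0$ and $\zeta^\bullet(\boldsymbol{k})=Z(\mathrm{reg}_\bullet(e_{\boldsymbol{k}}))\in\mathcal{Z}$, where $Z:\mathfrak{H}^0\to\mathcal{Z}$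 is linear with $Z(e_{\boldsymbol{l}})=\zeta(\boldsymbol{l})$. Let $\zeta_{\widehat{\mathcal{S}}}(\boldsymbol{k})\in\overline{\mathcal{Z}}[[t]]$ be the class modulo $\zeta(2)$ of \[ \sum_{i=0}^r(-1)^{k_{i+1}+\cdots+k_r}\zeta^\bullet(k_1,\dots,k_i)\sum_{l_{i+1},\dots,l_r\ge0}\Bigl[\prod_{j=i+1}^r\tbinom{k_j+l_j-1}{l_j}\Bigr]\zeta^\bullet(k_r+l_r,\dots,k_{i+1}+l_{i+1})\,t^{l_{i+1}+\cdots+l_r}, \] and $\zeta^\star_{\widehat{\mathcal{S}}}(\boldsymbol{k})=\sum\zeta_{\widehat{\mathcal{S}}}(k_1\square\cdots\square k_r)$, summed over all ways of replacing each $\square$ by a comma or a plus sign. Then $\zeta_{\mathcal{S}_n}(\boldsymbol{k})$ and $\zeta^\star_{\mathcal{S}_n}(\boldsymbol{k})$ are the classes of these series in $\overline{\mathcal{Z}}[[t]]/(t^n)$; further $x_{\mathcal{S}_n}=t\bmod t^n$, and $\mathfrak{Z}_{\mathcal{S}_n}(k)=\zeta(k)\bmod\zeta(2)$ for $k\ge2$.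 \textbf{Theorem.} Let $k_1$ and $k_2$ be positive integers such that $k=k_1+k_2$ is even. Then, for $\mathcal{F}=\mathcal{A}$ and for $\mathcal{F}=\mathcal{S}$ (in the latter case with either choice of the regularization $\bullet$), \begin{align*} \zeta_{\mathcal{F}_2}(k_1,k_2)&=\frac12\left\{(-1)^{k_1}k_2\binom{k+1}{k_1}-(-1)^{k_2}k_1\binom{k+1}{k_2}-k\right\}\mathfrak{Z}_{\mathcal{F}_2}(k+1)\,x_{\mathcal{F}_2},\\ \zeta^\star_{\mathcal{F}_2}(k_1,k_2)&=\frac12\left\{(-1)^{k_1}k_2\binom{k+1}{k_1}-(-1)^{k_2}k_1\binom{k+1}{k_2}+k\right\}\mathfrak{Z}_{\mathcal{F}_2}(k+1)\,x_{\mathcal{F}_2}. \end{align*} -/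

import Mathlib

namespace FMZV

/-! ## Indices and multiple zeta values -/

/-- An index: a finite, possibly empty, tuple of positive integers. -/
abbrev Index := List ℕ+

/-- An index `(k₁, …, k_r)` is admissible if `k_r ≥ 2`; the empty index is admissible. -/
def Admissible (k : Index) : Prop := ∀ a ∈ k.getLast?, 2 ≤ a

/-- Admissible indices. -/
abbrev AdmIndex := {k : Index // Admissible k}

/-- The multiple zeta value `ζ(k₁, …, k_r) = ∑_{0 < n₁ < ⋯ < n_r} 1 / (n₁^{k₁} ⋯ n_r^{k_r})`
(the series converges for admissible indices, the only ones for which it is used). -/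
noncomputable def mzv (k : Index) : ℝ :=
  ∑' n : {n : Fin k.length → ℕ // StrictMono n ∧ ∀ i, 0 < n i},
    ∏ i, 1 / (n.1 i : ℝ) ^ (k.get i : ℕ)

/-- The `ℚ`-subalgebra `𝒵` of `ℝ` generated by all multiple zeta values. -/
noncomputable def MZAlg : Subalgebra ℚ ℝ :=
  Algebra.adjoin ℚ {x | ∃ k : AdmIndex, x = mzv k.1}

/-- The multiple zeta value of an admissible index as an element of `𝒵`. -/
noncomputable def mzvMem (k : AdmIndex) : MZAlg :=
  ⟨mzv k.1, Algebra.subset_adjoin ⟨k, rfl⟩⟩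

theorem admissible_singleton {k : ℕ+} (h : 2 ≤ k) : Admissible [k] := by
  intro a ha
  simp only [List.getLast?_singleton, Option.mem_def, Option.some.injEq] at ha
  exact ha ▸ h

/-- The Riemann zeta value `ζ(k) ∈ 𝒵` for `k ≥ 2` (and `0` for `k = 1`, where it is not used). -/
noncomputable def zetaMem (k : ℕ+) : MZAlg :=
  if h : 2 ≤ k then mzvMem ⟨[k], admissible_singleton h⟩ else 0

/-- The quotient ring `𝒵 / ζ(2)𝒵`. -/
abbrev MZBar : Type := MZAlg ⧸ Ideal.span {zetaMem 2}

/-! ## Words, harmonic product and shuffle product -/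

/-- The `ℚ`-vector space with the words over the alphabet `α` as a basis. -/
abbrev Words (α : Type) : Type := List α →₀ ℚ

/-- The empty word. -/
noncomputable def one {α : Type} : Words α := Finsupp.single [] 1

/-- Multiplication by a letter from the left. -/
noncomputable def consL {α : Type} (a : α) : Words α →ₗ[ℚ] Words α :=
  Finsupp.lmapDomain ℚ ℚ (List.cons a)

/-- The bilinear extension of a product of words. -/
noncomputable def bilin {α : Type} (f : List α → List α → Words α) :
    Words α →ₗ[ℚ] Words α →ₗ[ℚ] Words α :=
  Finsupp.linearCombination ℚ fun u => Finsupp.linearCombination ℚ fun v => f u v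

/-- `ℌ¹`, with the basis `e_k = e_{k₁} ⋯ e_{k_r}` indexed by all indices. -/
abbrev H1 : Type := Words ℕ+

/-- `ℌ⁰`, with the basis `e_k` indexed by the admissible indices. -/
abbrev H0 : Type := AdmIndex →₀ ℚ

/-- The inclusion `ℌ⁰ ⊆ ℌ¹`. -/
noncomputable def incl : H0 →ₗ[ℚ] H1 := Finsupp.lmapDomain ℚ ℚ Subtype.val

/-- The harmonic product of two words in the letters `e_k`. -/
noncomputable def harmonicWord : Index → Index → H1
  | [], v => Finsupp.single v 1
  | a :: u, [] => Finsupp.single (a :: u) 1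
  | a :: u, b :: v =>
      consL a (harmonicWord u (b :: v)) + consL b (harmonicWord (a :: u) v)
        + consL (a + b) (harmonicWord u v)
termination_by u v => u.length + v.length

/-- The harmonic product on `ℌ¹`. -/
noncomputable def harmonic : H1 →ₗ[ℚ] H1 →ₗ[ℚ] H1 := bilin harmonicWord

/-- The non-commutative polynomials `ℚ⟨e₀, e₁⟩`: the letter `e₀` is `0 : Fin 2`, and `e₁` is
`1 : Fin 2`. -/
abbrev Poly01 : Type := Words (Fin 2)

/-- The shuffle product of two words in `e₀, e₁`. -/
noncomputable def shuffleWord : List (Fin 2) → List (Fin 2) → Poly01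
  | [], v => Finsupp.single v 1
  | a :: u, [] => Finsupp.single (a :: u) 1
  | a :: u, b :: v =>
      consL a (shuffleWord u (b :: v)) + consL b (shuffleWord (a :: u) v)
termination_by u v => u.length + v.length

/-- The shuffle product on `ℚ⟨e₀, e₁⟩`. -/
noncomputable def shuffle : Poly01 →ₗ[ℚ] Poly01 →ₗ[ℚ] Poly01 := bilin shuffleWord

/-- The word in `e₀, e₁` which `e_{k₁} ⋯ e_{k_r}` stands for, where `e_k = e₁ e₀^{k-1}`. -/
def toWord : Index → List (Fin 2)
  | [] => []
  | k :: w => (1 :: List.replicate ((k : ℕ) - 1) 0) ++ toWord w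

/-- The inclusion `ℌ¹ ⊆ ℚ⟨e₀, e₁⟩`. -/
noncomputable def toPoly : H1 →ₗ[ℚ] Poly01 := Finsupp.lmapDomain ℚ ℚ toWord

/-- The `i`-th power of `e` with respect to the product `mul`. -/
noncomputable def powWith {α : Type} (mul : Words α →ₗ[ℚ] Words α →ₗ[ℚ] Words α) (e : Words α) :
    ℕ → Words α
  | 0 => one
  | i + 1 => mul (powWith mul e i) e

/-! ## Regularization

Every `a ∈ ℌ¹` has a unique expression `a = ∑ aᵢ • e₁^{•i}` with `aᵢ ∈ ℌ⁰`, both for the harmonic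
and for the shuffle product. This is proved first (by means of the derivation that deletes a last
letter `e₁`), so that the regularization, which is `a₀`, can be read off. -/

section Regularization

/-- Deletion of a last letter `c` of a word; words that do not end in `c` go to `0`. -/
noncomputable def delWord {α : Type} [DecidableEq α] (c : α) : List α → Words α
  | [] => 0
  | a :: w => consL a (delWord c w) + if w = [] ∧ a = c then one else 0

/-- The linear extension of `delWord`. -/
noncomputable def del {α : Type} [DecidableEq α] (c : α) : Words α →ₗ[ℚ] Words α :=
  Finsupp.linearCombination ℚ (delWord c)

theorem consL_single {α : Type} (a : α) (w : List α) (q : ℚ) :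
    consL a (Finsupp.single w q) = Finsupp.single (a :: w) q := by
  simp [consL]

theorem del_single {α : Type} [DecidableEq α] (c : α) (w : List α) :
    del c (Finsupp.single w 1) = delWord c w := by
  simp [del]

theorem bilin_single {α : Type} (f : List α → List α → Words α) (u v : List α) :
    bilin f (Finsupp.single u 1) (Finsupp.single v 1) = f u v := by
  simp [bilin]

/-- The coefficient of the empty word in `consL a x` is zero, and deletion passes a letter. -/
theorem del_consL {α : Type} [DecidableEq α] (c a : α) (x : Words α) :
    del c (consL a x) = consL a (del c x) + if a = c then x [] • one else 0 := by
  induction x using Finsupp.induction_linear with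
  | zero => simp
  | add x y hx hy =>
    simp only [map_add, hx, hy, Finsupp.add_apply]
    split_ifs <;> (simp [add_smul]; try abel)
  | single w q =>
    have h : (Finsupp.single w q : Words α) = q • Finsupp.single w 1 := by simp
    rw [h]
    simp only [map_smul, consL_single, del_single, delWord, Finsupp.smul_apply]
    rw [smul_add]
    by_cases hw : w = []
    · subst hw; split_ifs <;> simp_all
    · simp [hw]

theorem consL_nil {α : Type} (a : α) (x : Words α) : consL a x [] = 0 := by
  unfold consL
  rw [Finsupp.lmapDomain_apply]
  exact Finsupp.mapDomain_of_notMem_range _ _ (by simp)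

theorem words_bilin_ext {α : Type} {f g : Words α →ₗ[ℚ] Words α →ₗ[ℚ] Words α}
    (h : ∀ u v, f (Finsupp.single u 1) (Finsupp.single v 1)
      = g (Finsupp.single u 1) (Finsupp.single v 1)) : f = g := by
  ext u v : 4
  simpa using h u v

/-- An abstract form of the unique expression. -/
theorem unique_expression {α : Type} (mul : Words α →ₗ[ℚ] Words α →ₗ[ℚ] Words α) (e : Words α)
    (φ : H1 →ₗ[ℚ] Words α) (hφ : Function.Injective φ) (D : Words α →ₗ[ℚ] Words α)
    (hmul : ∀ x, mul x one = x) (hone : D one = 0) (he : D e = one) (hone_mul : mul one e = e)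
    (hD : ∀ x y, D (mul x y) = mul (D x) y + mul x (D y))
    (D' : H1 →ₗ[ℚ] H1) (hDφ : ∀ x, D (φ x) = φ (D' x))
    (hker : ∀ x, D' x = 0 ↔ ∃ y, incl y = x) (hnil : ∀ x, ∃ n : ℕ, (D' ^ n) x = 0)
    (hcl : ∀ x y, ∃ z, φ z = mul (φ x) (φ y)) (hone' : ∃ z, φ z = one) (he' : ∃ z, φ z = e)
    (a : H1) :
    ∃! c : ℕ →₀ H0, φ a = c.sum fun i x => mul (φ (incl x)) (powWith mul e i) := by
  have hincl : Function.Injective incl := Finsupp.mapDomain_injective Subtype.val_injective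
  have hD0 : ∀ y, D (φ (incl y)) = 0 := fun y => by
    rw [hDφ, (hker _).2 ⟨y, rfl⟩, map_zero]
  have hpow : ∀ i, D (powWith mul e (i + 1)) = ((i : ℚ) + 1) • powWith mul e i := by
    intro i
    induction i with
    | zero => simp [powWith, hone_mul, he]
    | succ i ih =>
      rw [powWith, hD, ih, he, hmul, map_smul, LinearMap.smul_apply, ← powWith]
      push_cast
      module
  have hlow : ∀ n i, i < n → ∀ y, (D ^ n) (mul (φ (incl y)) (powWith mul e i)) = 0 := by
    intro n
    induction n with
    | zero => intro i hi; omega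
    | succ n ih =>
      intro i hi y
      rw [pow_succ, Module.End.mul_apply, hD, hD0, map_zero, LinearMap.zero_apply, zero_add]
      cases i with
      | zero => simp [powWith, hone]
      | succ i => rw [hpow, map_smul, map_smul, ih i (by omega), smul_zero]
  have htop : ∀ n y, (D ^ n) (mul (φ (incl y)) (powWith mul e n))
      = (n.factorial : ℚ) • φ (incl y) := by
    intro n
    induction n with
    | zero => intro y; simp [powWith, hmul]
    | succ n ih =>
      intro y
      rw [pow_succ, Module.End.mul_apply, hD, hD0, map_zero, LinearMap.zero_apply, zero_add, hpow,
        map_smul, map_smul, ih, smul_smul, Nat.factorial_succ]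
      push_cast
      rfl
  let S : (ℕ →₀ H0) →ₗ[ℚ] Words α := Finsupp.lsum ℚ fun i =>
    ((mul.flip (powWith mul e i)).comp φ).comp incl
  have hS : ∀ c : ℕ →₀ H0, S c = c.sum fun i x => mul (φ (incl x)) (powWith mul e i) := by
    intro c; rfl
  have hSinj : ∀ c, S c = 0 → c = 0 := by
    intro c hc
    by_contra hne
    have hs : c.support.Nonempty := Finsupp.support_nonempty_iff.2 hne
    set n := c.support.max' hs with hn
    have h1 : (D ^ n) (S c) = (n.factorial : ℚ) • φ (incl (c n)) := by
      rw [hS, Finsupp.sum, map_sum, Finset.sum_eq_single n, htop]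
      · intro i hi hin
        exact hlow n i (lt_of_le_of_ne (Finset.le_max' _ _ hi) hin) _
      · intro hni
        exact absurd (Finset.max'_mem _ _) hni
    rw [hc, map_zero] at h1
    have h2 : φ (incl (c n)) = 0 :=
      (smul_eq_zero.1 h1.symm).resolve_left (by exact_mod_cast n.factorial_ne_zero)
    have h3 : c n = 0 := hincl (by rw [hφ (h2.trans (map_zero φ).symm), map_zero])
    exact (Finsupp.mem_support_iff.1 (Finset.max'_mem _ hs)) h3
  have hDφn : ∀ n x, (D ^ n) (φ x) = φ ((D' ^ n) x) := by
    intro n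
    induction n with
    | zero => intro x; simp
    | succ n ih => intro x; rw [pow_succ, pow_succ, Module.End.mul_apply, Module.End.mul_apply,
        hDφ, ih]
  have hpowmem : ∀ i, ∃ z, φ z = powWith mul e i := by
    intro i
    induction i with
    | zero => exact hone'
    | succ i ih =>
      obtain ⟨z, hz⟩ := ih
      obtain ⟨y, hy⟩ := he'
      obtain ⟨x, hx⟩ := hcl z y
      exact ⟨x, by rw [hx, hz, hy, powWith]⟩
  have hex : ∀ n : ℕ, ∀ x : H1, (D' ^ n) x = 0 → ∃ c, S c = φ x := by
    intro n
    induction n with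
    | zero => intro x hx; exact ⟨0, by rw [show x = 0 by simpa using hx, map_zero, map_zero]⟩
    | succ n ih =>
      intro x hx
      rw [pow_succ', Module.End.mul_apply] at hx
      obtain ⟨y, hy⟩ := (hker _).1 hx
      obtain ⟨z, hz⟩ := hpowmem n
      obtain ⟨t, ht⟩ := hcl (incl y) z
      have hne : (n.factorial : ℚ) ≠ 0 := by exact_mod_cast n.factorial_ne_zero
      obtain ⟨c, hc⟩ := ih (x - (n.factorial : ℚ)⁻¹ • t) (by
        apply hφ
        rw [map_zero, map_sub, map_sub, map_smul, map_smul, ← hDφn, ← hDφn, ht, hz, htop, hDφn,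
          hy, smul_smul, inv_mul_cancel₀ hne, one_smul, sub_self])
      refine ⟨c + Finsupp.single n ((n.factorial : ℚ)⁻¹ • y), ?_⟩
      have h1 : S (Finsupp.single n ((n.factorial : ℚ)⁻¹ • y)) = (n.factorial : ℚ)⁻¹ • φ t := by
        rw [hS, Finsupp.sum_single_index (by simp), map_smul, map_smul, map_smul,
          LinearMap.smul_apply, ht, hz]
      rw [map_add, hc, h1, map_sub, map_smul, sub_add_cancel]
  obtain ⟨n, hn⟩ := hnil a
  obtain ⟨c, hc⟩ := hex n a hn
  refine ⟨c, by rw [← hc, hS], fun c' hc' => ?_⟩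
  have hc' : S c = S c' := by rw [hc, hS]; exact hc'
  exact sub_eq_zero.1 (hSinj _ (by rw [map_sub, hc', sub_self]))

theorem delWord_snoc {α : Type} [DecidableEq α] (c a : α) (w : List α) :
    delWord c (w ++ [a]) = if a = c then Finsupp.single w 1 else 0 := by
  induction w with
  | nil => simp [delWord, one]
  | cons b w ih =>
    rw [List.cons_append, delWord, ih]
    split_ifs <;> simp_all [consL_single]

theorem del_apply {α : Type} [DecidableEq α] (c : α) (x : Words α) (w : List α) :
    del c x w = x (w ++ [c]) := by
  induction x using Finsupp.induction_linear with
  | zero => simp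
  | add x y hx hy => simp [hx, hy]
  | single u q =>
    have h : (Finsupp.single u q : Words α) = q • Finsupp.single u 1 := by simp
    rw [h, map_smul, del_single, Finsupp.smul_apply, Finsupp.smul_apply]
    congr 1
    rcases List.eq_nil_or_concat u with rfl | ⟨v, a, rfl⟩
    · simp [delWord]
    · rw [List.concat_eq_append, delWord_snoc]
      by_cases hac : a = c
      · subst hac
        simp [Finsupp.single_apply]
      · simp [hac]

theorem del_pow_apply {α : Type} [DecidableEq α] (c : α) (n : ℕ) (x : Words α) (w : List α) :
    (del c ^ n) x w = x (w ++ List.replicate n c) := by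
  induction n generalizing x with
  | zero => simp
  | succ n ih =>
    rw [pow_succ, Module.End.mul_apply, ih, del_apply, List.append_assoc, List.replicate_succ']

theorem del_nilpotent {α : Type} [DecidableEq α] (c : α) (x : Words α) :
    ∃ n : ℕ, (del c ^ n) x = 0 := by
  refine ⟨x.support.sup List.length + 1, ?_⟩
  ext w
  rw [del_pow_apply, Finsupp.zero_apply, ← Finsupp.notMem_support_iff]
  intro h
  have := Finset.le_sup (f := List.length) h
  simp only [List.length_append, List.length_replicate] at this
  omega

theorem admissible_snoc (w : Index) (a : ℕ+) : Admissible (w ++ [a]) ↔ a ≠ 1 := by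
  have h : (2 : ℕ+) ≤ a ↔ a ≠ 1 := by
    rw [← PNat.coe_le_coe, Ne, ← PNat.coe_eq_one_iff]
    have := a.pos
    change 2 ≤ (a : ℕ) ↔ _
    omega
  simp [Admissible, h]

theorem del_eq_zero_iff (x : H1) : del 1 x = 0 ↔ ∃ y, incl y = x := by
  constructor
  · intro h
    refine ⟨Finsupp.comapDomain Subtype.val x Subtype.val_injective.injOn, ?_⟩
    refine Finsupp.mapDomain_comapDomain _ Subtype.val_injective x ?_
    intro u hu
    rw [Subtype.range_coe_subtype]
    rcases List.eq_nil_or_concat u with rfl | ⟨v, a, rfl⟩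
    · simp [Admissible]
    · rw [List.concat_eq_append] at hu ⊢
      refine (admissible_snoc v a).2 ?_
      rintro rfl
      have h2 := del_apply 1 x v
      rw [h] at h2
      exact (Finsupp.mem_support_iff.1 hu) h2.symm
  · rintro ⟨y, rfl⟩
    ext w
    rw [del_apply]
    refine Finsupp.mapDomain_of_notMem_range _ _ ?_
    rintro ⟨⟨u, hu⟩, rfl⟩
    exact (admissible_snoc w 1).1 hu rfl

theorem toWord_append (u v : Index) : toWord (u ++ v) = toWord u ++ toWord v := by
  induction u with
  | nil => rfl
  | cons a u ih => simp [toWord, ih]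

theorem toWord_injective : Function.Injective toWord := by
  have key : ∀ (m n : ℕ) (u v : Index),
      List.replicate m (0 : Fin 2) ++ toWord u = List.replicate n 0 ++ toWord v →
      m = n ∧ toWord u = toWord v := by
    intro m
    induction m with
    | zero =>
      intro n u v h
      cases n with
      | zero => exact ⟨rfl, by simpa using h⟩
      | succ n => cases u <;> simp [toWord, List.replicate_succ] at h
    | succ m ih =>
      intro n u v h
      cases n with
      | zero => cases v <;> simp [toWord, List.replicate_succ] at h
      | succ n =>
        simp only [List.replicate_succ, List.cons_append, List.cons.injEq, true_and] at h
        exact ⟨congrArg (· + 1) (ih n u v h).1, (ih n u v h).2⟩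
  intro u
  induction u with
  | nil => intro v h; cases v <;> simp_all [toWord]
  | cons a u ih =>
    intro v h
    cases v with
    | nil => simp [toWord] at h
    | cons b v =>
      simp only [toWord, List.cons_append, List.cons.injEq, true_and] at h
      obtain ⟨h1, h2⟩ := key _ _ _ _ h
      rw [ih h2, PNat.natPred_inj.1 h1]

theorem toPoly_single (w : Index) (q : ℚ) :
    toPoly (Finsupp.single w q) = Finsupp.single (toWord w) q := by
  simp [toPoly]

theorem del_toPoly (x : H1) : del 1 (toPoly x) = toPoly (del 1 x) := by
  induction x using Finsupp.induction_linear with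
  | zero => simp
  | add x y hx hy => simp [hx, hy]
  | single u q =>
    have h : (Finsupp.single u q : H1) = q • Finsupp.single u 1 := by simp
    rw [h]
    simp only [map_smul, toPoly_single, del_single]
    congr 1
    rcases List.eq_nil_or_concat u with rfl | ⟨v, a, rfl⟩
    · simp [delWord, toWord]
    · rw [List.concat_eq_append, delWord_snoc, toWord_append]
      by_cases ha : a = 1
      · subst ha
        simp [toWord, delWord_snoc, toPoly_single]
      · obtain ⟨b, rfl⟩ := PNat.exists_eq_succ_of_ne_one ha
        obtain ⟨c, hc⟩ : ∃ c, (b : ℕ) = c + 1 := ⟨b - 1, by have := b.pos; omega⟩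
        have hb : toWord [b + 1] = (1 :: List.replicate c 0) ++ [0] := by
          simp [toWord, hc, List.replicate_succ']
        rw [hb, ← List.append_assoc, delWord_snoc, if_neg (by decide), if_neg ha, map_zero]

theorem consL_one_mem (x : Poly01) : ∃ z, toPoly z = consL 1 x := by
  have hw : ∀ w : List (Fin 2), ∃ k, toWord k = 1 :: w := by
    intro w
    induction w with
    | nil => exact ⟨[1], rfl⟩
    | cons a w ih =>
      obtain ⟨k, hk⟩ := ih
      match a with
      | 0 =>
        cases k with
        | nil => simp [toWord] at hk
        | cons b k =>
          simp only [toWord, List.cons_append, List.cons.injEq, true_and] at hk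
          refine ⟨(b + 1) :: k, ?_⟩
          obtain ⟨c, hc⟩ : ∃ c, (b : ℕ) = c + 1 := ⟨b - 1, by have := b.pos; omega⟩
          rw [← hk]
          simp [toWord, hc, List.replicate_succ]
      | 1 => exact ⟨1 :: k, by simp [toWord, hk]⟩
  induction x using Finsupp.induction_linear with
  | zero => exact ⟨0, by simp⟩
  | add x y hx hy =>
    obtain ⟨a, ha⟩ := hx
    obtain ⟨b, hb⟩ := hy
    exact ⟨a + b, by rw [map_add, map_add, ha, hb]⟩
  | single w q =>
    obtain ⟨k, hk⟩ := hw w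
    exact ⟨Finsupp.single k q, by rw [toPoly_single, hk, consL_single]⟩

theorem shuffle_toPoly_mem (x y : H1) : ∃ z, toPoly z = shuffle (toPoly x) (toPoly y) := by
  change _ ∈ Set.range toPoly
  rw [← LinearMap.coe_range, SetLike.mem_coe]
  induction x using Finsupp.induction_linear with
  | zero => simp
  | add x x' hx hx' => rw [map_add, map_add, LinearMap.add_apply]; exact add_mem hx hx'
  | single u q =>
    induction y using Finsupp.induction_linear with
    | zero => simp
    | add y y' hy hy' => rw [map_add, map_add]; exact add_mem hy hy'
    | single v r =>
      have h1 : (Finsupp.single u q : H1) = q • Finsupp.single u 1 := by simp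
      have h2 : (Finsupp.single v r : H1) = r • Finsupp.single v 1 := by simp
      rw [h1, h2]
      simp only [map_smul, LinearMap.smul_apply, toPoly_single]
      refine Submodule.smul_mem _ _ (Submodule.smul_mem _ _ ?_)
      rw [shuffle, bilin_single]
      cases u with
      | nil => exact ⟨Finsupp.single v 1, by simp [toPoly_single, toWord, shuffleWord]⟩
      | cons a u =>
        cases v with
        | nil => exact ⟨Finsupp.single (a :: u) 1, by simp [toPoly_single, toWord, shuffleWord]⟩
        | cons b v =>
          simp only [toWord, List.cons_append, shuffleWord]
          exact add_mem (consL_one_mem _) (consL_one_mem _)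

theorem mul_one_of {α : Type} {f : List α → List α → Words α}
    (hf : ∀ u, f u [] = Finsupp.single u 1) (x : Words α) : bilin f x one = x := by
  induction x using Finsupp.induction_linear with
  | zero => simp
  | add x y hx hy => simp [hx, hy]
  | single u q => simp [bilin, one, hf]

theorem one_mul_of {α : Type} {f : List α → List α → Words α}
    (hf : ∀ u, f [] u = Finsupp.single u 1) (x : Words α) : bilin f one x = x := by
  induction x using Finsupp.induction_linear with
  | zero => simp
  | add x y hx hy => simp [hx, hy]
  | single u q => simp [bilin, one, hf]

theorem harmonicWord_nil (u : Index) : harmonicWord u [] = Finsupp.single u 1 := by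
  cases u <;> rw [harmonicWord]

theorem nil_harmonicWord (u : Index) : harmonicWord [] u = Finsupp.single u 1 := by
  rw [harmonicWord]

theorem shuffleWord_nil (u : List (Fin 2)) : shuffleWord u [] = Finsupp.single u 1 := by
  cases u <;> rw [shuffleWord]

theorem nil_shuffleWord (u : List (Fin 2)) : shuffleWord [] u = Finsupp.single u 1 := by
  rw [shuffleWord]

theorem shuffle_consL (a b : Fin 2) (x y : Poly01) :
    shuffle (consL a x) (consL b y)
      = consL a (shuffle x (consL b y)) + consL b (shuffle (consL a x) y) := by
  have h := words_bilin_ext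
    (f := (shuffle.compl₁₂ (consL a) (consL b)))
    (g := (shuffle.compl₁₂ LinearMap.id (consL b)).compr₂ (consL a)
      + (shuffle.compl₁₂ (consL a) LinearMap.id).compr₂ (consL b)) (by
      intro u v
      simp [consL_single, shuffle, bilin_single, shuffleWord])
  simpa using LinearMap.congr_fun₂ h x y

theorem harmonic_consL (a b : ℕ+) (x y : H1) :
    harmonic (consL a x) (consL b y)
      = consL a (harmonic x (consL b y)) + consL b (harmonic (consL a x) y)
        + consL (a + b) (harmonic x y) := by
  have h := words_bilin_ext
    (f := (harmonic.compl₁₂ (consL a) (consL b)))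
    (g := (harmonic.compl₁₂ LinearMap.id (consL b)).compr₂ (consL a)
      + (harmonic.compl₁₂ (consL a) LinearMap.id).compr₂ (consL b)
      + harmonic.compr₂ (consL (a + b))) (by
      intro u v
      simp [consL_single, harmonic, bilin_single, harmonicWord])
  simpa using LinearMap.congr_fun₂ h x y

theorem one_consL_eq {α : Type} [DecidableEq α] (c a : α) (w : List α) :
    delWord c (a :: w) = consL a (delWord c w) + (if w = [] ∧ a = c then (1 : ℚ) else 0) • one := by
  rw [delWord]; split_ifs <;> simp

theorem del_shuffle (x y : Poly01) :
    del 1 (shuffle x y) = shuffle (del 1 x) y + shuffle x (del 1 y) := by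
  have h1x : ∀ x, shuffle one x = x := one_mul_of nil_shuffleWord
  have hx1 : ∀ x, shuffle x one = x := mul_one_of shuffleWord_nil
  have key : ∀ (n : ℕ) (u v : List (Fin 2)), u.length + v.length = n →
      del 1 (shuffleWord u v) = shuffle (delWord 1 u) (Finsupp.single v 1)
        + shuffle (Finsupp.single u 1) (delWord 1 v) := by
    intro n
    induction n using Nat.strong_induction_on with
    | _ n ih =>
      intro u v hn
      match u, v with
      | [], v =>
        have := h1x (delWord 1 v)
        rw [one] at this
        simp [nil_shuffleWord, del_single, delWord, this]
      | a :: u, [] =>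
        have := hx1 (delWord 1 (a :: u))
        rw [one] at this
        simp [shuffleWord_nil, del_single, this, show delWord (1 : Fin 2) [] = 0 from rfl]
      | a :: u, b :: v =>
        simp only [List.length_cons] at hn
        have hnu : (shuffleWord u (b :: v)) [] = if u = [] then 0 else 0 := by
          cases u with
          | nil => simp [nil_shuffleWord]
          | cons => simp [shuffleWord, consL_nil]
        have hnv : (shuffleWord (a :: u) v) [] = 0 := by
          cases v with
          | nil => simp [shuffleWord_nil]
          | cons => simp [shuffleWord, consL_nil]
        rw [shuffleWord, map_add, del_consL, del_consL, hnu, hnv,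
          ih _ (by simp; omega) u (b :: v) rfl, ih _ (by simp; omega) (a :: u) v rfl,
          one_consL_eq, one_consL_eq]
        simp only [ite_self, zero_smul, add_zero, map_add, LinearMap.add_apply, map_smul,
          LinearMap.smul_apply, h1x, hx1]
        rw [← consL_single a u, ← consL_single b v, shuffle_consL, shuffle_consL]
        have hu : ∀ (c : Fin 2) (w : List (Fin 2)) (z : Poly01),
            (if w = [] ∧ c = 1 then (1 : ℚ) else 0) • z
              = (if w = [] ∧ c = 1 then z else 0) := by
          intro c w z; split_ifs <;> simp
        simp only [hu]
        split_ifs <;> simp_all <;> abel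
  have h := words_bilin_ext (f := shuffle.compr₂ (del 1))
    (g := shuffle.compl₁₂ (del 1) LinearMap.id + shuffle.compl₁₂ LinearMap.id (del 1)) (by
      intro u v
      simpa [del_single, shuffle, bilin_single] using key _ u v rfl)
  simpa using LinearMap.congr_fun₂ h x y

theorem del_harmonic (x y : H1) :
    del 1 (harmonic x y) = harmonic (del 1 x) y + harmonic x (del 1 y) := by
  have h1x : ∀ x, harmonic one x = x := one_mul_of nil_harmonicWord
  have hx1 : ∀ x, harmonic x one = x := mul_one_of harmonicWord_nil
  have key : ∀ (n : ℕ) (u v : Index), u.length + v.length = n →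
      del 1 (harmonicWord u v) = harmonic (delWord 1 u) (Finsupp.single v 1)
        + harmonic (Finsupp.single u 1) (delWord 1 v) := by
    intro n
    induction n using Nat.strong_induction_on with
    | _ n ih =>
      intro u v hn
      match u, v with
      | [], v =>
        have := h1x (delWord 1 v)
        rw [one] at this
        simp [nil_harmonicWord, del_single, delWord, this]
      | a :: u, [] =>
        have := hx1 (delWord 1 (a :: u))
        rw [one] at this
        simp [harmonicWord_nil, del_single, this, show delWord (1 : ℕ+) [] = 0 from rfl]
      | a :: u, b :: v =>
        simp only [List.length_cons] at hn
        have hnu : (harmonicWord u (b :: v)) [] = 0 := by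
          cases u with
          | nil => simp [nil_harmonicWord]
          | cons => simp [harmonicWord, consL_nil]
        have hnv : (harmonicWord (a :: u) v) [] = 0 := by
          cases v with
          | nil => simp [harmonicWord_nil]
          | cons => simp [harmonicWord, consL_nil]
        have hab : a + b ≠ 1 := by
          intro h
          have h2 : (a : ℕ) + b = 1 := by exact_mod_cast congrArg PNat.val h
          have := a.pos
          have := b.pos
          omega
        rw [harmonicWord, map_add, map_add, del_consL, del_consL, del_consL, hnu, hnv,
          ih _ (by simp; omega) u (b :: v) rfl, ih _ (by simp; omega) (a :: u) v rfl,
          ih _ (by omega) u v rfl, one_consL_eq, one_consL_eq]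
        simp only [hab, if_false, ite_self, zero_smul, add_zero, map_add, LinearMap.add_apply,
          map_smul, LinearMap.smul_apply, h1x, hx1]
        rw [← consL_single a u, ← consL_single b v, harmonic_consL, harmonic_consL]
        have hu : ∀ (c : ℕ+) (w : Index) (z : H1),
            (if w = [] ∧ c = 1 then (1 : ℚ) else 0) • z
              = (if w = [] ∧ c = 1 then z else 0) := by
          intro c w z; split_ifs <;> simp
        simp only [hu]
        split_ifs <;> simp_all <;> abel
  have h := words_bilin_ext (f := harmonic.compr₂ (del 1))
    (g := harmonic.compl₁₂ (del 1) LinearMap.id + harmonic.compl₁₂ LinearMap.id (del 1)) (by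
      intro u v
      simpa [del_single, harmonic, bilin_single] using key _ u v rfl)
  simpa using LinearMap.congr_fun₂ h x y

/-- Every `a ∈ ℌ¹` is uniquely `∑ aᵢ * e₁^{*i}` with `aᵢ ∈ ℌ⁰`. -/
theorem existsUnique_harmonic (a : H1) :
    ∃! c : ℕ →₀ H0, a = c.sum fun i x =>
      harmonic (incl x) (powWith harmonic (Finsupp.single [1] 1) i) := by
  have h := unique_expression harmonic (Finsupp.single [1] 1) LinearMap.id
    Function.injective_id (del 1) (mul_one_of harmonicWord_nil)
    (by rw [one, del_single]; rfl) (by rw [del_single]; simp [delWord])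
    (one_mul_of nil_harmonicWord _) del_harmonic (del 1) (fun _ => rfl) del_eq_zero_iff
    (del_nilpotent 1) (fun x y => ⟨_, rfl⟩) ⟨_, rfl⟩ ⟨_, rfl⟩ a
  exact h

/-- Every `a ∈ ℌ¹` is uniquely `∑ aᵢ ш e₁^{ш i}` with `aᵢ ∈ ℌ⁰`. -/
theorem existsUnique_shuffle (a : H1) :
    ∃! c : ℕ →₀ H0, toPoly a = c.sum fun i x =>
      shuffle (toPoly (incl x)) (powWith shuffle (Finsupp.single [1] 1) i) :=
  unique_expression shuffle (Finsupp.single [1] 1) toPoly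
    (Finsupp.mapDomain_injective toWord_injective) (del 1) (mul_one_of shuffleWord_nil)
    (by rw [one, del_single]; rfl) (by rw [del_single]; simp [delWord])
    (one_mul_of nil_shuffleWord _) del_shuffle (del 1) del_toPoly del_eq_zero_iff
    (del_nilpotent 1) shuffle_toPoly_mem
    ⟨one, by simp [one, toPoly_single, toWord]⟩
    ⟨Finsupp.single [1] 1, by simp [toPoly_single, toWord]⟩ a

end Regularization
/-- The two kinds of regularization of multiple zeta values. -/
inductive Reg
  | harmonic
  | shuffle

/-- The regularization map `reg_• : ℌ¹ → ℌ⁰`, which sends `a = ∑ aᵢ • e₁^{•i}` to `a₀`. -/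
noncomputable def regMap : Reg → H1 → H0
  | .harmonic, a => (existsUnique_harmonic a).choose 0
  | .shuffle, a => (existsUnique_shuffle a).choose 0

/-- The `ℚ`-linear map `Z : ℌ⁰ → 𝒵` with `Z(e_k) = ζ(k)` for every admissible index `k`. -/
noncomputable def zMap : H0 →ₗ[ℚ] MZAlg := Finsupp.linearCombination ℚ mzvMem

/-- The regularized multiple zeta value `ζ^•(k) = Z(reg_•(e_k)) ∈ 𝒵`. -/
noncomputable def mzvReg (ρ : Reg) (k : Index) : MZAlg := zMap (regMap ρ (Finsupp.single k 1))

/-! ## Symmetric multiple zeta values -/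

/-- The entrywise sum of an index and a tuple of non-negative integers. -/
def shift (k : Index) (l : Fin k.length → ℕ) : Index :=
  List.ofFn fun j => ⟨(k.get j : ℕ) + l j, Nat.add_pos_left (k.get j).pos _⟩

/-- The power series `ζ^•_Ŝ(k) ∈ 𝒵⟦t⟧`, that is,
`∑_{i=0}^r (-1)^{k_{i+1}+⋯+k_r} ζ^•(k₁, …, k_i)
  ∑_{l_{i+1}, …, l_r ≥ 0} (∏_j C(k_j+l_j-1, l_j)) ζ^•(k_r+l_r, …, k_{i+1}+l_{i+1}) t^{l_{i+1}+⋯+l_r}`. -/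
noncomputable def zetaSHatLift (ρ : Reg) (k : Index) : PowerSeries MZAlg :=
  PowerSeries.mk fun m => ∑ i ∈ Finset.range (k.length + 1),
    (-1) ^ ((k.drop i).map PNat.val).sum * mzvReg ρ (k.take i) *
      ∑ l ∈ Finset.Nat.antidiagonalTuple (k.drop i).length m,
        (∏ j, ((((k.drop i).get j : ℕ) + l j - 1).choose (l j) : MZAlg)) *
          mzvReg ρ (shift (k.drop i) l).reverse

/-- The `Ŝ`-multiple zeta value: the class of `ζ^•_Ŝ(k)` in `(𝒵/ζ(2)𝒵)⟦t⟧`. -/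
noncomputable def zetaSHat (ρ : Reg) (k : Index) : PowerSeries MZBar :=
  PowerSeries.map (Ideal.Quotient.mk _) (zetaSHatLift ρ k)

/-- The list of all indices `k₁ □ ⋯ □ k_r` with each `□` a comma or a plus sign. -/
def merges : Index → List Index
  | [] => [[]]
  | [a] => [[a]]
  | a :: b :: w => (merges (b :: w)).map (List.cons a) ++ merges ((a + b) :: w)
termination_by k => k.length

/-- The `Ŝ`-multiple zeta-star value. -/
noncomputable def zetaSHatStar (ρ : Reg) (k : Index) : PowerSeries MZBar :=
  ((merges k).map (zetaSHat ρ)).sum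

/-- The ring `(𝒵/ζ(2)𝒵)⟦t⟧ / (t^n)`. -/
abbrev SRing (n : ℕ) : Type :=
  PowerSeries MZBar ⧸ Ideal.span {(PowerSeries.X : PowerSeries MZBar) ^ n}

/-- The `𝒮_n`-multiple zeta value, by means of the regularization `ρ`. -/
noncomputable def zetaS (ρ : Reg) (n : ℕ) (k : Index) : SRing n :=
  Ideal.Quotient.mk _ (zetaSHat ρ k)

/-- The `𝒮_n`-multiple zeta-star value, by means of the regularization `ρ`. -/
noncomputable def zetaSStar (ρ : Reg) (n : ℕ) (k : Index) : SRing n :=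
  Ideal.Quotient.mk _ (zetaSHatStar ρ k)

/-- `𝔷_{𝒮_n}(k) = ζ(k) mod ζ(2)`, for `k ≥ 2`. -/
noncomputable def frakZS (n : ℕ) (k : ℕ+) : SRing n :=
  Ideal.Quotient.mk _ (PowerSeries.C (Ideal.Quotient.mk _ (zetaMem k)))

/-- `x_{𝒮_n} = t mod t^n`. -/
noncomputable def xS (n : ℕ) : SRing n := Ideal.Quotient.mk _ PowerSeries.X

/-! ## Finite multiple zeta values -/

/-- `∏_p ℤ/p^nℤ` over all primes `p`. -/
abbrev AProd (n : ℕ) : Type := (p : Nat.Primes) → ZMod ((p : ℕ) ^ n)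

/-- The ideal `⊕_p ℤ/p^nℤ` of `∏_p ℤ/p^nℤ`. -/
def finiteIdeal (n : ℕ) : Ideal (AProd n) where
  carrier := {f | {p | f p ≠ 0}.Finite}
  zero_mem' := by simp
  add_mem' {f g} hf hg := (Set.Finite.union hf hg).subset fun p hp => by
    by_contra h
    simp only [Set.mem_union, Set.mem_ofPred_eq, not_or, not_not] at h
    exact hp (by simp [h.1, h.2])
  smul_mem' c f hf := Set.Finite.subset hf fun p hp h => hp (by simp [h])

/-- The ring `𝒜_n = ∏_p ℤ/p^nℤ / ⊕_p ℤ/p^nℤ`. -/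
abbrev ARing (n : ℕ) : Type := AProd n ⧸ finiteIdeal n

theorem isUnit_intCast (n : ℕ) (m : ℤ) (hm : m ≠ 0) : IsUnit ((m : ℤ) : ARing n) := by
  refine IsUnit.of_mul_eq_one
    (Ideal.Quotient.mk (finiteIdeal n) fun p => ((m : ℤ) : ZMod ((p : ℕ) ^ n))⁻¹) ?_
  rw [← map_intCast (Ideal.Quotient.mk (finiteIdeal n)), ← map_mul,
    ← map_one (Ideal.Quotient.mk (finiteIdeal n)), Ideal.Quotient.eq]
  refine Set.Finite.subset (Set.Finite.preimage (f := fun p : Nat.Primes => (p : ℕ))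
    Nat.Primes.coe_nat_injective.injOn (Set.finite_le_nat m.natAbs)) fun p hp => ?_
  by_contra hlt
  refine hp ?_
  have hcop : IsUnit ((m : ℤ) : ZMod ((p : ℕ) ^ n)) := by
    rw [ZMod.coe_int_isUnit_iff_isCoprime]
    push_cast
    refine IsCoprime.pow_left ((Prime.coprime_iff_not_dvd (Nat.prime_iff_prime_int.1 p.2)).2 ?_)
    intro hdvd
    exact hlt (Nat.le_of_dvd (Int.natAbs_pos.2 hm) (Int.natCast_dvd.1 hdvd))
  change ((m : ℤ) : AProd n) p * ((m : ℤ) : ZMod ((p : ℕ) ^ n))⁻¹ - 1 = 0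
  rw [Pi.intCast_apply, ZMod.mul_inv_of_unit _ hcop, sub_self]

/-- Nonzero integers are invertible in `𝒜_n`, so it is a `ℚ`-algebra (in a unique way). -/
noncomputable instance algebraARing (n : ℕ) : Algebra ℚ (ARing n) :=
  (IsLocalization.lift (M := nonZeroDivisors ℤ) (S := ℚ) (g := Int.castRingHom (ARing n))
    fun y => isUnit_intCast n y (nonZeroDivisors.coe_ne_zero y)).toAlgebra

/-- The `𝒜_n`-multiple zeta value
`(∑_{0 < n₁ < ⋯ < n_r < p} 1 / (n₁^{k₁} ⋯ n_r^{k_r}) mod p^n)_p`. -/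
def zetaA (n : ℕ) (k : Index) : ARing n :=
  Ideal.Quotient.mk _ fun p =>
    ∑ m ∈ (Fintype.piFinset fun _ : Fin k.length => Finset.Ioo 0 (p : ℕ)).filter
        (fun m => ∀ i j, i < j → m i < m j),
      ∏ i, ((m i : ZMod ((p : ℕ) ^ n)) ^ (k.get i : ℕ))⁻¹

/-- The `𝒜_n`-multiple zeta-star value
`(∑_{1 ≤ n₁ ≤ ⋯ ≤ n_r ≤ p-1} 1 / (n₁^{k₁} ⋯ n_r^{k_r}) mod p^n)_p`. -/
def zetaAStar (n : ℕ) (k : Index) : ARing n :=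
  Ideal.Quotient.mk _ fun p =>
    ∑ m ∈ (Fintype.piFinset fun _ : Fin k.length => Finset.Ioo 0 (p : ℕ)).filter
        (fun m => ∀ i j, i ≤ j → m i ≤ m j),
      ∏ i, ((m i : ZMod ((p : ℕ) ^ n)) ^ (k.get i : ℕ))⁻¹

/-- The residue class in `ℤ/mℤ` of a rational number with denominator prime to `m`. -/
def ratMod (m : ℕ) (q : ℚ) : ZMod m := (q.num : ZMod m) * (q.den : ZMod m)⁻¹

/-- `𝔷_{𝒜_n}(k) = (B_{p^{n-1}(p-1)-k+1} / (k-1+p^{n-1}) mod p^n)_p`, for `n ≥ 1` and `k ≥ 2`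
(the finitely many primes for which this makes no sense do not matter). -/
def frakZA (n : ℕ) (k : ℕ+) : ARing n :=
  Ideal.Quotient.mk _ fun p =>
    ratMod ((p : ℕ) ^ n)
      (bernoulli ((p : ℕ) ^ (n - 1) * ((p : ℕ) - 1) + 1 - k) / ((k : ℚ) - 1 + (p : ℚ) ^ (n - 1)))

/-- `x_{𝒜_n} = (p mod p^n)_p`. -/
def xA (n : ℕ) : ARing n := Ideal.Quotient.mk _ fun p => ((p : ℕ) : ZMod ((p : ℕ) ^ n))

end FMZV

section

open Finset

/-! Both cases follow one pattern: a product relation and a reversal relation express the depth-two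
value through depth-two values of odd weight k + 1, multiplied by x, and these are rational
multiples of a single depth-one value.

For 𝒜, let H(a) and H(a, b) be the truncated sums modulo p². The harmonic product gives H(k₁) H(k₂)
= H(k₁, k₂) + H(k₂, k₁) + H(k), and the left side is 0 because p divides both factors when p is
large. The substitution m ↦ p - m, expanded to first order in p, gives H(k₁, k₂) = H(k₂, k₁) + p (k₁
H(k₂, k₁+1) + k₂ H(k₂+1, k₁)), as k is even. Adding the two eliminates H(k₂, k₁)
(`two_mul_doubleSum`). The sums of weight k + 1 matter only modulo p, where Faulhaber's formula
turns them into binomial multiples of B_{p-1-k} / (k+1) (`weight_mul_doubleSum`). With Z =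
B_{p(p-1)-k} / (k+p) one has H(k) = k p Z (`powerSum_eq_mul_ratMod`), and a Kummer congruence links
the two Bernoulli numbers (`kummer_powerSum`).

For 𝒮, the constant coefficient vanishes by the harmonic product modulo ζ(2). The coefficient of t
is k₂ ζ(k₂+1, k₁) + k₁ ζ(k₂, k₁+1), the same combination as above; it is evaluated by the parity
theorem in depth two (`two_mul_barPair`). Modulo ζ(2) the double shuffle relations of odd weight
have no product terms. For the generating polynomial F(A, B) they become functional equations under
(A, B) ↦ (B, A) and (A, B) ↦ (B - A, B). These maps generate a finite group containing -1, and going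
round an orbit determines F (`generating_closed_form`). Both regularizations satisfy these relations
modulo ζ(2), by Euler's sum formula `sum_doubleZeta`.

In both cases the star value adds the depth-one value of weight k, which is k Z x with Z = 𝔷(k+1),
and this changes -k into k. -/

theorem sum_Ioo_natCast_pow (p : ℕ) [Fact p.Prime] (l : ℕ) :
    ∑ m ∈ Ioo 0 p, (m : ZMod p) ^ l = if p - 1 ∣ l then -1 else 0 := by
  have hbij : ∑ m ∈ Ioo 0 p, (m : ZMod p) ^ l = ∑ u : (ZMod p)ˣ, (u : ZMod p) ^ l :=
    Finset.sum_bij'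
      (fun v hv ↦ Units.mk0 (v : ZMod p) (mt (ZMod.natCast_eq_zero_iff v p).mp
        (Nat.not_dvd_of_pos_of_lt (mem_Ioo.1 hv).1 (mem_Ioo.1 hv).2)))
      (fun u _ ↦ (u : ZMod p).val)
      (fun _ _ ↦ Finset.mem_univ _)
      (fun u _ ↦ mem_Ioo.2 ⟨Nat.pos_of_ne_zero ((ZMod.val_ne_zero _).2 u.ne_zero), ZMod.val_lt _⟩)
      (fun v hv ↦ by simp [ZMod.val_cast_of_lt (Finset.mem_Ioo.mp hv).2])
      (fun u _ ↦ Units.ext (ZMod.natCast_zmod_val _))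
      (fun _ _ ↦ rfl)
  rw [hbij, FiniteField.sum_pow_units, ZMod.card]

/-! ### p-adic integrality of Bernoulli numbers, and power sums modulo p². -/

section Bernoulli

variable {p : ℕ} [hp : Fact p.Prime]

theorem padic_norm_sub_le_max (x y : ℚ_[p]) : ‖x - y‖ ≤ max ‖x‖ ‖y‖ := by
  rw [sub_eq_add_neg, ← norm_neg y]
  exact IsUltrametricDist.norm_add_le_max _ _

theorem padic_norm_natCast_eq_one {m : ℕ} (h : ¬ p ∣ m) : ‖(m : ℚ_[p])‖ = 1 := by
  rw [Padic.norm_natCast_eq_one_iff]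
  exact (Nat.Prime.coprime_iff_not_dvd hp.out).2 h

/-- Von Staudt–Clausen: for even j only primes q with q - 1 ∣ j occur in the denominator. The only
nonzero value at odd j is at j = 1, with denominator 2, and p is odd. -/
theorem padic_norm_bernoulli_le_one (hp2 : 2 < p) {j : ℕ} (hj : j = 0 ∨ ¬ p - 1 ∣ j) :
    ‖((bernoulli j : ℚ) : ℚ_[p])‖ ≤ 1 := by
  rcases hj with rfl | hj
  · simp
  rcases Nat.even_or_odd' j with ⟨k, rfl | rfl⟩
  · obtain ⟨n, hn⟩ := Bernoulli.vonStaudt_clausen k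
    rw [eq_sub_iff_add_eq.2 hn.symm]
    push_cast
    refine (padic_norm_sub_le_max _ _).trans (max_le (Padic.norm_int_le_one n) ?_)
    refine IsUltrametricDist.norm_sum_le_of_forall_le_of_nonneg zero_le_one fun q hq => ?_
    simp only [mem_filter] at hq
    rw [norm_div, norm_one, padic_norm_natCast_eq_one, div_one]
    intro h
    rw [Nat.prime_dvd_prime_iff_eq hp.out hq.2.1] at h
    exact hj (h ▸ hq.2.2)
  · rcases Nat.eq_zero_or_pos k with rfl | hk
    · have : ‖((2 : ℕ) : ℚ_[p])‖ = 1 := padic_norm_natCast_eq_one fun h => by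
        have := Nat.le_of_dvd two_pos h
        omega
      have h2 : ‖(2 : ℚ_[p])‖ = 1 := by exact_mod_cast this
      simp [h2]
    · rw [bernoulli_eq_zero_of_odd ⟨k, rfl⟩ (by omega)]
      simp

/-- In von Staudt–Clausen each 1/q occurs only once, so a single factor p clears the denominator. -/
theorem padic_norm_prime_mul_bernoulli_le_one (hp2 : 2 < p) (j : ℕ) :
    ‖(p : ℚ_[p]) * (bernoulli j : ℚ)‖ ≤ 1 := by
  by_cases hj : p - 1 ∣ j
  · have he : Even j := (Nat.Odd.sub_odd (hp.out.odd_of_ne_two (by omega)) odd_one).trans_dvd hj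
    obtain ⟨k, rfl⟩ := he.two_dvd
    obtain ⟨n, hn⟩ := Bernoulli.vonStaudt_clausen k
    rw [eq_sub_iff_add_eq.2 hn.symm]
    push_cast
    rw [mul_sub, mul_sum]
    refine (padic_norm_sub_le_max _ _).trans (max_le ?_ ?_)
    · exact_mod_cast Padic.norm_int_le_one (p := p) ((p : ℤ) * n)
    refine IsUltrametricDist.norm_sum_le_of_forall_le_of_nonneg zero_le_one fun q hq => ?_
    simp only [mem_filter] at hq
    by_cases h : p ∣ q
    · rw [Nat.prime_dvd_prime_iff_eq hp.out hq.2.1] at h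
      subst h
      rw [mul_one_div_cancel (by exact_mod_cast hp.out.ne_zero), norm_one]
    · rw [norm_mul, norm_div, norm_one, padic_norm_natCast_eq_one h, div_one, mul_one]
      exact Padic.norm_p_lt_one.le
  · rw [norm_mul]
    exact mul_le_one₀ Padic.norm_p_lt_one.le (norm_nonneg _)
      (padic_norm_bernoulli_le_one hp2 (.inr hj))

/-- Since j + 1 < 5^(j-1) ≤ p^(j-1), the valuation of j + 1 is at most j - 2. For p = 3 and j = 2
the bound fails, hence the hypothesis `5 ≤ p`. -/
theorem padic_norm_pow_div_succ_le (hp5 : 5 ≤ p) {j : ℕ} (hj : 2 ≤ j) :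
    ‖(p : ℚ_[p]) ^ j / (j + 1 : ℕ)‖ ≤ (p : ℝ) ^ (-2 : ℤ) := by
  have hlt : j + 1 < p ^ (j - 1) := by
    obtain ⟨i, rfl⟩ := Nat.exists_eq_add_of_le hj
    refine lt_of_lt_of_le ?_ (Nat.pow_le_pow_left hp5 _)
    induction i with
    | zero => norm_num
    | succ i ih =>
      have := ih (by omega)
      rw [show 2 + (i + 1) - 1 = (2 + i - 1) + 1 by omega, pow_succ]
      omega
  have hv : padicValNat p (j + 1) ≤ j - 2 := by
    have h1 : p ^ padicValNat p (j + 1) ≤ j + 1 := Nat.le_of_dvd (by omega) pow_padicValNat_dvd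
    have := (Nat.pow_lt_pow_iff_right (by omega : 1 < p)).1 (h1.trans_lt hlt)
    omega
  have hp0 : (1 : ℝ) < p := by exact_mod_cast hp.out.one_lt
  rw [norm_div, norm_pow, Padic.norm_p, Padic.norm_eq_zpow_neg_valuation (by exact_mod_cast Nat.succ_ne_zero j),
    Padic.valuation_natCast, ← zpow_natCast, inv_zpow', ← zpow_sub₀ (by positivity)]
  apply zpow_le_zpow_right₀ hp0.le
  omega

/-- `∑_{n<p} n^M ≡ p B_M` modulo `p²` for even `M ≥ 4`. -/
theorem padic_norm_sum_pow_sub_le (hp5 : 5 ≤ p) {M : ℕ} (hM : 4 ≤ M) (hMe : Even M) :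
    ‖∑ n ∈ range p, (n : ℚ_[p]) ^ M - p * (bernoulli M : ℚ)‖ ≤ (p : ℝ) ^ (-2 : ℤ) := by
  have hp0 : (1 : ℝ) < p := by exact_mod_cast hp.out.one_lt
  -- Faulhaber's formula indexed by the distance j from the top Bernoulli number: one factor p makes
  -- p B_{M-j} integral, and p^j / (j+1) governs the size of the term.
  have h1 : ∑ n ∈ range p, (n : ℚ) ^ M = ∑ j ∈ range (M + 1),
      (M.choose j : ℚ) * (p * bernoulli (M - j)) * (p ^ j / (j + 1 : ℕ)) := by
    rw [sum_range_pow, ← sum_range_reflect]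
    refine sum_congr rfl fun j hj => ?_
    have hj : j ≤ M := by simpa [Nat.lt_succ_iff] using hj
    rw [show M + 1 - 1 - j = M - j by omega, show M + 1 - (M - j) = j + 1 by omega]
    have h2 : ((M + 1).choose (M - j) : ℚ) * (j + 1) = (M + 1) * M.choose j := by
      have := Nat.add_one_mul_choose_eq M j
      rw [← Nat.choose_symm_of_eq_add (show M + 1 = (M - j) + (j + 1) by omega)] at this
      exact_mod_cast this.symm
    have h3 : ((M + 1).choose (M - j) : ℚ) = (M + 1) * M.choose j / (j + 1) := by
      rw [eq_div_iff (by positivity), h2]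
    rw [h3]
    push_cast
    rw [pow_succ]
    field_simp
  obtain ⟨N, rfl⟩ : ∃ N, M = N + 1 := ⟨M - 1, by omega⟩
  -- The term j = 0 is p B_M, and the term j = 1 vanishes because M - 1 is odd and exceeds 1. All
  -- others are divisible by p².
  rw [sum_range_succ', sum_range_succ'] at h1
  simp only [zero_add, Nat.add_sub_cancel] at h1
  rw [bernoulli_eq_zero_of_odd (n := N) (by
    rcases Nat.even_or_odd N with h | h
    · exact absurd hMe (by simpa [Nat.even_add_one] using h)
    · exact h) (by omega)] at h1
  have h2 : ∑ n ∈ range p, (n : ℚ_[p]) ^ (N + 1) - p * (bernoulli (N + 1) : ℚ)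
      = ∑ j ∈ range N, ((N + 1).choose (j + 1 + 1) : ℚ_[p])
        * (p * (bernoulli (N + 1 - (j + 1 + 1)) : ℚ)) * (p ^ (j + 2) / (j + 2 + 1 : ℕ)) := by
    have h3 := congrArg (Rat.cast : ℚ → ℚ_[p]) h1
    push_cast at h3
    rw [h3]
    norm_num [add_assoc, Nat.add_sub_add_right]
  rw [h2]
  refine IsUltrametricDist.norm_sum_le_of_forall_le_of_nonneg (by positivity) fun j _ => ?_
  rw [norm_mul, norm_mul]
  have h4 := padic_norm_pow_div_succ_le hp5 (show 2 ≤ j + 2 by omega)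
  have h5 := padic_norm_prime_mul_bernoulli_le_one (by omega : 2 < p) (N + 1 - (j + 1 + 1))
  have h6 : ‖((N + 1).choose (j + 1 + 1) : ℚ_[p])‖ ≤ 1 := by
    exact_mod_cast Padic.norm_int_le_one (p := p) ((N + 1).choose (j + 1 + 1) : ℕ)
  calc _ ≤ 1 * (p : ℝ) ^ (-2 : ℤ) := by
        gcongr
        exact mul_le_one₀ h6 (norm_nonneg _) h5
    _ = _ := one_mul _

/-- Identities between p-integral rationals can then be checked in ℚ_p and carried to residues by a
ring homomorphism. -/
theorem ratMod_eq_toZModPow (n : ℕ) (q : ℚ) (h : ‖(q : ℚ_[p])‖ ≤ 1) :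
    FMZV.ratMod (p ^ n) q = PadicInt.toZModPow n ⟨(q : ℚ_[p]), h⟩ := by
  have hden : ¬ p ∣ q.den := 
    Rat.padicValuation_le_one_iff.1 ((Padic.norm_rat_le_one_iff_padicValuation_le_one p).1 h)
  have hu : IsUnit ((q.den : ℕ) : ZMod (p ^ n)) := by
    rw [ZMod.isUnit_iff_coprime]
    exact (((Nat.Prime.coprime_iff_not_dvd hp.out).2 hden).symm).pow_right n
  set y : ℤ_[p] := ⟨(q : ℚ_[p]), h⟩ with hy
  have h1 : y * ((q.den : ℕ) : ℤ_[p]) = ((q.num : ℤ) : ℤ_[p]) := by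
    apply Subtype.ext
    push_cast
    change (q : ℚ_[p]) * _ = _
    exact_mod_cast congrArg (Rat.cast : ℚ → ℚ_[p]) (Rat.mul_den_eq_num q)
  have h2 := congrArg (PadicInt.toZModPow n) h1
  rw [map_mul, map_natCast, map_intCast] at h2
  rw [FMZV.ratMod, ← h2, mul_assoc, ZMod.mul_inv_of_unit _ hu, mul_one]

theorem toZModPow_two_eq_of_norm_sub_le {x y : ℤ_[p]}
    (h : ‖(x : ℚ_[p]) - y‖ ≤ (p : ℝ) ^ (-2 : ℤ)) :
    PadicInt.toZModPow 2 x = PadicInt.toZModPow 2 y := by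
  rw [← sub_eq_zero, ← map_sub, ← RingHom.mem_ker, PadicInt.ker_toZModPow,
    ← PadicInt.norm_le_pow_iff_mem_span_pow, PadicInt.norm_def]
  exact_mod_cast h

/-- The Bernoulli number `B_j` as a `p`-adic integer, for `p - 1 ∤ j`. -/
noncomputable def bernoulliInt (hp2 : 2 < p) (j : ℕ) (hj : j = 0 ∨ ¬ p - 1 ∣ j) : ℤ_[p] :=
  ⟨((bernoulli j : ℚ) : ℚ_[p]), padic_norm_bernoulli_le_one hp2 hj⟩

theorem coe_bernoulliInt (hp2 : 2 < p) (j : ℕ) (hj : j = 0 ∨ ¬ p - 1 ∣ j) :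
    (bernoulliInt hp2 j hj : ℚ_[p]) = (bernoulli j : ℚ) := rfl

theorem sum_Ioo_pow_eq_prime_mul_bernoulliInt (hp5 : 5 ≤ p) {M : ℕ} (hM : 4 ≤ M) (hMe : Even M)
    (hj : M = 0 ∨ ¬ p - 1 ∣ M) :
    ∑ n ∈ Ioo 0 p, (n : ZMod (p ^ 2)) ^ M
      = p * PadicInt.toZModPow 2 (bernoulliInt (by omega) M hj) := by
  have h := toZModPow_two_eq_of_norm_sub_le (p := p) (x := ∑ n ∈ range p, (n : ℤ_[p]) ^ M)
    (y := p * bernoulliInt (by omega) M hj) (by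
      have := padic_norm_sum_pow_sub_le hp5 hM hMe
      simpa [PadicInt.coe_sum, coe_bernoulliInt] using this)
  simp only [map_sum, map_mul, map_pow, map_natCast] at h
  rw [← h]
  refine sum_subset (fun x hx => by simp at hx ⊢; omega) fun x hx hx' => ?_
  have : x = 0 := by simp at hx hx'; omega
  subst this
  rw [Nat.cast_zero, zero_pow (by omega)]

end Bernoulli

/-! ### Relations between truncated zeta sums modulo p². -/

section FiniteSums

variable {p : ℕ} [hp : Fact p.Prime]

theorem isUnit_natCast_of_mem_Ioo {n m : ℕ} (hm : m ∈ Ioo 0 p) : IsUnit (m : ZMod (p ^ n)) := by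
  rw [mem_Ioo] at hm
  rw [ZMod.isUnit_iff_coprime]
  exact ((Nat.Prime.coprime_iff_not_dvd hp.out).2
    (Nat.not_dvd_of_pos_of_lt hm.1 hm.2)).symm.pow_right n

theorem ZMod.inv_pow_of_isUnit {N : ℕ} {x : ZMod N} (hx : IsUnit x) (a : ℕ) :
    (x ^ a)⁻¹ = x⁻¹ ^ a :=
  ZMod.inv_eq_of_mul_eq_one _ _ _ (by rw [← mul_pow, ZMod.mul_inv_of_unit _ hx, one_pow])

/-- The truncated zeta sum `∑_{0<m<p} m^{-a}` modulo `N`. -/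
def powerSum (N p a : ℕ) : ZMod N := ∑ m ∈ Ioo 0 p, (m : ZMod N)⁻¹ ^ a

/-- The truncated double zeta sum `∑_{0<m<n<p} m^{-a} n^{-b}` modulo `N`. -/
def doubleSum (N p a b : ℕ) : ZMod N :=
  ∑ x ∈ (Ioo 0 p ×ˢ Ioo 0 p) with x.1 < x.2, (x.1 : ZMod N)⁻¹ ^ a * (x.2 : ZMod N)⁻¹ ^ b

theorem powerSum_add_eq_sum (N p a b : ℕ) :
    powerSum N p (a + b) = ∑ x ∈ (Ioo 0 p ×ˢ Ioo 0 p) with x.1 = x.2,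
      (x.1 : ZMod N)⁻¹ ^ a * (x.2 : ZMod N)⁻¹ ^ b := by
  refine sum_nbij' (fun m => (m, m)) Prod.fst ?_ ?_ ?_ ?_ ?_
  · simp
  · simp +contextual
  · simp
  · rintro ⟨m, n⟩ h
    simp at h ⊢
    exact h.2
  · intro m _
    exact pow_add _ _ _

theorem powerSum_mul_powerSum (N p a b : ℕ) :
    powerSum N p a * powerSum N p b
      = doubleSum N p a b + doubleSum N p b a + powerSum N p (a + b) := by
  have h1 : doubleSum N p b a = ∑ x ∈ (Ioo 0 p ×ˢ Ioo 0 p) with x.2 < x.1,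
      (x.1 : ZMod N)⁻¹ ^ a * (x.2 : ZMod N)⁻¹ ^ b := by
    refine sum_nbij' Prod.swap Prod.swap ?_ ?_ ?_ ?_ ?_
    · simp +contextual
    · simp +contextual
    · simp
    · simp
    · intro x _
      exact mul_comm _ _
  rw [h1, powerSum_add_eq_sum, doubleSum, powerSum, powerSum, sum_mul_sum, ← sum_product']
  simp only [sum_filter, ← sum_add_distrib]
  refine sum_congr rfl fun x _ => ?_
  rcases lt_trichotomy x.1 x.2 with h | h | h
  · simp [h, h.not_gt, h.ne]
  · simp [h]
  · simp [h, h.not_gt, h.ne']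

theorem ZMod.prime_mul_prime_eq_zero (p : ℕ) : (p : ZMod (p ^ 2)) * p = 0 := by
  rw [← pow_two]
  exact_mod_cast ZMod.natCast_self (p ^ 2)

theorem one_add_pow_of_sq_zero {R : Type*} [CommRing R] {x : R} (h : x * x = 0) (a : ℕ) :
    (1 + x) ^ a = 1 + a * x := by
  induction a with
  | zero => simp
  | succ a ih =>
    rw [pow_succ, ih]
    push_cast
    linear_combination (a : R) * h

/-- The geometric series of 1/(p - m) = -m⁻¹ (1 - p/m)⁻¹ stops after its linear term because p² = 0.
-/
theorem inv_natCast_sub_pow {m : ℕ} (hm : m ∈ Ioo 0 p) (a : ℕ) :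
    ((p - m : ℕ) : ZMod (p ^ 2))⁻¹ ^ a
      = (-1) ^ a * ((m : ZMod (p ^ 2))⁻¹ ^ a * (1 + (a : ZMod (p ^ 2)) * ((p : ZMod (p ^ 2)) * (m : ZMod (p ^ 2))⁻¹))) := by
  have h0 := ZMod.prime_mul_prime_eq_zero p
  have h1 := ZMod.mul_inv_of_unit _ (isUnit_natCast_of_mem_Ioo (n := 2) hm)
  have h2 : ((p - m : ℕ) : ZMod (p ^ 2))⁻¹
      = -1 * ((m : ZMod (p ^ 2))⁻¹ * (1 + p * (m : ZMod (p ^ 2))⁻¹)) := by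
    apply ZMod.inv_eq_of_mul_eq_one
    rw [Nat.cast_sub (mem_Ioo.1 hm).2.le]
    linear_combination (-(m : ZMod (p ^ 2))⁻¹ ^ 2) * h0
      + (1 + p * (m : ZMod (p ^ 2))⁻¹) * h1
  rw [h2, mul_pow, mul_pow, one_add_pow_of_sq_zero]
  linear_combination (m : ZMod (p ^ 2))⁻¹ ^ 2 * h0

/-- The map m ↦ p - m reverses the order of the two variables. Each factor contributes a first-order
correction in p, and the product of both corrections carries p² = 0. -/
theorem doubleSum_reflect (a b : ℕ) :
    doubleSum (p ^ 2) p a b = (-1) ^ (a + b) * (doubleSum (p ^ 2) p b a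
      + (p : ZMod (p ^ 2)) * ((a : ZMod (p ^ 2)) * doubleSum (p ^ 2) p b (a + 1)
        + (b : ZMod (p ^ 2)) * doubleSum (p ^ 2) p (b + 1) a)) := by
  have h0 := ZMod.prime_mul_prime_eq_zero p
  have h1 : doubleSum (p ^ 2) p a b = ∑ x ∈ (Ioo 0 p ×ˢ Ioo 0 p) with x.1 < x.2,
      ((p - x.2 : ℕ) : ZMod (p ^ 2))⁻¹ ^ a * ((p - x.1 : ℕ) : ZMod (p ^ 2))⁻¹ ^ b := by
    refine sum_nbij' (fun x => (p - x.2, p - x.1)) (fun x => (p - x.2, p - x.1)) ?_ ?_ ?_ ?_ ?_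
    · rintro ⟨m, n⟩ h; simp at h ⊢; omega
    · rintro ⟨m, n⟩ h; simp at h ⊢; omega
    · rintro ⟨m, n⟩ h; simp at h ⊢; omega
    · rintro ⟨m, n⟩ h; simp at h ⊢; omega
    · rintro ⟨m, n⟩ h
      simp at h
      simp only
      rw [Nat.sub_sub_self (by omega), Nat.sub_sub_self (by omega)]
  rw [h1]
  simp only [doubleSum, mul_sum, ← sum_add_distrib]
  refine sum_congr rfl fun x hx => ?_
  simp only [mem_filter, mem_product] at hx
  rw [inv_natCast_sub_pow hx.1.1, inv_natCast_sub_pow hx.1.2]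
  linear_combination (-1) ^ a * (-1) ^ b * (x.1 : ZMod (p ^ 2))⁻¹ ^ (b + 1)
    * (x.2 : ZMod (p ^ 2))⁻¹ ^ (a + 1) * a * b * h0

theorem ZMod.prime_dvd_of_castHom_eq_zero {x : ZMod (p ^ 2)}
    (h : ZMod.castHom (dvd_pow_self p two_ne_zero) (ZMod p) x = 0) : (p : ZMod (p ^ 2)) ∣ x := by
  rw [← ZMod.natCast_zmod_val x, map_natCast, ZMod.natCast_eq_zero_iff] at h
  rw [← ZMod.natCast_zmod_val x]
  exact Nat.cast_dvd_cast h

/-- This is why sums multiplied by p need only be evaluated modulo p. -/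
theorem ZMod.prime_mul_eq_of_castHom_eq {x y : ZMod (p ^ 2)}
    (h : ZMod.castHom (dvd_pow_self p two_ne_zero) (ZMod p) x
      = ZMod.castHom (dvd_pow_self p two_ne_zero) (ZMod p) y) : (p : ZMod (p ^ 2)) * x = p * y := by
  rw [← sub_eq_zero, ← map_sub] at h
  obtain ⟨z, hz⟩ := ZMod.prime_dvd_of_castHom_eq_zero h
  linear_combination (p : ZMod (p ^ 2)) * hz + z * ZMod.prime_mul_prime_eq_zero p

/-- A congruence modulo p improves to one modulo p² under p-th powers, which makes Teichmüller
representatives modulo p² well defined. -/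
theorem ZMod.pow_prime_eq_of_castHom_eq {x y : ZMod (p ^ 2)}
    (h : ZMod.castHom (dvd_pow_self p two_ne_zero) (ZMod p) x
      = ZMod.castHom (dvd_pow_self p two_ne_zero) (ZMod p) y) : x ^ p = y ^ p := by
  rw [← sub_eq_zero, ← map_sub] at h
  have h1 := dvd_sub_pow_of_dvd_sub (ZMod.prime_dvd_of_castHom_eq_zero h) 1
  have h2 : (p : ZMod (p ^ 2)) ^ (1 + 1) = 0 :=
    (pow_two _).trans (ZMod.prime_mul_prime_eq_zero p)
  rw [h2, zero_dvd_iff, pow_one] at h1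
  exact sub_eq_zero.1 h1

theorem castHom_inv_natCast {m : ℕ} (hm : m ∈ Ioo 0 p) :
    ZMod.castHom (dvd_pow_self p two_ne_zero) (ZMod p) (m : ZMod (p ^ 2))⁻¹ = (m : ZMod p)⁻¹ := by
  have h := congrArg (ZMod.castHom (dvd_pow_self p two_ne_zero) (ZMod p))
    (ZMod.mul_inv_of_unit _ (isUnit_natCast_of_mem_Ioo (n := 2) hm))
  rw [map_mul, map_natCast, map_one] at h
  exact (ZMod.inv_eq_of_mul_eq_one _ _ _ h).symm

theorem castHom_doubleSum (a b : ℕ) :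
    ZMod.castHom (dvd_pow_self p two_ne_zero) (ZMod p) (doubleSum (p ^ 2) p a b)
      = doubleSum p p a b := by
  simp only [doubleSum, map_sum]
  refine sum_congr rfl fun x hx => ?_
  simp only [mem_filter, mem_product] at hx
  rw [map_mul, map_pow, map_pow, castHom_inv_natCast hx.1.1, castHom_inv_natCast hx.1.2]

/-- Power sums of Teichmüller representatives modulo `p²` vanish. -/
theorem sum_Ioo_pow_mul_prime_eq_zero {m : ℕ} (hm : ¬ p - 1 ∣ m) :
    ∑ n ∈ Ioo 0 p, (n : ZMod (p ^ 2)) ^ (p * m) = 0 := by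
  -- The Teichmüller representative modulo p²; it is multiplicative because a p-th power depends
  -- only on the residue modulo p.
  set τ : ZMod p → ZMod (p ^ 2) := fun x => (x.val : ZMod (p ^ 2)) ^ p with hτ
  have hmul : ∀ x y, τ (x * y) = τ x * τ y := fun x y => by
    simp only [hτ, ← mul_pow]
    apply ZMod.pow_prime_eq_of_castHom_eq
    simp only [map_mul, map_natCast, ZMod.natCast_zmod_val]
  have hsum : ∑ n ∈ Ioo 0 p, (n : ZMod (p ^ 2)) ^ (p * m) = ∑ u : (ZMod p)ˣ, τ u ^ m :=
    Finset.sum_bij'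
      (fun v hv ↦ Units.mk0 (v : ZMod p) (mt (ZMod.natCast_eq_zero_iff v p).mp
        (Nat.not_dvd_of_pos_of_lt (mem_Ioo.1 hv).1 (mem_Ioo.1 hv).2)))
      (fun u _ ↦ (u : ZMod p).val)
      (fun _ _ ↦ Finset.mem_univ _)
      (fun u _ ↦ mem_Ioo.2 ⟨Nat.pos_of_ne_zero ((ZMod.val_ne_zero _).2 u.ne_zero), ZMod.val_lt _⟩)
      (fun v hv ↦ by simp [ZMod.val_cast_of_lt (Finset.mem_Ioo.mp hv).2])
      (fun u _ ↦ Units.ext (ZMod.natCast_zmod_val _))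
      (fun v hv ↦ by
        simp only [hτ, Units.val_mk0, ZMod.val_cast_of_lt (Finset.mem_Ioo.mp hv).2, pow_mul])
  -- Multiplication by g permutes the units, so the sum is fixed by the factor τ(g)^m. As τ(g)
  -- reduces to g, the difference τ(g)^m - 1 is a unit, and the sum must vanish.
  have hg : ∃ g : (ZMod p)ˣ, g ^ m ≠ 1 := by
    by_contra! h
    exact hm (by simpa [ZMod.card] using (FiniteField.forall_pow_eq_one_iff (ZMod p) m).1 h)
  obtain ⟨g, hg⟩ := hg
  have h1 : τ g ^ m * ∑ u : (ZMod p)ˣ, τ u ^ m = ∑ u : (ZMod p)ˣ, τ u ^ m := by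
    rw [mul_sum]
    exact Fintype.sum_equiv (Equiv.mulLeft g) _ _ fun u => by simp [hmul, mul_pow]
  have h2 : IsUnit (τ g ^ m - 1) := by
    by_contra h
    have h3 : ZMod.castHom (dvd_pow_self p two_ne_zero) (ZMod p) (τ g ^ m - 1) ≠ 0 := by
      simp only [hτ, map_sub, map_pow, map_natCast, map_one, ZMod.natCast_zmod_val, ZMod.pow_card]
      intro h4
      exact hg (Units.ext (by simpa using sub_eq_zero.1 h4))
    have h5 := ZMod.natCast_zmod_val (τ g ^ m - 1)
    rw [← h5, map_natCast, Ne, ZMod.natCast_eq_zero_iff] at h3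
    rw [← h5, ZMod.isUnit_iff_coprime] at h
    exact h (((Nat.Prime.coprime_iff_not_dvd hp.out).2 h3).symm.pow_right 2)
  rw [hsum]
  exact h2.mul_right_eq_zero.1 (by rw [sub_mul, h1, one_mul, sub_self])

theorem natCast_pow_totient {n : ℕ} (hn : n ∈ Ioo 0 p) :
    (n : ZMod (p ^ 2)) ^ (p * (p - 1)) = 1 := by
  obtain ⟨u, hu⟩ := isUnit_natCast_of_mem_Ioo (n := 2) hn
  have h := ZMod.pow_totient u
  rw [Nat.totient_prime_pow hp.out two_pos, show 2 - 1 = 1 from rfl, pow_one] at h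
  rw [← hu]
  rw [← Units.val_pow_eq_pow_val, h, Units.val_one]

theorem powerSum_eq_sum_pow {k M : ℕ} (hM : M + k = p * (p - 1)) :
    powerSum (p ^ 2) p k = ∑ n ∈ Ioo 0 p, (n : ZMod (p ^ 2)) ^ M := by
  refine sum_congr rfl fun n hn => ?_
  have hu := isUnit_natCast_of_mem_Ioo (n := 2) hn
  rw [← ZMod.inv_pow_of_isUnit hu]
  exact ZMod.inv_eq_of_mul_eq_one _ _ _ (by rw [← pow_add, add_comm, hM, natCast_pow_totient hn])

/-- Kummer's congruence for `B_{p(p-1)-k}` and `B_{p-1-k}`, in terms of power sums. -/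
theorem kummer_powerSum {k m : ℕ} (hm : m + k = p - 1) (hdvd : ¬ p - 1 ∣ m) :
    (k : ZMod (p ^ 2)) * ∑ n ∈ Ioo 0 p, (n : ZMod (p ^ 2)) ^ m
      = ((k : ZMod (p ^ 2)) + 1) * powerSum (p ^ 2) p k := by
  have hp1 : 1 < p := hp.out.one_lt
  have h0 := ZMod.prime_mul_prime_eq_zero p
  -- By Fermat n^(p-1) = 1 + p z, so modulo p² the function F is affine in t, with slope E
  -- annihilated by p. Two known values of F then determine its ratio to F(0).
  set F : ℕ → ZMod (p ^ 2) := fun t => ∑ n ∈ Ioo 0 p, (n : ZMod (p ^ 2)) ^ (m + t * (p - 1))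
  set E : ZMod (p ^ 2) := ∑ n ∈ Ioo 0 p, (n : ZMod (p ^ 2)) ^ m * ((n : ZMod (p ^ 2)) ^ (p - 1) - 1)
  have hE : ∀ n ∈ Ioo 0 p, (p : ZMod (p ^ 2)) ∣ (n : ZMod (p ^ 2)) ^ (p - 1) - 1 := fun n hn => by
    apply ZMod.prime_dvd_of_castHom_eq_zero
    rw [map_sub, map_pow, map_natCast, map_one, ZMod.pow_card_sub_one_eq_one, sub_self]
    rw [Ne, ZMod.natCast_eq_zero_iff]
    exact Nat.not_dvd_of_pos_of_lt (mem_Ioo.1 hn).1 (mem_Ioo.1 hn).2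
  have hpE : (p : ZMod (p ^ 2)) * E = 0 := by
    rw [mul_sum]
    refine sum_eq_zero fun n hn => ?_
    obtain ⟨z, hz⟩ := hE n hn
    rw [hz]
    linear_combination (n : ZMod (p ^ 2)) ^ m * z * h0
  have hF : ∀ t, F t = F 0 + t * E := fun t => by
    simp only [F, E, mul_sum, ← sum_add_distrib]
    refine sum_congr rfl fun n hn => ?_
    obtain ⟨z, hz⟩ := hE n hn
    have h1 : (n : ZMod (p ^ 2)) ^ (p - 1) = 1 + p * z := by rw [← hz]; ring
    rw [pow_add, mul_comm t, pow_mul, h1,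
      one_add_pow_of_sq_zero (by linear_combination z ^ 2 * h0)]
    ring
  -- The exponent m + m (p - 1) is p m, so this is a power sum of Teichmüller representatives.
  have h1 : F m = 0 := by
    rw [← sum_Ioo_pow_mul_prime_eq_zero hdvd]
    refine sum_congr rfl fun n _ => ?_
    congr 1
    obtain ⟨q, rfl⟩ : ∃ q, p = q + 1 := ⟨p - 1, by omega⟩
    rw [Nat.add_sub_cancel]; ring
  -- Here the exponent is p (p - 1) - k, and p (p - 1) is the order of the unit group modulo p².
  have h2 : F (p - 1) = powerSum (p ^ 2) p k := by
    rw [powerSum_eq_sum_pow (M := m + (p - 1) * (p - 1))]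
    obtain ⟨q, rfl⟩ : ∃ q, p = q + 1 := ⟨p - 1, by omega⟩
    rw [Nat.add_sub_cancel] at hm ⊢
    linear_combination hm
  have h3 : F 0 = ∑ n ∈ Ioo 0 p, (n : ZMod (p ^ 2)) ^ m := by simp [F]
  have h4 : (m : ZMod (p ^ 2)) + k = p - 1 := by
    rw [← Nat.cast_one, ← Nat.cast_sub hp1.le]; exact_mod_cast congrArg Nat.cast hm
  have h5 := hF m
  have h6 := hF (p - 1)
  rw [h1] at h5
  rw [h2, Nat.cast_sub hp1.le, Nat.cast_one] at h6
  -- From F(m) = 0, p E = 0 and m + k = p - 1 one gets F(0) = -m E = (k + 1) E and F(p - 1) = -(m +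
  -- 1) E = k E.
  rw [← h3]
  linear_combination (-(k : ZMod (p ^ 2)) - 1) * h6 + h5 + E * h4 - (k : ZMod (p ^ 2)) * hpE

end FiniteSums

/-! ### Evaluation of the truncated sums by Bernoulli numbers. -/

section FiniteSums

variable {p : ℕ} [hp : Fact p.Prime]

/-- As p - a ≡ -a, the falling factorial of p - a is a signed rising factorial of a; the factor b!
cancels because b < p. -/
theorem natCast_choose_prime_sub {a b : ℕ} (hab : a + b < p) :
    ((p - a).choose b : ZMod p) = (-1) ^ b * ((a + b - 1).choose b : ZMod p) := by
  have h1 : ∀ c ≤ b, ((p - a).descFactorial c : ZMod p) = (-1) ^ c * (a.ascFactorial c : ZMod p) := by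
    intro c
    induction c with
    | zero => simp
    | succ c ih =>
      intro hc
      rw [Nat.descFactorial_succ, Nat.ascFactorial_succ, Nat.cast_mul, ih (by omega), Nat.sub_sub,
        Nat.cast_sub (by omega), Nat.cast_mul, ZMod.natCast_self]
      ring
  have h2 := h1 b le_rfl
  rw [Nat.descFactorial_eq_factorial_mul_choose, Nat.ascFactorial_eq_factorial_mul_choose',
    Nat.cast_mul, Nat.cast_mul] at h2
  have h3 : (b.factorial : ZMod p) ≠ 0 := by
    rw [Ne, ZMod.natCast_eq_zero_iff, hp.out.dvd_factorial]
    omega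
  exact mul_left_cancel₀ h3 (by rw [h2]; ring)

theorem inv_pow_eq_pow_sub {n a b : ℕ} (hn : n ∈ Ioo 0 p) (hab : a + b = p - 1) :
    (n : ZMod p)⁻¹ ^ a = (n : ZMod p) ^ b := by
  have hn0 : (n : ZMod p) ≠ 0 := by
    rw [Ne, ZMod.natCast_eq_zero_iff]
    exact Nat.not_dvd_of_pos_of_lt (mem_Ioo.1 hn).1 (mem_Ioo.1 hn).2
  rw [inv_pow]
  exact inv_eq_of_mul_eq_one_right (by rw [← pow_add, hab, ZMod.pow_card_sub_one_eq_one hn0])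

theorem prime_dvd_powerSum {a : ℕ} (ha : 0 < a) (hap : a < p - 1) :
    (p : ZMod (p ^ 2)) ∣ powerSum (p ^ 2) p a := by
  apply ZMod.prime_dvd_of_castHom_eq_zero
  have h : ∀ n ∈ Ioo 0 p, ZMod.castHom (dvd_pow_self p two_ne_zero) (ZMod p)
      ((n : ZMod (p ^ 2))⁻¹ ^ a) = (n : ZMod p) ^ (p - 1 - a) := fun n hn => by
    rw [map_pow, castHom_inv_natCast hn, inv_pow_eq_pow_sub hn (show a + (p - 1 - a) = p - 1 by omega)]
  rw [powerSum, map_sum, sum_congr rfl h, sum_Ioo_natCast_pow,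
    if_neg (Nat.not_dvd_of_pos_of_lt (by omega) (by omega))]

theorem powerSum_mul_powerSum_eq_zero {a b : ℕ} (ha : 0 < a) (hap : a < p - 1) (hb : 0 < b)
    (hbp : b < p - 1) : powerSum (p ^ 2) p a * powerSum (p ^ 2) p b = 0 := by
  obtain ⟨x, hx⟩ := prime_dvd_powerSum ha hap
  obtain ⟨y, hy⟩ := prime_dvd_powerSum hb hbp
  rw [hx, hy]
  linear_combination x * y * ZMod.prime_mul_prime_eq_zero p

/-- Faulhaber's formula in a quotient of `ℤ_p`. -/
theorem succ_mul_sum_range_pow {R : Type*} [CommRing R] (φ : ℤ_[p] →+* R) (β : ℕ → ℤ_[p]) {e : ℕ}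
    (hβ : ∀ i ≤ e, (β i : ℚ_[p]) = (bernoulli i : ℚ)) (n : ℕ) :
    ((e : R) + 1) * ∑ m ∈ range n, (m : R) ^ e
      = ∑ i ∈ range (e + 1), φ (β i) * (e + 1).choose i * (n : R) ^ (e + 1 - i) := by
  have h1 : ((e : ℤ_[p]) + 1) * ∑ m ∈ range n, (m : ℤ_[p]) ^ e
      = ∑ i ∈ range (e + 1), β i * (e + 1).choose i * (n : ℤ_[p]) ^ (e + 1 - i) := by
    apply Subtype.ext
    have h2 := congrArg (Rat.cast : ℚ → ℚ_[p]) (sum_range_pow n e)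
    push_cast at h2
    push_cast [PadicInt.coe_sum]
    rw [h2, mul_sum]
    refine sum_congr rfl fun i hi => ?_
    rw [hβ i (Nat.lt_succ_iff.1 (mem_range.1 hi))]
    have : (e : ℚ_[p]) + 1 ≠ 0 := by exact_mod_cast e.succ_ne_zero
    field_simp
  have h3 := congrArg φ h1
  simpa [map_sum] using h3

/-- The finite double zeta value of weight `w` modulo `p`, in terms of `B_{p-w}`. -/
theorem weight_mul_doubleSum (hp2 : 2 < p) {a b w : ℕ} (ha : 0 < a) (hb : 0 < b) (hw : a + b = w)
    (hwp : w < p - 1) (hj : p - w = 0 ∨ ¬ p - 1 ∣ p - w) (φ : ℤ_[p] →+* ZMod p) :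
    (w : ZMod p) * doubleSum p p a b
      = (-1) ^ b * (w.choose a : ZMod p) * φ (bernoulliInt hp2 (p - w) hj) := by
  classical
  -- The exponent e = p - 1 - a satisfies m⁻ᵃ = mᵉ modulo p, which makes the inner sum a Faulhaber
  -- polynomial. Every B_i with i ≤ e is p-integral because e < p - 1.
  obtain ⟨e, he⟩ : ∃ e, e + 1 + a = p := ⟨p - 1 - a, by omega⟩
  set β : ℕ → ℤ_[p] := fun i => if h : i = 0 ∨ ¬ p - 1 ∣ i then bernoulliInt hp2 i h else 0
  have hβ : ∀ i ≤ e, (β i : ℚ_[p]) = (bernoulli i : ℚ) := fun i hi => by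
    have h : i = 0 ∨ ¬ p - 1 ∣ i := by
      rcases Nat.eq_zero_or_pos i with h | h
      · exact .inl h
      · exact .inr (Nat.not_dvd_of_pos_of_lt h (by omega))
    simp only [β, dif_pos h]
    rfl
  have h1 : doubleSum p p a b
      = ∑ n ∈ Ioo 0 p, (n : ZMod p) ^ (p - 1 - b) * ∑ m ∈ range n, (m : ZMod p) ^ e := by
    rw [doubleSum, sum_filter, sum_product_right]
    refine sum_congr rfl fun n hn => ?_
    rw [← inv_pow_eq_pow_sub hn (a := b) (by omega), mul_comm, sum_mul, ← sum_filter]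
    refine sum_subset_zero_on_sdiff (fun m hm => ?_) (fun m hm => ?_) (fun m hm => ?_)
    · simp at hm ⊢; omega
    · have : m = 0 := by simp at hm hn; omega
      rw [this, Nat.cast_zero, zero_pow (by omega), zero_mul]
    · simp only [mem_filter] at hm
      rw [inv_pow_eq_pow_sub hm.1 (show a + e = p - 1 by omega)]
  have h2 : ((e : ZMod p) + 1) * doubleSum p p a b
      = ∑ i ∈ range (e + 1), φ (β i) * (e + 1).choose i *
        ∑ n ∈ Ioo 0 p, (n : ZMod p) ^ (p - 1 - b + (e + 1 - i)) := by
    rw [h1, mul_sum]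
    simp_rw [mul_left_comm _ ((_ : ZMod p) ^ (p - 1 - b)) _, succ_mul_sum_range_pow φ β hβ, mul_sum]
    rw [sum_comm]
    refine sum_congr rfl fun i _ => sum_congr rfl fun n _ => ?_
    rw [pow_add]
    ring
  -- The outer power sum has exponent 2p - 1 - w - i and survives only when p - 1 divides it. In the
  -- range of i this forces the exponent p - 1, that is i = p - w.
  rw [sum_eq_single (p - w)] at h2
  · have h3 : β (p - w) = bernoulliInt hp2 (p - w) hj := dif_pos hj
    rw [sum_Ioo_natCast_pow, if_pos ⟨1, by omega⟩, h3, show e + 1 = p - a by omega,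
      Nat.choose_symm_of_eq_add (show p - a = (p - w) + b by omega),
      natCast_choose_prime_sub (by omega)] at h2
    have h4 : (e : ZMod p) + 1 = -a := by
      have := congrArg (Nat.cast : ℕ → ZMod p) he
      push_cast [ZMod.natCast_self] at this
      linear_combination this
    have h5 : (w : ZMod p) * ((a + b - 1).choose b : ZMod p) = a * (w.choose a : ZMod p) := by
      obtain ⟨c, rfl⟩ : ∃ c, a = c + 1 := ⟨a - 1, by omega⟩
      have := Nat.add_one_mul_choose_eq (c + b) c
      rw [show c + 1 + b - 1 = c + b by omega,
        Nat.choose_symm_of_eq_add (show c + b = b + c by omega), ← hw,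
        show c + 1 + b = c + b + 1 by omega]
      exact_mod_cast congrArg (Nat.cast : ℕ → ZMod p) (this.trans (mul_comm _ _))
    have h6 : (a : ZMod p) ≠ 0 := by
      rw [Ne, ZMod.natCast_eq_zero_iff]
      exact Nat.not_dvd_of_pos_of_lt ha (by omega)
    apply mul_left_cancel₀ h6
    rw [h4] at h2
    linear_combination (-(w : ZMod p)) * h2
      + (-1) ^ b * φ (bernoulliInt hp2 (p - w) hj) * h5
  · intro i hi hne
    rw [sum_Ioo_natCast_pow, if_neg, mul_zero]
    rintro ⟨c, hc⟩
    simp only [mem_range] at hi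
    rcases c with _ | _ | c
    · omega
    · omega
    · have : p - 1 + (p - 1) ≤ (p - 1) * (c + 1 + 1) := by nlinarith [Nat.zero_le ((p - 1) * c)]
      omega
  · intro h
    simp only [mem_range] at h
    omega

variable {k : ℕ}

/-- By Euler's theorem n⁻ᵏ = n^M with M = p(p-1) - k, so the sum is p B_M. Writing B_M = (k + p) y,
the part p² y drops out and k p y remains. The bound `k + 6 ≤ p` makes k a unit modulo p and, here
and in the next lemma, keeps the exponents of the power sums at least 4. -/
theorem powerSum_eq_mul_ratMod (hk : 0 < k) (hke : Even k) (hkp : k + 6 ≤ p) :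
    powerSum (p ^ 2) p k = (k : ZMod (p ^ 2)) * ((p : ZMod (p ^ 2)) * FMZV.ratMod (p ^ 2)
      (bernoulli (p * (p - 1) - k) / ((k : ℚ) + p))) := by
  have hp2 : 2 < p := by omega
  have hodd : Odd p := hp.out.odd_of_ne_two (by omega)
  have hpe : Even (p - 1) := Nat.Odd.sub_odd hodd odd_one
  have h5 : 5 * (p - 1) ≤ p * (p - 1) := Nat.mul_le_mul_right _ (by omega)
  set M := p * (p - 1) - k with hM
  have hMk : M + k = p * (p - 1) := by omega
  have hMe : Even M := by
    rw [hM, Nat.even_sub (by omega)]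
    simp [hke, hpe.mul_left p]
  have hj : M = 0 ∨ ¬ p - 1 ∣ M := by
    refine .inr fun h => Nat.not_dvd_of_pos_of_lt hk (by omega : k < p - 1) ?_
    exact (Nat.dvd_add_right h).1 (hMk ▸ dvd_mul_left _ _)
  have hkp1 : ‖((k + p : ℕ) : ℚ_[p])‖ = 1 := padic_norm_natCast_eq_one fun h =>
    Nat.not_dvd_of_pos_of_lt hk (by omega : k < p) ((Nat.dvd_add_left dvd_rfl).1 h)
  have hkp0 : ((k + p : ℕ) : ℚ_[p]) ≠ 0 := by exact_mod_cast (by omega : k + p ≠ 0)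
  have hn : ‖((bernoulli M / ((k : ℚ) + p) : ℚ) : ℚ_[p])‖ ≤ 1 := by
    push_cast at hkp1 ⊢
    rw [norm_div, hkp1, div_one]
    exact padic_norm_bernoulli_le_one hp2 hj
  rw [ratMod_eq_toZModPow 2 _ hn, powerSum_eq_sum_pow hMk,
    sum_Ioo_pow_eq_prime_mul_bernoulliInt (by omega) (by omega) hMe hj]
  set y : ℤ_[p] := ⟨((bernoulli M / ((k : ℚ) + p) : ℚ) : ℚ_[p]), hn⟩
  have h1 : bernoulliInt hp2 M hj = ((k : ℤ_[p]) + p) * y := by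
    apply Subtype.ext
    push_cast
    change ((bernoulli M : ℚ) : ℚ_[p])
      = ((k : ℚ_[p]) + p) * ((bernoulli M / ((k : ℚ) + p) : ℚ) : ℚ_[p])
    push_cast at hkp0 ⊢
    rw [mul_div_cancel₀ _ hkp0]
  rw [h1, map_mul, map_add, map_natCast, map_natCast]
  linear_combination PadicInt.toZModPow 2 y * ZMod.prime_mul_prime_eq_zero p

/-- The evaluation modulo p involves B_{p-1-k}. Multiplied by p, this Bernoulli number is a power
sum modulo p², which `kummer_powerSum` trades for the one belonging to B_{p(p-1)-k}; the factors k
and k + 1 are units. -/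
theorem prime_mul_doubleSum_eq_mul_ratMod (hke : Even k) (hkp : k + 6 ≤ p) {a b : ℕ}
    (ha : 0 < a) (hb : 0 < b) (hab : a + b = k + 1) :
    (p : ZMod (p ^ 2)) * doubleSum (p ^ 2) p a b
      = (-1) ^ b * ((k + 1).choose a : ZMod (p ^ 2)) * ((p : ZMod (p ^ 2)) * FMZV.ratMod (p ^ 2)
        (bernoulli (p * (p - 1) - k) / ((k : ℚ) + p))) := by
  have hk : 0 < k := by
    rcases Nat.eq_zero_or_pos k with rfl | h
    · omega
    · exact h
  have hp2 : 2 < p := by omega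
  have hodd : Odd p := hp.out.odd_of_ne_two (by omega)
  have hpe : Even (p - (k + 1)) := by
    rw [Nat.even_sub (by omega)]
    simp [Nat.even_add_one, hke, hodd]
  have hdvd : ¬ p - 1 ∣ p - (k + 1) := Nat.not_dvd_of_pos_of_lt (by omega) (by omega)
  have h1 := weight_mul_doubleSum hp2 ha hb hab (by omega) (.inr hdvd)
    ((ZMod.castHom (dvd_pow_self p two_ne_zero) (ZMod p)).comp (PadicInt.toZModPow 2))
  have h2 : (p : ZMod (p ^ 2)) * (((k + 1 : ℕ) : ZMod (p ^ 2)) * doubleSum (p ^ 2) p a b)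
      = (p : ZMod (p ^ 2)) * ((-1) ^ b * ((k + 1).choose a : ZMod (p ^ 2))
        * PadicInt.toZModPow 2 (bernoulliInt hp2 (p - (k + 1)) (.inr hdvd))) := by
    apply ZMod.prime_mul_eq_of_castHom_eq
    rw [map_mul, castHom_doubleSum, map_natCast, h1]
    simp
  have h3 := kummer_powerSum (p := p) (k := k) (m := p - (k + 1)) (by omega) hdvd
  rw [sum_Ioo_pow_eq_prime_mul_bernoulliInt (by omega) (by omega) hpe (.inr hdvd),
    powerSum_eq_mul_ratMod hk hke hkp] at h3
  have hu : ∀ m : ℕ, 0 < m → m < p → IsUnit (m : ZMod (p ^ 2)) := fun m h h' =>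
    isUnit_natCast_of_mem_Ioo (mem_Ioo.2 ⟨h, h'⟩)
  apply ((hu k hk (by omega)).mul (hu (k + 1) (by omega) (by omega))).mul_left_cancel
  push_cast at h2 ⊢
  linear_combination (k : ZMod (p ^ 2)) * h2
    + (-1) ^ b * ((k + 1).choose a : ZMod (p ^ 2)) * h3

/-- For even k the sign in the reflection formula is 1, so adding it to the harmonic product
relation eliminates the sum with k₁ and k₂ interchanged. -/
theorem two_mul_doubleSum {k₁ k₂ : ℕ} (h₁ : 0 < k₁) (h₂ : 0 < k₂) (hk : k₁ + k₂ = k) (hke : Even k)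
    (hkp : k + 6 ≤ p) :
    2 * doubleSum (p ^ 2) p k₁ k₂
      = ((-1) ^ k₁ * (k₂ : ZMod (p ^ 2)) * ((k + 1).choose k₁ : ZMod (p ^ 2))
        - (-1) ^ k₂ * (k₁ : ZMod (p ^ 2)) * ((k + 1).choose k₂ : ZMod (p ^ 2))
        - (k : ZMod (p ^ 2))) *
      ((p : ZMod (p ^ 2)) * FMZV.ratMod (p ^ 2) (bernoulli (p * (p - 1) - k) / ((k : ℚ) + p))) := by
  have h1 := powerSum_mul_powerSum (p ^ 2) p k₁ k₂
  rw [powerSum_mul_powerSum_eq_zero h₁ (by omega) h₂ (by omega), hk,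
    powerSum_eq_mul_ratMod (by omega) hke hkp] at h1
  have h2 := doubleSum_reflect (p := p) k₁ k₂
  rw [hk, hke.neg_one_pow] at h2
  have h3 := prime_mul_doubleSum_eq_mul_ratMod hke hkp h₂ (Nat.succ_pos k₁)
    (show k₂ + (k₁ + 1) = k + 1 by omega)
  have h4 := prime_mul_doubleSum_eq_mul_ratMod hke hkp (Nat.succ_pos k₂) h₁
    (show k₂ + 1 + k₁ = k + 1 by omega)
  rw [Nat.choose_symm_of_eq_add (show k + 1 = (k₂ + 1) + k₁ by omega)] at h4
  have h5 : (-1 : ZMod (p ^ 2)) ^ k₁ = (-1) ^ k₂ := by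
    rw [← hk] at hke
    have : (-1 : ZMod (p ^ 2)) ^ (k₁ + k₂) = 1 := hke.neg_one_pow
    have h6 : ((-1 : ZMod (p ^ 2)) ^ k₂) * (-1) ^ k₂ = 1 := by rw [← mul_pow]; simp
    rw [pow_add] at this
    linear_combination (-1) ^ k₂ * this - (-1) ^ k₁ * h6
  rw [Nat.succ_eq_add_one, pow_succ (-1 : ZMod (p ^ 2)), h5] at h3
  rw [h5] at h4 ⊢
  linear_combination h2 - h1 + (k₁ : ZMod (p ^ 2)) * h3 + (k₂ : ZMod (p ^ 2)) * h4

end FiniteSums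

/-! ### The theorem in 𝒜₂. -/

section FiniteValues

theorem sum_piFinset_fin_two {R : Type*} [AddCommMonoid R] (p : ℕ) (r : ℕ → ℕ → Prop)
    [DecidableRel r] (P : (Fin 2 → ℕ) → Prop) [DecidablePred P] (hP : ∀ m, P m ↔ r (m 0) (m 1))
    (f : ℕ → ℕ → R) :
    ∑ m ∈ (Fintype.piFinset fun _ : Fin 2 => Ioo 0 p) with P m, f (m 0) (m 1)
      = ∑ x ∈ (Ioo 0 p ×ˢ Ioo 0 p) with r x.1 x.2, f x.1 x.2 := by
  refine sum_nbij' (fun m => (m 0, m 1)) (fun x => ![x.1, x.2]) ?_ ?_ ?_ ?_ ?_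
  · intro m hm
    simp only [mem_filter, Fintype.mem_piFinset, mem_product, hP] at hm ⊢
    exact ⟨⟨hm.1 0, hm.1 1⟩, hm.2⟩
  · intro x hx
    simp only [mem_filter, Fintype.mem_piFinset, mem_product, hP, Fin.forall_fin_two] at hx ⊢
    simpa using hx
  · intro m _
    ext i
    fin_cases i <;> rfl
  · intro x _
    rfl
  · intro m _
    rfl

theorem zetaA_two_component (p : ℕ) [hp : Fact p.Prime] (k₁ k₂ : ℕ+) :
    (∑ m ∈ (Fintype.piFinset fun _ : Fin [k₁, k₂].length => Ioo 0 p).filter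
        (fun m => ∀ i j, i < j → m i < m j),
      ∏ i, ((m i : ZMod (p ^ 2)) ^ ([k₁, k₂].get i : ℕ))⁻¹) = doubleSum (p ^ 2) p k₁ k₂ := by
  have h := sum_piFinset_fin_two p (· < ·) (fun m : Fin 2 → ℕ => ∀ i j, i < j → m i < m j)
    (fun m => by simp [Fin.forall_fin_two])
    (fun a b => ((a : ZMod (p ^ 2)) ^ (k₁ : ℕ))⁻¹ * ((b : ZMod (p ^ 2)) ^ (k₂ : ℕ))⁻¹)
  refine (sum_congr rfl fun m _ => Fin.prod_univ_two _).trans (h.trans ?_)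
  refine sum_congr rfl fun x hx => ?_
  simp only [mem_filter, mem_product] at hx
  rw [ZMod.inv_pow_of_isUnit (isUnit_natCast_of_mem_Ioo hx.1.1),
    ZMod.inv_pow_of_isUnit (isUnit_natCast_of_mem_Ioo hx.1.2)]

theorem zetaAStar_two_component (p : ℕ) [hp : Fact p.Prime] (k₁ k₂ : ℕ+) :
    (∑ m ∈ (Fintype.piFinset fun _ : Fin [k₁, k₂].length => Ioo 0 p).filter
        (fun m => ∀ i j, i ≤ j → m i ≤ m j),
      ∏ i, ((m i : ZMod (p ^ 2)) ^ ([k₁, k₂].get i : ℕ))⁻¹)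
      = doubleSum (p ^ 2) p k₁ k₂ + powerSum (p ^ 2) p (k₁ + k₂) := by
  have h := sum_piFinset_fin_two p (· ≤ ·) (fun m : Fin 2 → ℕ => ∀ i j, i ≤ j → m i ≤ m j)
    (fun m => by simp [Fin.forall_fin_two])
    (fun a b => ((a : ZMod (p ^ 2)) ^ (k₁ : ℕ))⁻¹ * ((b : ZMod (p ^ 2)) ^ (k₂ : ℕ))⁻¹)
  have h1 : ∀ x ∈ (Ioo 0 p ×ˢ Ioo 0 p).filter (fun x : ℕ × ℕ => x.1 ≤ x.2),
      ((x.1 : ZMod (p ^ 2)) ^ (k₁ : ℕ))⁻¹ * ((x.2 : ZMod (p ^ 2)) ^ (k₂ : ℕ))⁻¹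
        = (x.1 : ZMod (p ^ 2))⁻¹ ^ (k₁ : ℕ) * (x.2 : ZMod (p ^ 2))⁻¹ ^ (k₂ : ℕ) := fun x hx => by
    simp only [mem_filter, mem_product] at hx
    rw [ZMod.inv_pow_of_isUnit (isUnit_natCast_of_mem_Ioo hx.1.1),
      ZMod.inv_pow_of_isUnit (isUnit_natCast_of_mem_Ioo hx.1.2)]
  have h2 : powerSum (p ^ 2) p (k₁ + k₂) = ∑ x ∈ (Ioo 0 p ×ˢ Ioo 0 p) with x.1 = x.2,
      (x.1 : ZMod (p ^ 2))⁻¹ ^ (k₁ : ℕ) * (x.2 : ZMod (p ^ 2))⁻¹ ^ (k₂ : ℕ) :=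
    powerSum_add_eq_sum _ _ _ _
  refine (sum_congr rfl fun m _ => Fin.prod_univ_two _).trans (h.trans ?_)
  refine (sum_congr rfl h1).trans ?_
  rw [h2, doubleSum, sum_filter, sum_filter, sum_filter, ← sum_add_distrib]
  refine sum_congr rfl fun x _ => ?_
  rcases lt_trichotomy x.1 x.2 with h | h | h
  · simp [h, h.le, h.ne]
  · simp [h]
  · simp [h.not_ge, h.not_gt, h.ne']

theorem ARing_mk_eq_of_forall_large {n : ℕ} {f g : FMZV.AProd n} (K : ℕ)
    (h : ∀ p : Nat.Primes, K ≤ (p : ℕ) → f p = g p) :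
    Ideal.Quotient.mk (FMZV.finiteIdeal n) f = Ideal.Quotient.mk _ g := by
  rw [Ideal.Quotient.eq]
  refine Set.Finite.subset (Set.Finite.preimage (f := fun p : Nat.Primes => (p : ℕ))
    Nat.Primes.coe_nat_injective.injOn (Set.finite_lt_nat K)) fun p hp => ?_
  by_contra hlt
  exact hp (by rw [Pi.sub_apply, h p (not_lt.1 hlt), sub_self])

/-- With an integer c, the hypothesis involves only integer casts and can be checked prime by prime
or coefficient by coefficient; rational scalars enter only in the conclusion. -/
theorem eq_half_smul_of_two_mul {R : Type*} [Ring R] [Module ℚ R] {x y : R} (c : ℤ)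
    (h : 2 * x = c * y) : x = ((1 / 2 : ℚ) * c) • y := by
  rw [mul_smul, Int.cast_smul_eq_zsmul, zsmul_eq_mul, ← h, two_mul]
  module

theorem zetaA_two_depth_two (k₁ k₂ k : ℕ+) (hk : k = k₁ + k₂) (heven : Even (k : ℕ)) :
    FMZV.zetaA 2 [k₁, k₂] =
        ((1 / 2 : ℚ) * ((-1) ^ (k₁ : ℕ) * (k₂ : ℚ) * (((k : ℕ) + 1).choose k₁ : ℚ)
          - (-1) ^ (k₂ : ℕ) * (k₁ : ℚ) * (((k : ℕ) + 1).choose k₂ : ℚ) - (k : ℚ))) •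
          (FMZV.frakZA 2 (k + 1) * FMZV.xA 2) ∧
      FMZV.zetaAStar 2 [k₁, k₂] =
        ((1 / 2 : ℚ) * ((-1) ^ (k₁ : ℕ) * (k₂ : ℚ) * (((k : ℕ) + 1).choose k₁ : ℚ)
          - (-1) ^ (k₂ : ℕ) * (k₁ : ℚ) * (((k : ℕ) + 1).choose k₂ : ℚ) + (k : ℚ))) •
          (FMZV.frakZA 2 (k + 1) * FMZV.xA 2) := by
  have hk' : (k₁ : ℕ) + k₂ = k := by rw [hk, PNat.add_coe]
  have hq : ∀ p : ℕ, bernoulli (p ^ (2 - 1) * (p - 1) + 1 - ((k + 1 : ℕ+) : ℕ))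
      / (((k + 1 : ℕ+) : ℚ) - 1 + (p : ℚ) ^ (2 - 1))
      = bernoulli (p * (p - 1) - k) / ((k : ℚ) + p) := fun p => by
    rw [PNat.add_coe, PNat.one_coe, Nat.add_sub_add_right]
    push_cast
    simp
  constructor
  · have h := eq_half_smul_of_two_mul (x := FMZV.zetaA 2 [k₁, k₂])
      (y := FMZV.frakZA 2 (k + 1) * FMZV.xA 2)
      ((-1) ^ (k₁ : ℕ) * (k₂ : ℕ) * (((k : ℕ) + 1).choose k₁ : ℕ)
          - (-1) ^ (k₂ : ℕ) * (k₁ : ℕ) * (((k : ℕ) + 1).choose k₂ : ℕ) - (k : ℕ)) (by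
      rw [FMZV.zetaA, FMZV.frakZA, FMZV.xA, ← map_ofNat (Ideal.Quotient.mk (FMZV.finiteIdeal 2)),
        ← map_intCast (Ideal.Quotient.mk (FMZV.finiteIdeal 2)), ← map_mul, ← map_mul, ← map_mul]
      refine ARing_mk_eq_of_forall_large (k + 6) fun p hp => ?_
      have : Fact (p : ℕ).Prime := ⟨p.2⟩
      have h := two_mul_doubleSum k₁.pos k₂.pos hk' heven hp
      simp only [Pi.mul_apply, Pi.intCast_apply, Pi.ofNat_apply]
      rw [zetaA_two_component, hq, h]
      push_cast
      ring)
    rw [h]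
    push_cast
    rfl
  · have h := eq_half_smul_of_two_mul (x := FMZV.zetaAStar 2 [k₁, k₂])
      (y := FMZV.frakZA 2 (k + 1) * FMZV.xA 2)
      ((-1) ^ (k₁ : ℕ) * (k₂ : ℕ) * (((k : ℕ) + 1).choose k₁ : ℕ)
          - (-1) ^ (k₂ : ℕ) * (k₁ : ℕ) * (((k : ℕ) + 1).choose k₂ : ℕ) + (k : ℕ)) (by
      rw [FMZV.zetaAStar, FMZV.frakZA, FMZV.xA,
        ← map_ofNat (Ideal.Quotient.mk (FMZV.finiteIdeal 2)),
        ← map_intCast (Ideal.Quotient.mk (FMZV.finiteIdeal 2)), ← map_mul, ← map_mul, ← map_mul]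
      refine ARing_mk_eq_of_forall_large (k + 6) fun p hp => ?_
      have : Fact (p : ℕ).Prime := ⟨p.2⟩
      have h := two_mul_doubleSum k₁.pos k₂.pos hk' heven hp
      simp only [Pi.mul_apply, Pi.intCast_apply, Pi.ofNat_apply]
      rw [zetaAStar_two_component, hq, mul_add, h, hk', powerSum_eq_mul_ratMod k.pos heven hp]
      push_cast
      ring)
    rw [h]
    push_cast
    rfl

end FiniteValues

/-! ### Convergent double zeta values: harmonic product, shuffle product, Euler's sum formula. -/

section DoubleZeta

/-- The double zeta value `∑_{0<m<n} m^{-a} n^{-b}`, as a sum over `m` and `n - m`. -/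
noncomputable def doubleZeta (a b : ℕ) : ℝ :=
  ∑' x : ℕ × ℕ, ((x.1 + 1 : ℝ)⁻¹ ^ a * (x.1 + x.2 + 2 : ℝ)⁻¹ ^ b)

/-- The zeta value `∑_{0<n} n^{-a}`. -/
noncomputable def singleZeta (a : ℕ) : ℝ := ∑' n : ℕ, (n + 1 : ℝ)⁻¹ ^ a

/-- Since √x √y ≤ x + y, the series is dominated by the square of ∑ n^(-3/2). It serves as the
common majorant for the double series with an exponent 1. -/
theorem summable_inv_mul_inv_mul_inv_add :
    Summable fun x : ℕ × ℕ => (x.1 + 1 : ℝ)⁻¹ * (x.2 + 1 : ℝ)⁻¹ * (x.1 + x.2 + 2 : ℝ)⁻¹ := by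
  have h1 : Summable fun n : ℕ => ((n + 1 : ℝ) * √(n + 1))⁻¹ := by
    have h := (summable_nat_add_iff 1).2
      (Real.summable_one_div_nat_rpow.2 (by norm_num : (1 : ℝ) < 1 + 1 / 2))
    refine h.congr fun n => ?_
    rw [Real.rpow_add (by positivity), Real.rpow_one, ← Real.sqrt_eq_rpow, one_div]
    push_cast
    rfl
  refine Summable.of_nonneg_of_le (fun x => by positivity) (fun x => ?_)
    (h1.mul_of_nonneg h1 (fun n => by positivity) (fun n => by positivity))
  rw [← mul_inv, ← mul_inv, ← mul_inv]
  apply inv_anti₀ (by positivity)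
  have h2 : √(x.1 + 1 : ℝ) * √(x.2 + 1) ≤ x.1 + x.2 + 2 := by
    have e1 := Real.sq_sqrt (show (0 : ℝ) ≤ x.1 + 1 by positivity)
    have e2 := Real.sq_sqrt (show (0 : ℝ) ≤ x.2 + 1 by positivity)
    nlinarith [sq_nonneg (√(x.1 + 1 : ℝ) - √(x.2 + 1)), Real.sqrt_nonneg (x.1 + 1 : ℝ),
      Real.sqrt_nonneg (x.2 + 1 : ℝ)]
  calc (x.1 + 1 : ℝ) * √(x.1 + 1) * ((x.2 + 1) * √(x.2 + 1))
      = (x.1 + 1 : ℝ) * (x.2 + 1) * (√(x.1 + 1 : ℝ) * √(x.2 + 1)) := by ring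
    _ ≤ _ := by gcongr

theorem summable_singleZeta {a : ℕ} (ha : 2 ≤ a) : Summable fun n : ℕ => (n + 1 : ℝ)⁻¹ ^ a := by
  have h := (summable_nat_add_iff 1).2 (Real.summable_nat_pow_inv.2 (by omega : 1 < a))
  refine h.congr fun n => ?_
  push_cast
  rw [inv_pow]

theorem summable_doubleZeta {a b : ℕ} (ha : 1 ≤ a) (hb : 2 ≤ b) :
    Summable fun x : ℕ × ℕ => ((x.1 + 1 : ℝ)⁻¹ ^ a * (x.1 + x.2 + 2 : ℝ)⁻¹ ^ b) := by
  refine Summable.of_nonneg_of_le (fun x => by positivity) (fun x => ?_)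
    summable_inv_mul_inv_mul_inv_add
  have h1 : (x.1 + 1 : ℝ)⁻¹ ≤ 1 := inv_le_one_of_one_le₀ (by linarith [Nat.cast_nonneg (α := ℝ) x.1])
  have h2 : (x.1 + x.2 + 2 : ℝ)⁻¹ ≤ 1 := inv_le_one_of_one_le₀ (by
    linarith [Nat.cast_nonneg (α := ℝ) x.1, Nat.cast_nonneg (α := ℝ) x.2])
  have h3 : (x.1 + x.2 + 2 : ℝ)⁻¹ ≤ (x.2 + 1 : ℝ)⁻¹ := inv_anti₀ (by positivity) (by
    linarith [Nat.cast_nonneg (α := ℝ) x.1])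
  calc _ ≤ (x.1 + 1 : ℝ)⁻¹ ^ 1 * (x.1 + x.2 + 2 : ℝ)⁻¹ ^ 2 := by
        gcongr ?_ * ?_
        · exact pow_le_pow_of_le_one (by positivity) h1 ha
        · exact pow_le_pow_of_le_one (by positivity) h2 hb
    _ = (x.1 + 1 : ℝ)⁻¹ * (x.1 + x.2 + 2 : ℝ)⁻¹ * (x.1 + x.2 + 2 : ℝ)⁻¹ := by ring
    _ ≤ _ := by gcongr

theorem summable_singleZeta_mul {a b : ℕ} (ha : 2 ≤ a) (hb : 2 ≤ b) :
    Summable fun x : ℕ × ℕ => (x.1 + 1 : ℝ)⁻¹ ^ a * (x.2 + 1 : ℝ)⁻¹ ^ b :=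
  (summable_singleZeta ha).mul_of_nonneg (summable_singleZeta hb) (fun n => by positivity)
    (fun n => by positivity)

theorem singleZeta_mul_eq_tsum {a b : ℕ} (ha : 2 ≤ a) (hb : 2 ≤ b) :
    singleZeta a * singleZeta b = ∑' x : ℕ × ℕ, (x.1 + 1 : ℝ)⁻¹ ^ a * (x.2 + 1 : ℝ)⁻¹ ^ b :=
  (summable_singleZeta ha).tsum_mul_tsum (summable_singleZeta hb) (summable_singleZeta_mul ha hb)

/-- Splitting a sum over pairs according to the order of the two entries. -/
theorem tsum_prod_split {f : ℕ × ℕ → ℝ} (hf : Summable f) :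
    ∑' x, f x = ∑' x : ℕ × ℕ, f (x.1, x.1 + x.2 + 1) + ∑' x : ℕ × ℕ, f (x.1 + x.2 + 1, x.1)
      + ∑' n, f (n, n) := by
  have i1 : Function.Injective fun x : ℕ × ℕ => (x.1, x.1 + x.2 + 1) := by
    rintro ⟨a, b⟩ ⟨c, d⟩ h
    simp only [Prod.mk.injEq] at h ⊢
    omega
  have i2 : Function.Injective fun x : ℕ × ℕ => (x.1 + x.2 + 1, x.1) := by
    rintro ⟨a, b⟩ ⟨c, d⟩ h
    simp only [Prod.mk.injEq] at h ⊢
    omega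
  have i3 : Function.Injective fun n : ℕ => (n, n) := fun a b h => (Prod.mk.inj h).1
  have e1 := i1.tsum_eq (f := Set.indicator {x : ℕ × ℕ | x.1 < x.2} f) (fun x hx => by
    have h := Set.support_indicator_subset hx
    exact ⟨(x.1, x.2 - x.1 - 1), by
      ext
      · rfl
      · have h' : x.1 < x.2 := h
        simp only
        omega⟩)
  have e2 := i2.tsum_eq (f := Set.indicator {x : ℕ × ℕ | x.2 < x.1} f) (fun x hx => by
    have h := Set.support_indicator_subset hx
    exact ⟨(x.2, x.1 - x.2 - 1), by
      ext
      · have h' : x.2 < x.1 := h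
        simp only
        omega
      · rfl⟩)
  have e3 := i3.tsum_eq (f := Set.indicator {x : ℕ × ℕ | x.1 = x.2} f) (fun x hx => by
    have h := Set.support_indicator_subset hx
    exact ⟨x.1, by
      ext
      · rfl
      · exact h⟩)
  have c1 : ∀ x : ℕ × ℕ, Set.indicator {x : ℕ × ℕ | x.1 < x.2} f (x.1, x.1 + x.2 + 1)
      = f (x.1, x.1 + x.2 + 1) := fun x => Set.indicator_of_mem
    (show (x.1, x.1 + x.2 + 1) ∈ {x : ℕ × ℕ | x.1 < x.2} from by simp [add_assoc]) f
  have c2 : ∀ x : ℕ × ℕ, Set.indicator {x : ℕ × ℕ | x.2 < x.1} f (x.1 + x.2 + 1, x.1)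
      = f (x.1 + x.2 + 1, x.1) := fun x => Set.indicator_of_mem
    (show (x.1 + x.2 + 1, x.1) ∈ {x : ℕ × ℕ | x.2 < x.1} from by simp [add_assoc]) f
  have c3 : ∀ n : ℕ, Set.indicator {x : ℕ × ℕ | x.1 = x.2} f (n, n) = f (n, n) := fun n =>
    Set.indicator_of_mem (show (n, n) ∈ {x : ℕ × ℕ | x.1 = x.2} from rfl) f
  simp only [c1] at e1
  simp only [c2] at e2
  simp only [c3] at e3
  rw [e1, e2, e3, ← (hf.indicator _).tsum_add (hf.indicator _),
    ← ((hf.indicator _).add (hf.indicator _)).tsum_add (hf.indicator _)]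
  refine tsum_congr fun x => ?_
  simp only [Set.indicator_apply, Set.mem_ofPred_eq]
  rcases lt_trichotomy x.1 x.2 with h | h | h
  · simp [h, h.not_gt, h.ne]
  · simp [h]
  · simp [h, h.not_gt, h.ne']

theorem singleZeta_mul_singleZeta {a b : ℕ} (ha : 2 ≤ a) (hb : 2 ≤ b) :
    singleZeta a * singleZeta b = doubleZeta a b + doubleZeta b a + singleZeta (a + b) := by
  rw [singleZeta_mul_eq_tsum ha hb, tsum_prod_split (summable_singleZeta_mul ha hb)]
  congr 1
  · congr 1
    · refine tsum_congr fun x => ?_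
      push_cast
      ring_nf
    · refine tsum_congr fun x => ?_
      push_cast
      ring_nf
  · exact tsum_congr fun n => (pow_add _ _ _).symm

/-- The partial fraction decomposition, with `u = 1/x`, `v = 1/y`, `q = 1/(x+y)`. -/
theorem partial_fraction {R : Type*} [CommRing R] {u v q : R} (h : u * v = q * (u + v)) :
    ∀ s i j : ℕ, i + j = s → u ^ (i + 1) * v ^ (j + 1)
      = ∑ t ∈ range (s + 1), ((t.choose i : R) * v ^ (s + 1 - t) + (t.choose j : R) * u ^ (s + 1 - t))
        * q ^ (t + 1) := by
  intro s
  induction s with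
  | zero =>
    intro i j hij
    obtain ⟨rfl, rfl⟩ : i = 0 ∧ j = 0 := by omega
    simp
    linear_combination h
  | succ s ih =>
    intro i j hij
    rw [sum_range_succ']
    simp only [Nat.add_sub_add_right]
    -- Using u v = q (u + v) once lowers i or j by one, and Pascal's rule merges the two expansions.
    -- If an index is already 0, its part is a pure power times q, which is the term t = 0 split off
    -- above.
    rcases i with _ | i <;> rcases j with _ | j
    · omega
    · have h1 := ih 0 j (by omega)
      have h2 : ∀ t ∈ range (s + 1), (((t + 1).choose 0 : R) * v ^ (s + 1 - t)
          + ((t + 1).choose (j + 1) : R) * u ^ (s + 1 - t)) * q ^ (t + 1 + 1)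
          = q * (((t.choose 0 : R) * v ^ (s + 1 - t) + (t.choose j : R) * u ^ (s + 1 - t))
            * q ^ (t + 1)) := fun t ht => by
        rw [Nat.choose_succ_succ, Nat.choose_eq_zero_of_lt (show t < j + 1 by simp at ht; omega),
          Nat.choose_zero_right, Nat.choose_zero_right]
        push_cast
        ring
      rw [sum_congr rfl h2, ← mul_sum, ← h1]
      obtain rfl : j = s := by omega
      simp
      linear_combination v ^ (j + 1) * h
    · have h1 := ih i 0 (by omega)
      have h2 : ∀ t ∈ range (s + 1), (((t + 1).choose (i + 1) : R) * v ^ (s + 1 - t)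
          + ((t + 1).choose 0 : R) * u ^ (s + 1 - t)) * q ^ (t + 1 + 1)
          = q * (((t.choose i : R) * v ^ (s + 1 - t) + (t.choose 0 : R) * u ^ (s + 1 - t))
            * q ^ (t + 1)) := fun t ht => by
        rw [Nat.choose_succ_succ, Nat.choose_eq_zero_of_lt (show t < i + 1 by simp at ht; omega),
          Nat.choose_zero_right, Nat.choose_zero_right]
        push_cast
        ring
      rw [sum_congr rfl h2, ← mul_sum, ← h1]
      obtain rfl : i = s := by omega
      simp
      linear_combination u ^ (i + 1) * h
    · have h1 := ih i (j + 1) (by omega)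
      have h1' := ih (i + 1) j (by omega)
      have h2 : ∀ t ∈ range (s + 1), (((t + 1).choose (i + 1) : R) * v ^ (s + 1 - t)
          + ((t + 1).choose (j + 1) : R) * u ^ (s + 1 - t)) * q ^ (t + 1 + 1)
          = q * (((t.choose i : R) * v ^ (s + 1 - t) + (t.choose (j + 1) : R) * u ^ (s + 1 - t))
            * q ^ (t + 1)) + q * (((t.choose (i + 1) : R) * v ^ (s + 1 - t)
            + (t.choose j : R) * u ^ (s + 1 - t)) * q ^ (t + 1)) := fun t ht => by
        rw [Nat.choose_succ_succ, Nat.choose_succ_succ]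
        push_cast
        ring
      rw [sum_congr rfl h2, sum_add_distrib, ← mul_sum, ← mul_sum, ← h1, ← h1']
      simp
      linear_combination u ^ (i + 1) * v ^ (j + 1) * h

theorem doubleZeta_swap (a b : ℕ) :
    doubleZeta a b = ∑' x : ℕ × ℕ, ((x.2 + 1 : ℝ)⁻¹ ^ a * (x.1 + x.2 + 2 : ℝ)⁻¹ ^ b) := by
  rw [doubleZeta, ← (Equiv.prodComm ℕ ℕ).tsum_eq]
  refine tsum_congr fun x => ?_
  simp only [Equiv.prodComm_apply, Prod.fst_swap, Prod.snd_swap, add_comm (x.2 : ℝ)]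

/-- The shuffle product of two convergent zeta values. -/
theorem singleZeta_mul_singleZeta_shuffle {i j : ℕ} (hi : 1 ≤ i) (hj : 1 ≤ j) :
    singleZeta (i + 1) * singleZeta (j + 1)
      = ∑ t ∈ range (i + j + 1), ((t.choose i : ℝ) + (t.choose j : ℝ))
        * doubleZeta (i + j + 1 - t) (t + 1) := by
  rw [singleZeta_mul_eq_tsum (by omega) (by omega)]
  have h1 : ∀ x : ℕ × ℕ, (x.1 + 1 : ℝ)⁻¹ ^ (i + 1) * (x.2 + 1 : ℝ)⁻¹ ^ (j + 1)
      = ∑ t ∈ range (i + j + 1),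
        ((t.choose i : ℝ) * ((x.2 + 1 : ℝ)⁻¹ ^ (i + j + 1 - t) * (x.1 + x.2 + 2 : ℝ)⁻¹ ^ (t + 1))
        + (t.choose j : ℝ) * ((x.1 + 1 : ℝ)⁻¹ ^ (i + j + 1 - t) * (x.1 + x.2 + 2 : ℝ)⁻¹ ^ (t + 1))) :=
    fun x => by
    have hx : (x.1 + 1 : ℝ)⁻¹ * (x.2 + 1 : ℝ)⁻¹
        = (x.1 + x.2 + 2 : ℝ)⁻¹ * ((x.1 + 1 : ℝ)⁻¹ + (x.2 + 1 : ℝ)⁻¹) := by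
      have a1 : (x.1 + 1 : ℝ) ≠ 0 := by positivity
      have a2 : (x.2 + 1 : ℝ) ≠ 0 := by positivity
      have a3 : (x.1 + x.2 + 2 : ℝ) ≠ 0 := by positivity
      field_simp
      ring
    rw [partial_fraction hx (i + j) i j rfl]
    exact sum_congr rfl fun t _ => by ring
  have hs : ∀ t, 1 ≤ t → t < i + j + 1 → Summable fun x : ℕ × ℕ =>
      ((x.1 + 1 : ℝ)⁻¹ ^ (i + j + 1 - t) * (x.1 + x.2 + 2 : ℝ)⁻¹ ^ (t + 1)) := fun t h h' =>
    summable_doubleZeta (by omega) (by omega)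
  have hs' : ∀ t, 1 ≤ t → t < i + j + 1 → Summable fun x : ℕ × ℕ =>
      ((x.2 + 1 : ℝ)⁻¹ ^ (i + j + 1 - t) * (x.1 + x.2 + 2 : ℝ)⁻¹ ^ (t + 1)) := fun t h h' => by
    refine ((Equiv.prodComm ℕ ℕ).summable_iff.2 (hs t h h')).congr fun x => ?_
    simp only [Function.comp, Equiv.prodComm_apply, Prod.fst_swap, Prod.snd_swap,
      add_comm (x.2 : ℝ)]
  have ht : ∀ t ∈ range (i + j + 1), Summable fun x : ℕ × ℕ =>
      (t.choose i : ℝ) * ((x.2 + 1 : ℝ)⁻¹ ^ (i + j + 1 - t) * (x.1 + x.2 + 2 : ℝ)⁻¹ ^ (t + 1))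
        + (t.choose j : ℝ) * ((x.1 + 1 : ℝ)⁻¹ ^ (i + j + 1 - t) * (x.1 + x.2 + 2 : ℝ)⁻¹ ^ (t + 1)) :=
    fun t ht => by
    -- At t = 0 stands the divergent ζ(i+j+1, 1), but its coefficient is zero because i, j ≥ 1.
    rcases Nat.eq_zero_or_pos t with rfl | h
    · rw [Nat.choose_eq_zero_of_lt (by omega), Nat.choose_eq_zero_of_lt (by omega)]
      simp [summable_zero]
    · exact ((hs' t h (mem_range.1 ht)).mul_left _).add ((hs t h (mem_range.1 ht)).mul_left _)
  rw [tsum_congr h1, Summable.tsum_finsetSum ht]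
  refine sum_congr rfl fun t ht => ?_
  rcases Nat.eq_zero_or_pos t with rfl | h
  · rw [Nat.choose_eq_zero_of_lt (by omega), Nat.choose_eq_zero_of_lt (by omega)]
    simp
  · rw [((hs' t h (mem_range.1 ht)).mul_left _).tsum_add ((hs t h (mem_range.1 ht)).mul_left _),
      tsum_mul_left, tsum_mul_left, ← doubleZeta_swap, ← doubleZeta, add_mul]

/-- Passing from M to M + 1 adds a telescoping series with sum 1/(M + 1). -/
theorem hasSum_inv_sub_inv_add (M : ℕ) :
    HasSum (fun d : ℕ => (d + 1 : ℝ)⁻¹ - (M + d + 1 : ℝ)⁻¹) (∑ l ∈ range M, (l + 1 : ℝ)⁻¹) := by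
  induction M with
  | zero => simp [hasSum_zero]
  | succ M ih =>
    have h : HasSum (fun d : ℕ => (M + d + 1 : ℝ)⁻¹ - (M + (d + 1 : ℕ) + 1 : ℝ)⁻¹)
        ((M + 1 : ℝ)⁻¹) := by
      rw [hasSum_iff_tendsto_nat_of_nonneg]
      · have h1 : Filter.Tendsto (fun n : ℕ => (M + 1 : ℝ)⁻¹ - (M + n + 1 : ℝ)⁻¹) Filter.atTop
            (nhds ((M + 1 : ℝ)⁻¹ - 0)) := by
          refine Filter.Tendsto.sub tendsto_const_nhds ?_
          refine (((Filter.tendsto_add_atTop_iff_nat (M + 1)).2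
            (tendsto_inv_atTop_nhds_zero_nat (𝕜 := ℝ)))).congr fun n => ?_
          push_cast
          ring_nf
        rw [sub_zero] at h1
        refine h1.congr fun n => ?_
        rw [Finset.sum_range_sub' (fun d : ℕ => (M + d + 1 : ℝ)⁻¹)]
        simp
      · intro d
        rw [sub_nonneg]
        apply inv_anti₀ (by positivity)
        push_cast
        linarith
    rw [sum_range_succ]
    refine (ih.add h).congr_fun fun d => ?_
    push_cast
    ring_nf

theorem tsum_inv_mul_inv_add (m : ℕ) :
    ∑' d : ℕ, (d + 1 : ℝ)⁻¹ * (m + d + 2 : ℝ)⁻¹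
      = (m + 1 : ℝ)⁻¹ * ∑ l ∈ range (m + 1), (l + 1 : ℝ)⁻¹ := by
  rw [← (hasSum_inv_sub_inv_add (m + 1)).tsum_eq, ← tsum_mul_left]
  refine tsum_congr fun d => ?_
  have a1 : (d + 1 : ℝ) ≠ 0 := by positivity
  have a2 : (m + d + 2 : ℝ) ≠ 0 := by positivity
  have a3 : (m + 1 : ℝ) ≠ 0 := by positivity
  have a4 : ((m + 1 : ℕ) + d + 1 : ℝ) = m + d + 2 := by push_cast; ring
  rw [a4]
  field_simp
  ring

/-- The left side is a sum over pairs l ≤ m: the part l < m is the double zeta value and the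
diagonal is the single one. -/
theorem tsum_pow_mul_harmonic {c : ℕ} (hc : 2 ≤ c) :
    ∑' m : ℕ, (m + 1 : ℝ)⁻¹ ^ c * ∑ l ∈ range (m + 1), (l + 1 : ℝ)⁻¹
      = doubleZeta 1 c + singleZeta (c + 1) := by
  set g : ℕ × ℕ → ℝ := fun x => if x.2 ≤ x.1 then (x.1 + 1 : ℝ)⁻¹ ^ c * (x.2 + 1 : ℝ)⁻¹ else 0
    with hg
  have hsum : Summable g := by
    refine Summable.of_nonneg_of_le (fun x => ?_) (fun x => ?_)
      (summable_inv_mul_inv_mul_inv_add.mul_left 2)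
    · simp only [hg]
      split_ifs <;> positivity
    · simp only [hg]
      split_ifs with h
      · have h1 : (x.1 + 1 : ℝ)⁻¹ ≤ 1 :=
          inv_le_one_of_one_le₀ (by linarith [Nat.cast_nonneg (α := ℝ) x.1])
        have h2 : (x.1 + 1 : ℝ)⁻¹ ≤ 2 * (x.1 + x.2 + 2 : ℝ)⁻¹ := by
          have h' : (x.2 : ℝ) ≤ x.1 := by exact_mod_cast h
          rw [← div_eq_mul_inv, inv_eq_one_div, div_le_div_iff₀ (by positivity) (by positivity)]
          linarith
        calc _ ≤ (x.1 + 1 : ℝ)⁻¹ ^ 2 * (x.2 + 1 : ℝ)⁻¹ := by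
              gcongr ?_ * _
              exact pow_le_pow_of_le_one (by positivity) h1 hc
          _ = (x.1 + 1 : ℝ)⁻¹ * (x.2 + 1 : ℝ)⁻¹ * (x.1 + 1 : ℝ)⁻¹ := by ring
          _ ≤ (x.1 + 1 : ℝ)⁻¹ * (x.2 + 1 : ℝ)⁻¹ * (2 * (x.1 + x.2 + 2 : ℝ)⁻¹) := by gcongr
          _ = _ := by ring
      · positivity
  have h1 : ∑' x, g x = ∑' m : ℕ, (m + 1 : ℝ)⁻¹ ^ c * ∑ l ∈ range (m + 1), (l + 1 : ℝ)⁻¹ := by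
    rw [hsum.tsum_prod]
    refine tsum_congr fun m => ?_
    rw [tsum_eq_sum (s := range (m + 1)), mul_sum]
    · refine sum_congr rfl fun l hl => ?_
      simp only [hg]
      rw [if_pos (Nat.lt_succ_iff.1 (mem_range.1 hl))]
    · intro l hl
      simp only [hg]
      rw [if_neg (by simpa [Nat.lt_succ_iff] using hl)]
  rw [← h1, tsum_prod_split hsum]
  have h2 : ∀ x : ℕ × ℕ, g (x.1, x.1 + x.2 + 1) = 0 := fun x => by
    simp only [hg]
    rw [if_neg (by omega)]
  have h3 : ∀ x : ℕ × ℕ, g (x.1 + x.2 + 1, x.1)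
      = (x.1 + 1 : ℝ)⁻¹ ^ 1 * (x.1 + x.2 + 2 : ℝ)⁻¹ ^ c := fun x => by
    simp only [hg]
    rw [if_pos (by omega)]
    push_cast
    ring_nf
  have h4 : ∀ n : ℕ, g (n, n) = (n + 1 : ℝ)⁻¹ ^ (c + 1) := fun n => by
    simp only [hg]
    rw [if_pos le_rfl, pow_succ]
  simp only [h2, h3, h4, tsum_zero, zero_add]
  rfl

/-- Repeated partial fractions in which the exponent of u falls step by step, until only v q^(n+1)
is left. -/
theorem pow_mul_mul_eq_sum {R : Type*} [CommRing R] {u v q : R} (h : u * v = q * (u + v)) (n : ℕ) :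
    u ^ n * v * q = ∑ t ∈ range n, u ^ (n - t) * q ^ (t + 2) + v * q ^ (n + 1) := by
  induction n with
  | zero => simp
  | succ n ih =>
    have h1 : ∀ t ∈ range n, u ^ (n + 1 - t) * q ^ (t + 2) = u * (u ^ (n - t) * q ^ (t + 2)) :=
      fun t ht => by
        rw [Nat.sub_add_comm (mem_range.1 ht).le, pow_succ]
        ring
    rw [sum_range_succ, sum_congr rfl h1, ← mul_sum, Nat.add_sub_cancel_left, pow_one]
    linear_combination u * ih + q ^ (n + 1) * h

/-- Euler's sum formula for double zeta values. -/
theorem sum_doubleZeta {n : ℕ} (hn : 1 ≤ n) :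
    ∑ t ∈ range n, doubleZeta (n - t) (t + 2) = singleZeta (n + 2) := by
  have hx : ∀ x : ℕ × ℕ, (x.1 + 1 : ℝ)⁻¹ * (x.2 + 1 : ℝ)⁻¹
      = (x.1 + x.2 + 2 : ℝ)⁻¹ * ((x.1 + 1 : ℝ)⁻¹ + (x.2 + 1 : ℝ)⁻¹) := fun x => by
    have a1 : (x.1 + 1 : ℝ) ≠ 0 := by positivity
    have a2 : (x.2 + 1 : ℝ) ≠ 0 := by positivity
    have a3 : (x.1 + x.2 + 2 : ℝ) ≠ 0 := by positivity
    field_simp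
    ring
  have hA : Summable fun x : ℕ × ℕ =>
      (x.1 + 1 : ℝ)⁻¹ ^ n * (x.2 + 1 : ℝ)⁻¹ * (x.1 + x.2 + 2 : ℝ)⁻¹ := by
    refine Summable.of_nonneg_of_le (fun x => by positivity) (fun x => ?_)
      summable_inv_mul_inv_mul_inv_add
    gcongr ?_ * _ * _
    have h1 : (x.1 + 1 : ℝ)⁻¹ ≤ 1 :=
      inv_le_one_of_one_le₀ (by linarith [Nat.cast_nonneg (α := ℝ) x.1])
    simpa using pow_le_pow_of_le_one (by positivity) h1 hn
  -- The series ∑ x⁻ⁿ y⁻¹ (x+y)⁻¹ is evaluated twice. Summing over y first produces harmonic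
  -- numbers; partial fractions produce double zeta values. The term ζ(1, n+1) occurs on both sides
  -- and cancels.
  have h1 : ∑' x : ℕ × ℕ, (x.1 + 1 : ℝ)⁻¹ ^ n * (x.2 + 1 : ℝ)⁻¹ * (x.1 + x.2 + 2 : ℝ)⁻¹
      = doubleZeta 1 (n + 1) + singleZeta (n + 2) := by
    rw [← tsum_pow_mul_harmonic (by omega : 2 ≤ n + 1), hA.tsum_prod]
    refine tsum_congr fun m => ?_
    simp only [mul_assoc]
    rw [tsum_mul_left, tsum_inv_mul_inv_add, pow_succ, mul_assoc]
  have hs : ∀ t ∈ range n, Summable fun x : ℕ × ℕ =>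
      ((x.1 + 1 : ℝ)⁻¹ ^ (n - t) * (x.1 + x.2 + 2 : ℝ)⁻¹ ^ (t + 2)) := fun t ht => by
    have := mem_range.1 ht
    exact summable_doubleZeta (by omega) (by omega)
  have hs' : Summable fun x : ℕ × ℕ =>
      ((x.2 + 1 : ℝ)⁻¹ ^ 1 * (x.1 + x.2 + 2 : ℝ)⁻¹ ^ (n + 1)) := by
    refine ((Equiv.prodComm ℕ ℕ).summable_iff.2
      (summable_doubleZeta le_rfl (by omega : 2 ≤ n + 1))).congr fun x => ?_
    simp only [Function.comp, Equiv.prodComm_apply, Prod.fst_swap, Prod.snd_swap,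
      add_comm (x.2 : ℝ)]
  have h2 : ∑' x : ℕ × ℕ, (x.1 + 1 : ℝ)⁻¹ ^ n * (x.2 + 1 : ℝ)⁻¹ * (x.1 + x.2 + 2 : ℝ)⁻¹
      = ∑ t ∈ range n, doubleZeta (n - t) (t + 2) + doubleZeta 1 (n + 1) := by
    rw [tsum_congr fun x => pow_mul_mul_eq_sum (hx x) n, Summable.tsum_add (summable_sum hs)
      (by simpa using hs'), Summable.tsum_finsetSum hs, doubleZeta_swap 1]
    simp only [doubleZeta, pow_one]
  linarith

/-- Even zeta values are rational multiples of powers of `ζ(2)`. -/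
theorem exists_singleZeta_even_eq (m : ℕ) (hm : m ≠ 0) :
    ∃ q : ℚ, singleZeta (2 * m) = q * singleZeta 2 ^ m := by
  have h : ∀ m : ℕ, m ≠ 0 → ∃ q : ℚ, singleZeta (2 * m) = q * Real.pi ^ (2 * m) := fun m hm => by
    have h1 := (hasSum_nat_add_iff' 1).2 (hasSum_zeta_nat hm)
    refine ⟨(-1) ^ (m + 1) * 2 ^ (2 * m - 1) * bernoulli (2 * m) / (2 * m).factorial, ?_⟩
    rw [singleZeta]
    convert h1.tsum_eq using 1
    · refine tsum_congr fun n => ?_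
      push_cast
      rw [inv_pow, one_div]
    · simp [hm]
      ring
  obtain ⟨q, hq⟩ := h m hm
  have h2 : singleZeta 2 = Real.pi ^ 2 / 6 := by
    rw [singleZeta]
    convert ((hasSum_nat_add_iff' 1).2 hasSum_zeta_two).tsum_eq using 1
    · refine tsum_congr fun n => ?_
      push_cast
      rw [inv_pow, one_div]
    · simp
  refine ⟨q * 6 ^ m, ?_⟩
  rw [hq, h2, div_pow, pow_mul]
  push_cast
  field_simp

end DoubleZeta

/-! ### Solving the double shuffle equations in odd weight. -/

section DoubleShuffle

variable {N : ℕ} {z : ℕ → ℚ} {ζ : ℚ}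

/-- The behaviour of F(A, B) = ∑ z_t A^(N-t) B^t under interchange of A and B. -/
theorem generating_harmonic (hH : ∀ t ≤ N, z t + z (N - t) = -ζ) (A B : ℚ) :
    ∑ t ∈ range (N + 1), z t * (A ^ (N - t) * B ^ t)
      + ∑ t ∈ range (N + 1), z t * (B ^ (N - t) * A ^ t)
      = -ζ * ∑ t ∈ range (N + 1), A ^ t * B ^ (N - t) := by
  rw [← sum_range_reflect (fun t => z t * (A ^ (N - t) * B ^ t)), ← sum_add_distrib, mul_sum]
  refine sum_congr rfl fun t ht => ?_
  have ht : t ≤ N := Nat.lt_succ_iff.1 (mem_range.1 ht)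
  simp only [Nat.add_sub_cancel]
  rw [Nat.sub_sub_self ht, ← hH t ht]
  ring

/-- Weighting the i-th relation by A^i (B - A)^(N-i) and summing over i, the binomial theorem turns
the two binomial coefficients into F(A, B) and F(B - A, B). -/
theorem generating_shuffle
    (hS : ∀ i ≤ N, ∑ t ∈ range (N + 1), ((t.choose i : ℚ) + t.choose (N - i)) * z t = 0) (A B : ℚ) :
    ∑ t ∈ range (N + 1), z t * (A ^ (N - t) * B ^ t)
      = -∑ t ∈ range (N + 1), z t * ((B - A) ^ (N - t) * B ^ t) := by
  have h1 : ∀ X Y : ℚ, ∀ t ≤ N, ∑ i ∈ range (N + 1), X ^ i * Y ^ (N - i) * (t.choose i : ℚ)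
      = Y ^ (N - t) * (X + Y) ^ t := fun X Y t ht => by
    rw [add_pow, mul_sum, ← sum_subset (range_subset_range.2 (Nat.succ_le_succ ht))]
    · refine sum_congr rfl fun i hi => ?_
      have hi : i ≤ t := Nat.lt_succ_iff.1 (mem_range.1 hi)
      rw [show N - i = (N - t) + (t - i) by omega, pow_add]
      ring
    · intro i _ hi
      rw [Nat.choose_eq_zero_of_lt (by simpa [Nat.lt_succ_iff] using hi)]
      simp
  have h2 : ∑ i ∈ range (N + 1), A ^ i * (B - A) ^ (N - i)
      * ∑ t ∈ range (N + 1), ((t.choose i : ℚ) + t.choose (N - i)) * z t = 0 :=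
    sum_eq_zero fun i hi => by rw [hS i (Nat.lt_succ_iff.1 (mem_range.1 hi)), mul_zero]
  simp_rw [mul_sum] at h2
  rw [sum_comm] at h2
  rw [eq_neg_iff_add_eq_zero, ← sum_add_distrib, ← h2]
  refine sum_congr rfl fun t ht => ?_
  have ht : t ≤ N := Nat.lt_succ_iff.1 (mem_range.1 ht)
  have e1 := h1 A (B - A) t ht
  have e2 := h1 (B - A) A t ht
  rw [← sum_range_reflect] at e2
  rw [add_sub_cancel] at e1
  rw [sub_add_cancel] at e2
  rw [← e1, ← e2, ← mul_add, ← sum_add_distrib, mul_sum]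
  refine sum_congr rfl fun i hi => ?_
  have hi : i ≤ N := Nat.lt_succ_iff.1 (mem_range.1 hi)
  simp only [Nat.add_sub_cancel]
  rw [Nat.sub_sub_self hi]
  ring

/-- Up to multiples of ζ, F(A, B) = -F(B-A, B) = F(B, B-A) = -F(-A, B-A) = F(B-A, -A) = -F(-B, -A) =
F(B, A) = -F(A, B), the last step but one because N is odd. The orbit returns with the opposite
sign, so 2F is known. The factor A B clears the denominators of two geometric sums. -/
theorem generating_closed_form (hN : Odd N) (hH : ∀ t ≤ N, z t + z (N - t) = -ζ)
    (hS : ∀ i ≤ N, ∑ t ∈ range (N + 1), ((t.choose i : ℚ) + t.choose (N - i)) * z t = 0) (A B : ℚ) :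
    2 * (A * B) * ∑ t ∈ range (N + 1), z t * (A ^ (N - t) * B ^ t)
      = ζ * (B ^ (N + 2) - A ^ (N + 2) - (B - A) ^ (N + 2)
        - A * B * ∑ t ∈ range (N + 1), A ^ t * B ^ (N - t)) := by
  have hneg : ∑ t ∈ range (N + 1), z t * ((-B) ^ (N - t) * (-A) ^ t)
      = -∑ t ∈ range (N + 1), z t * (B ^ (N - t) * A ^ t) := by
    rw [← sum_neg_distrib]
    refine sum_congr rfl fun t ht => ?_
    have ht : t ≤ N := Nat.lt_succ_iff.1 (mem_range.1 ht)
    have : (-1 : ℚ) ^ (N - t) * (-1) ^ t = -1 := by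
      rw [← pow_add, Nat.sub_add_cancel ht, hN.neg_one_pow]
    rw [neg_pow B, neg_pow A]
    linear_combination z t * B ^ (N - t) * A ^ t * this
  have s1 := generating_shuffle hS A B
  have s2 := generating_harmonic hH (B - A) B
  have s3 := generating_shuffle hS B (B - A)
  have s4 := generating_harmonic hH (B - A) (-A)
  have s5 := generating_shuffle hS (-B) (-A)
  have s6 := generating_harmonic hH A B
  rw [show B - A - B = -A by ring] at s3
  rw [show -A - -B = B - A by ring] at s5
  have g1 := (Commute.all (B - A) B).geom_sum₂_mul (N + 1)
  have g2 := (Commute.all (B - A) (-A)).geom_sum₂_mul (N + 1)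
  rw [hN.add_one.neg_pow] at g2
  simp only [Nat.add_sub_cancel] at g1 g2
  linear_combination A * B * (s1 - s2 + s3 - s4 + s5 - hneg + s6) - ζ * B * g1 + ζ * A * g2

/-- The parity theorem in depth two, for rational solutions of the double shuffle equations. -/
theorem double_shuffle_solution (hN : Odd N) (hH : ∀ t ≤ N, z t + z (N - t) = -ζ)
    (hS : ∀ i ≤ N, ∑ t ∈ range (N + 1), ((t.choose i : ℚ) + t.choose (N - i)) * z t = 0)
    {t : ℕ} (ht : t ≤ N) :
    2 * z t = ((-1) ^ (t + 1) * (N + 2).choose (t + 1) - 1) * ζ := by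
  -- At A = 1 the closed form holds for every rational B, hence is an identity of polynomials whose
  -- coefficients can be compared.
  open Polynomial in
  have h : (∑ s ∈ range (N + 1), C (2 * z s) * X ^ (s + 1) : ℚ[X])
      = C ζ * (X ^ (N + 2) - 1 - (X + C (-1)) ^ (N + 2) - ∑ s ∈ range (N + 1), X ^ (s + 1)) := by
    refine Polynomial.funext fun x => ?_
    have h1 := generating_closed_form hN hH hS 1 x
    rw [← sum_range_reflect (fun s => (X : ℚ[X]) ^ (s + 1))]
    simp only [one_pow, one_mul, mul_sum] at h1
    simp only [eval_finsetSum, eval_mul, eval_C, eval_pow, eval_X, eval_sub, eval_add,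
      eval_one, ← sub_eq_add_neg]
    convert h1 using 1
    · refine sum_congr rfl fun s _ => ?_
      ring
    · congr 2
      refine sum_congr rfl fun s hs => ?_
      rw [← pow_succ', Nat.add_sub_cancel]
  have h2 := congrArg (fun P => Polynomial.coeff P (t + 1)) h
  simp only [Polynomial.finsetSum_coeff, Polynomial.coeff_C_mul, Polynomial.coeff_sub,
    Polynomial.coeff_X_pow, Polynomial.coeff_one, Polynomial.coeff_X_add_C_pow,
    Nat.add_right_cancel_iff] at h2
  rw [if_neg (by omega), if_neg (by omega)] at h2
  have ht' : t < N + 1 := by omega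
  simp only [mul_ite, mul_one, mul_zero, sum_ite_eq, mem_range, if_pos ht'] at h2
  have h3 : (-1 : ℚ) ^ (N + 2 - (t + 1)) = -(-1) ^ (t + 1) := by
    have : (-1 : ℚ) ^ (N + 2 - (t + 1)) * (-1) ^ (t + 1) = -1 := by
      rw [← pow_add, Nat.sub_add_cancel (by omega), pow_add, hN.neg_one_pow]
      norm_num
    rcases neg_one_pow_eq_or ℚ (t + 1) with h' | h' <;> rw [h'] at this ⊢ <;> linarith
  rw [h2, h3]
  ring

/-- The parity theorem in depth two, for solutions of the double shuffle equations in a rational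
vector space. -/
theorem double_shuffle_solution_module {V : Type*} [AddCommGroup V] [Module ℚ V] {z : ℕ → V} {ζ : V}
    (hN : Odd N) (hH : ∀ t ≤ N, z t + z (N - t) = -ζ)
    (hS : ∀ i ≤ N, ∑ t ∈ range (N + 1), ((t.choose i : ℚ) + t.choose (N - i)) • z t = 0)
    {t : ℕ} (ht : t ≤ N) :
    (2 : ℚ) • z t = ((-1) ^ (t + 1) * ((N + 2).choose (t + 1) : ℚ) - 1) • ζ := by
  -- The equations are linear, and linear functionals separate points of a rational vector space, so
  -- the scalar case suffices.
  rw [← sub_eq_zero, ← Module.forall_dual_apply_eq_zero_iff ℚ]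
  intro φ
  have h := double_shuffle_solution (z := fun t => φ (z t)) (ζ := φ ζ) hN
    (fun t ht => by rw [← map_add, hH t ht, map_neg])
    (fun i hi => by
      have := congrArg φ (hS i hi)
      simpa only [map_sum, map_smul, smul_eq_mul, map_zero] using this) ht
  rw [map_sub, map_smul, map_smul, smul_eq_mul, smul_eq_mul, h, sub_self]

end DoubleShuffle

/-! ### Regularized values in depth at most two. -/

section Regularized

namespace FMZV

theorem mzv_nil : mzv [] = 1 := by
  have : Unique {n : Fin ([] : Index).length → ℕ // StrictMono n ∧ ∀ i, 0 < n i} :=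
    { default := ⟨fun i => i.elim0, fun i => i.elim0, fun i => i.elim0⟩
      uniq := fun n => Subtype.ext (funext fun i => i.elim0) }
  rw [mzv, tsum_eq_single default (fun n hn => absurd (Subsingleton.elim _ _) hn)]
  exact Fin.prod_univ_zero _

theorem mzv_singleton (a : ℕ+) : mzv [a] = singleZeta a := by
  let e : ℕ ≃ {n : Fin [a].length → ℕ // StrictMono n ∧ ∀ i, 0 < n i} :=
    { toFun := fun m => ⟨fun _ => m + 1, fun i j h => absurd h (by
        have : i = j := Subsingleton.elim (α := Fin 1) i j
        simp [this]), fun _ => Nat.succ_pos m⟩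
      invFun := fun n => n.1 (0 : Fin 1) - 1
      left_inv := fun m => rfl
      right_inv := fun n => Subtype.ext (funext fun i => by
        have h : i = (0 : Fin 1) := Subsingleton.elim (α := Fin 1) i 0
        have := n.2.2 (0 : Fin 1)
        rw [h]
        exact Nat.sub_add_cancel this) }
  rw [mzv, singleZeta, ← e.tsum_eq]
  refine tsum_congr fun m => (Fin.prod_univ_one _).trans ?_
  simp [e]

theorem mzv_pair (a b : ℕ+) : mzv [a, b] = doubleZeta a b := by
  let e : ℕ × ℕ ≃ {n : Fin [a, b].length → ℕ // StrictMono n ∧ ∀ i, 0 < n i} :=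
    { toFun := fun x => ⟨(![x.1 + 1, x.1 + x.2 + 2] : Fin 2 → ℕ),
        (Fin.strictMono_iff_lt_succ (n := 1)).2 (fun i => by fin_cases i; simp),
        fun (i : Fin 2) => by fin_cases i <;> simp⟩
      invFun := fun n => (n.1 (0 : Fin 2) - 1, n.1 (1 : Fin 2) - n.1 (0 : Fin 2) - 1)
      left_inv := fun x => by
        ext
        · simp
        · simp; omega
      right_inv := fun n => Subtype.ext (funext fun (i : Fin 2) => by
        have h0 := n.2.2 (0 : Fin 2)
        have h1 : n.1 (0 : Fin 2) < n.1 (1 : Fin 2) :=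
          n.2.1 (show (0 : Fin 2) < 1 by decide)
        fin_cases i
        · exact Nat.sub_add_cancel h0
        · simp
          omega) }
  rw [mzv, doubleZeta, ← e.tsum_eq]
  refine tsum_congr fun m => (Fin.prod_univ_two _).trans ?_
  simp [e]

theorem incl_single (w : AdmIndex) (q : ℚ) : incl (Finsupp.single w q) = Finsupp.single w.1 q := by
  simp [incl]

/-- By uniqueness the regularization can be read off from any one expression; in depth two no power
of e₁ beyond the second is needed. -/
theorem regMap_harmonic_eq (y x₁ x₂ : H0) :
    regMap .harmonic (incl y + harmonic (incl x₁) (powWith harmonic (Finsupp.single [1] 1) 1)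
      + harmonic (incl x₂) (powWith harmonic (Finsupp.single [1] 1) 2)) = y := by
  set a := incl y + harmonic (incl x₁) (powWith harmonic (Finsupp.single [1] 1) 1)
      + harmonic (incl x₂) (powWith harmonic (Finsupp.single [1] 1) 2) with ha
  have h := (existsUnique_harmonic a).choose_spec.2
    (Finsupp.single 0 y + Finsupp.single 1 x₁ + Finsupp.single 2 x₂) (by
      simp only
      rw [Finsupp.sum_add_index', Finsupp.sum_add_index', Finsupp.sum_single_index,
        Finsupp.sum_single_index, Finsupp.sum_single_index, ha]
      · congr 2
        exact (mul_one_of harmonicWord_nil _).symm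
      all_goals simp)
  rw [regMap, ← h]
  simp

theorem regMap_shuffle_eq (a : H1) (y x₁ x₂ : H0)
    (ha : toPoly a = toPoly (incl y)
      + shuffle (toPoly (incl x₁)) (powWith shuffle (Finsupp.single [1] 1) 1)
      + shuffle (toPoly (incl x₂)) (powWith shuffle (Finsupp.single [1] 1) 2)) :
    regMap .shuffle a = y := by
  have h := (existsUnique_shuffle a).choose_spec.2
    (Finsupp.single 0 y + Finsupp.single 1 x₁ + Finsupp.single 2 x₂) (by
      simp only
      rw [Finsupp.sum_add_index', Finsupp.sum_add_index', Finsupp.sum_single_index,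
        Finsupp.sum_single_index, Finsupp.sum_single_index, ha]
      · congr 2
        exact (mul_one_of shuffleWord_nil _).symm
      all_goals simp)
  rw [regMap, ← h]
  simp

theorem regMap_incl (ρ : Reg) (y : H0) : regMap ρ (incl y) = y := by
  cases ρ
  · simpa using regMap_harmonic_eq y 0 0
  · exact regMap_shuffle_eq _ y 0 0 (by simp)

theorem mzvReg_of_admissible (ρ : Reg) (k : Index) (hk : Admissible k) :
    mzvReg ρ k = mzvMem ⟨k, hk⟩ := by
  rw [mzvReg, ← incl_single ⟨k, hk⟩, regMap_incl]
  simp [zMap]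

theorem admissible_nil : Admissible [] := by simp [Admissible]

theorem mzvReg_nil (ρ : Reg) : mzvReg ρ [] = 1 := by
  rw [mzvReg_of_admissible ρ [] admissible_nil]
  exact Subtype.ext mzv_nil

theorem powWith_one_harmonic :
    powWith harmonic (Finsupp.single [1] 1) 1 = Finsupp.single [1] 1 :=
  one_mul_of nil_harmonicWord _

theorem powWith_one_shuffle :
    powWith shuffle (Finsupp.single [1] 1) 1 = Finsupp.single [1] 1 :=
  one_mul_of nil_shuffleWord _

theorem mzvReg_one (ρ : Reg) : mzvReg ρ [1] = 0 := by
  have h : regMap ρ (Finsupp.single [1] 1) = 0 := by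
    cases ρ
    · have := regMap_harmonic_eq 0 (Finsupp.single ⟨[], admissible_nil⟩ 1) 0
      rw [incl_single, powWith_one_harmonic] at this
      simpa [harmonic, bilin_single, nil_harmonicWord] using this
    · refine regMap_shuffle_eq _ 0 (Finsupp.single ⟨[], admissible_nil⟩ 1) 0 ?_
      rw [incl_single, powWith_one_shuffle]
      simp [toPoly_single, toWord, shuffle, bilin_single, nil_shuffleWord]
  rw [mzvReg, h, map_zero]

theorem harmonicWord_singleton_one (n : ℕ) :
    harmonicWord [n.succPNat] [1] = Finsupp.single [n.succPNat, Nat.succPNat 0] 1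
      + Finsupp.single [Nat.succPNat 0, n.succPNat] 1 + Finsupp.single [(n + 1).succPNat] 1 := by
  rw [harmonicWord, nil_harmonicWord, harmonicWord_nil, nil_harmonicWord, consL_single,
    consL_single, consL_single]
  rfl

theorem shuffleWord_replicate_one (n : ℕ) :
    shuffleWord (List.replicate n 0) [1]
      = ∑ j ∈ range (n + 1), (Finsupp.single (List.replicate j 0 ++ 1 :: List.replicate (n - j) 0) 1 : Poly01) := by
  induction n with
  | zero => simp [nil_shuffleWord]
  | succ n ih =>
    rw [List.replicate_succ, shuffleWord, ih, shuffleWord_nil, map_sum, sum_range_succ' _ (n + 1)]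
    congr 1
    · refine sum_congr rfl fun j _ => ?_
      rw [consL_single, List.replicate_succ, Nat.add_sub_add_right, List.cons_append]
    · rw [consL_single, List.replicate_zero, List.nil_append, Nat.sub_zero, List.replicate_succ]

theorem toWord_succPNat (n : ℕ) : toWord [n.succPNat] = 1 :: List.replicate n 0 := by
  simp [toWord]

theorem toWord_succPNat_pair (m n : ℕ) :
    toWord [m.succPNat, n.succPNat] = 1 :: List.replicate m 0 ++ 1 :: List.replicate n 0 := by
  simp [toWord]

theorem shuffleWord_singleton_one (n : ℕ) :
    shuffleWord (toWord [n.succPNat]) [1] = toPoly (Finsupp.single [Nat.succPNat 0, n.succPNat] 1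
      + ∑ j ∈ range (n + 1), Finsupp.single [j.succPNat, (n - j).succPNat] 1) := by
  rw [toWord_succPNat, shuffleWord, shuffleWord_replicate_one, shuffleWord_nil, map_add, map_sum,
    map_sum, add_comm]
  congr 1
  · rw [consL_single, toPoly_single, toWord_succPNat_pair]
    rfl
  · refine sum_congr rfl fun j _ => ?_
    rw [consL_single, toPoly_single, toWord_succPNat_pair, List.cons_append]

theorem admissible_succPNat_pair (m n : ℕ) : Admissible [m.succPNat, (n + 1).succPNat] :=
  (admissible_snoc [m.succPNat] _).2 fun h => by
    have := congrArg PNat.val h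
    simp at this

theorem admissible_succPNat (n : ℕ) : Admissible [(n + 1).succPNat] :=
  (admissible_snoc [] _).2 fun h => by
    have := congrArg PNat.val h
    simp at this

/-- The depth-two regularized values `ζ^•(i+1, j+1)`. -/
noncomputable def regPair (ρ : Reg) (i j : ℕ) : MZAlg := mzvReg ρ [i.succPNat, j.succPNat]

/-- The depth-one regularized values `ζ^•(i+1)`. -/
noncomputable def regSingle (ρ : Reg) (i : ℕ) : MZAlg := mzvReg ρ [i.succPNat]

theorem regSingle_zero (ρ : Reg) : regSingle ρ 0 = 0 := mzvReg_one ρ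

theorem coe_regSingle_succ (ρ : Reg) (i : ℕ) : (regSingle ρ (i + 1) : ℝ) = singleZeta (i + 2) := by
  rw [regSingle, mzvReg_of_admissible ρ _ (admissible_succPNat i)]
  exact mzv_singleton _

theorem coe_regPair_succ (ρ : Reg) (i j : ℕ) :
    (regPair ρ i (j + 1) : ℝ) = doubleZeta (i + 1) (j + 2) := by
  rw [regPair, mzvReg_of_admissible ρ _ (admissible_succPNat_pair i j)]
  exact mzv_pair _ _

theorem sum_regPair (ρ : Reg) (n : ℕ) :
    ∑ t ∈ range (n + 1), regPair ρ (n - t) (t + 1) = regSingle ρ (n + 2) := by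
  apply Subtype.ext
  have h := sum_doubleZeta (Nat.succ_pos n)
  rw [coe_regSingle_succ, AddSubmonoidClass.coe_finsetSum, ← h]
  refine sum_congr rfl fun t ht => ?_
  rw [coe_regPair_succ, Nat.succ_eq_add_one, Nat.sub_add_comm (Nat.lt_succ_iff.1 (mem_range.1 ht))]

theorem zMap_single (k : Index) (hk : Admissible k) (ρ : Reg) :
    zMap (Finsupp.single ⟨k, hk⟩ 1) = mzvReg ρ k := by
  rw [mzvReg_of_admissible ρ k hk]
  simp [zMap]

/-- Multiplying e_{n+2} by e₁ and solving for e_{n+2} e₁, the harmonic product gives the stated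
value directly. The shuffle product gives a sum of double zeta values in place of ζ(n+3), and
Euler's sum formula identifies the two. -/
theorem regPair_succ_zero (ρ : Reg) (n : ℕ) :
    regPair ρ (n + 1) 0 = -regPair ρ 0 (n + 1) - regSingle ρ (n + 2) := by
  cases ρ with
  | harmonic =>
    set y : H0 := -Finsupp.single ⟨[Nat.succPNat 0, (n + 1).succPNat], admissible_succPNat_pair 0 n⟩ 1
      - Finsupp.single ⟨[(n + 2).succPNat], admissible_succPNat (n + 1)⟩ 1 with hy
    have h : regMap .harmonic (Finsupp.single [(n + 1).succPNat, Nat.succPNat 0] 1) = y := by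
      refine (congrArg _ ?_).trans (regMap_harmonic_eq y
        (Finsupp.single ⟨[(n + 1).succPNat], admissible_succPNat n⟩ 1) 0)
      rw [incl_single, powWith_one_harmonic, harmonic, bilin_single, harmonicWord_singleton_one,
        map_zero, map_zero, LinearMap.zero_apply, hy, map_sub, map_neg, incl_single, incl_single]
      abel
    rw [regPair, mzvReg, h, hy, map_sub, map_neg, zMap_single _ _ .harmonic,
      zMap_single _ _ .harmonic]
    rfl
  | shuffle =>
    set y : H0 := -Finsupp.single ⟨[Nat.succPNat 0, (n + 1).succPNat], admissible_succPNat_pair 0 n⟩ 1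
      - ∑ t ∈ range (n + 1), Finsupp.single
        ⟨[(n - t).succPNat, (t + 1).succPNat], admissible_succPNat_pair (n - t) t⟩ 1 with hy
    have h : regMap .shuffle (Finsupp.single [(n + 1).succPNat, Nat.succPNat 0] 1) = y := by
      refine regMap_shuffle_eq _ y
        (Finsupp.single ⟨[(n + 1).succPNat], admissible_succPNat n⟩ 1) 0 ?_
      rw [incl_single, powWith_one_shuffle, toPoly_single [(n + 1).succPNat], shuffle, bilin_single,
        shuffleWord_singleton_one, map_zero, map_zero, map_zero, LinearMap.zero_apply, add_zero,
        ← map_add]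
      congr 1
      have h1 : incl (∑ t ∈ range (n + 1), Finsupp.single
        ⟨[(n - t).succPNat, (t + 1).succPNat], admissible_succPNat_pair (n - t) t⟩ 1)
          = ∑ j ∈ range (n + 1), Finsupp.single [j.succPNat, (n + 1 - j).succPNat] 1 := by
        rw [map_sum, ← sum_range_reflect]
        refine sum_congr rfl fun j hj => ?_
        have hj : j ≤ n := Nat.lt_succ_iff.1 (mem_range.1 hj)
        rw [incl_single, Nat.add_sub_cancel, Nat.sub_sub_self hj, Nat.sub_add_comm hj]
      rw [hy, map_sub, map_neg, incl_single, h1, sum_range_succ _ (n + 1), Nat.sub_self]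
      abel
    rw [regPair, mzvReg, h, hy, map_sub, map_neg, zMap_single _ _ .shuffle, map_sum, ← sum_regPair]
    congr 1
    refine sum_congr rfl fun t _ => ?_
    rw [zMap_single _ _ .shuffle]
    rfl

/-- The square of e₁ is 2 e₁e₁ + e₂ for the harmonic product and 2 e₁e₁ for the shuffle product. The
two regularizations differ here, but only by a multiple of ζ(2). -/
theorem two_smul_regPair_zero_zero (ρ : Reg) :
    (2 : ℚ) • regPair ρ 0 0 = 0 ∨ (2 : ℚ) • regPair ρ 0 0 = -regSingle ρ 1 := by
  cases ρ with
  | harmonic =>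
    right
    set y : H0 := -((1 / 2 : ℚ) • Finsupp.single ⟨[Nat.succPNat 1], admissible_succPNat 0⟩ 1)
      with hy
    have h : regMap .harmonic (Finsupp.single [Nat.succPNat 0, Nat.succPNat 0] 1) = y := by
      refine (congrArg _ ?_).trans
        (regMap_harmonic_eq y 0 ((1 / 2 : ℚ) • Finsupp.single ⟨[], admissible_nil⟩ 1))
      have h1 : harmonic one (powWith harmonic (Finsupp.single [1] 1) 2)
        = powWith harmonic (Finsupp.single [1] 1) 2 := one_mul_of nil_harmonicWord _
      have h2 : powWith harmonic (Finsupp.single [1] 1) 2 = _ :=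
        (congrArg (fun x => harmonic x (Finsupp.single [1] 1)) powWith_one_harmonic).trans
          ((bilin_single _ _ _).trans (harmonicWord_singleton_one 0))
      rw [one] at h1
      rw [map_zero, map_zero, LinearMap.zero_apply, map_smul, incl_single, map_smul,
        LinearMap.smul_apply, h1, h2, hy, map_neg, map_smul, incl_single]
      module
    rw [regPair, mzvReg, h, hy, map_neg, map_smul, zMap_single _ _ .harmonic, regSingle]
    module
  | shuffle =>
    left
    have h : regMap .shuffle (Finsupp.single [Nat.succPNat 0, Nat.succPNat 0] 1) = 0 := by
      refine regMap_shuffle_eq _ 0 0 ((1 / 2 : ℚ) • Finsupp.single ⟨[], admissible_nil⟩ 1) ?_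
      have h1 : shuffle one (powWith shuffle (Finsupp.single [1] 1) 2)
        = powWith shuffle (Finsupp.single [1] 1) 2 := one_mul_of nil_shuffleWord _
      have h2 : powWith shuffle (Finsupp.single [1] 1) 2 = shuffleWord [1] [1] :=
        (congrArg (fun x => shuffle x (Finsupp.single [1] 1)) powWith_one_shuffle).trans
          (bilin_single _ _ _)
      rw [one] at h1
      rw [map_zero, map_zero, map_zero, LinearMap.zero_apply, map_smul, incl_single, map_smul,
        toPoly_single, toPoly_single, toWord_succPNat_pair, toWord, map_smul, LinearMap.smul_apply,
        h1, h2, shuffleWord, nil_shuffleWord, shuffleWord_nil, consL_single]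
      simp only [List.replicate_zero, List.cons_append, List.nil_append]
      module
    rw [regPair, mzvReg, h, map_zero, smul_zero]

end FMZV

end Regularized

/-! ### Symmetric values modulo ζ(2) and t². -/

section Symmetric

namespace FMZV

theorem inner_nil (ρ : Reg) (m : ℕ) :
    ∑ l ∈ Finset.Nat.antidiagonalTuple ([] : Index).length m,
        (∏ j, (((([] : Index).get j : ℕ) + l j - 1).choose (l j) : MZAlg)) *
          mzvReg ρ (shift [] l).reverse = if m = 0 then 1 else 0 := by
  cases m with
  | zero =>
    refine (Finset.sum_singleton _ _).trans ?_
    exact (congrArg₂ _ (Fin.prod_univ_zero _) (mzvReg_nil ρ)).trans (one_mul _)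
  | succ m => exact Finset.sum_empty

theorem inner_singleton (ρ : Reg) (a m : ℕ) :
    ∑ l ∈ Finset.Nat.antidiagonalTuple [a.succPNat].length m,
        (∏ j, ((([a.succPNat].get j : ℕ) + l j - 1).choose (l j) : MZAlg)) *
          mzvReg ρ (shift [a.succPNat] l).reverse
      = ((a + m).choose m : MZAlg) * regSingle ρ (a + m) := by
  have h : Finset.Nat.antidiagonalTuple [a.succPNat].length m = {(![m] : Fin 1 → ℕ)} :=
    Finset.Nat.antidiagonalTuple_one m
  rw [h]
  refine (Finset.sum_singleton _ _).trans ?_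
  refine congrArg₂ _ ((Fin.prod_univ_one _).trans ?_) ?_
  · change ((a + 1 + m - 1).choose m : MZAlg) = _
    rw [show a + 1 + m - 1 = a + m by omega]
  · rw [regSingle]
    congr 1
    change [(⟨a + 1 + m, _⟩ : ℕ+)] = _
    congr 1
    exact PNat.eq (by change a + 1 + m = a + m + 1; omega)

theorem inner_pair (ρ : Reg) (a b m : ℕ) :
    ∑ l ∈ Finset.Nat.antidiagonalTuple [a.succPNat, b.succPNat].length m,
        (∏ j, ((([a.succPNat, b.succPNat].get j : ℕ) + l j - 1).choose (l j) : MZAlg)) *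
          mzvReg ρ (shift [a.succPNat, b.succPNat] l).reverse
      = ∑ x ∈ antidiagonal m, ((a + x.1).choose x.1 : MZAlg) * ((b + x.2).choose x.2 : MZAlg)
        * regPair ρ (b + x.2) (a + x.1) := by
  have h : Finset.Nat.antidiagonalTuple [a.succPNat, b.succPNat].length m
      = (antidiagonal m).map ((piFinTwoEquiv fun _ => ℕ).symm.toEmbedding) :=
    Finset.Nat.antidiagonalTuple_two m
  rw [h]
  refine (Finset.sum_map _ _ _).trans (sum_congr rfl fun x _ => ?_)
  refine congrArg₂ _ ((Fin.prod_univ_two _).trans ?_) ?_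
  · change ((a + 1 + x.1 - 1).choose x.1 : MZAlg) * ((b + 1 + x.2 - 1).choose x.2 : MZAlg) = _
    rw [show a + 1 + x.1 - 1 = a + x.1 by omega, show b + 1 + x.2 - 1 = b + x.2 by omega]
  · rw [regPair]
    congr 1
    change [(⟨b + 1 + x.2, _⟩ : ℕ+), (⟨a + 1 + x.1, _⟩ : ℕ+)] = _
    congr 1
    · exact PNat.eq (by change b + 1 + x.2 = b + x.2 + 1; omega)
    · congr 1
      exact PNat.eq (by change a + 1 + x.1 = a + x.1 + 1; omega)

theorem coeff_zetaSHatLift_pair (ρ : Reg) (i j m : ℕ) :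
    PowerSeries.coeff m (zetaSHatLift ρ [i.succPNat, j.succPNat])
      = (-1) ^ (i + j) * ∑ x ∈ antidiagonal m, ((i + x.1).choose x.1 : MZAlg)
          * ((j + x.2).choose x.2 : MZAlg) * regPair ρ (j + x.2) (i + x.1)
        + (-1) ^ (j + 1) * regSingle ρ i * (((j + m).choose m : MZAlg) * regSingle ρ (j + m))
        + if m = 0 then regPair ρ i j else 0 := by
  rw [zetaSHatLift, PowerSeries.coeff_mk]
  refine (Finset.sum_range_succ _ 2).trans (congrArg₂ _ ((Finset.sum_range_succ _ 1).trans
    (congrArg₂ _ ((Finset.sum_range_one _).trans ?_) ?_)) ?_)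
  · refine congrArg₂ _ ?_ (inner_pair ρ i j m)
    change (-1) ^ (i + 1 + (j + 1 + 0)) * mzvReg ρ [] = _
    rw [mzvReg_nil]
    ring
  · refine congrArg₂ _ ?_ (inner_singleton ρ j m)
    simp [regSingle]
  · refine (congrArg (_ * ·) (inner_nil ρ m)).trans ?_
    simp [regPair]

theorem coeff_zetaSHatLift_singleton (ρ : Reg) (i m : ℕ) :
    PowerSeries.coeff m (zetaSHatLift ρ [i.succPNat])
      = (-1) ^ (i + 1) * (((i + m).choose m : MZAlg) * regSingle ρ (i + m))
        + if m = 0 then regSingle ρ i else 0 := by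
  rw [zetaSHatLift, PowerSeries.coeff_mk]
  refine (Finset.sum_range_succ _ 1).trans (congrArg₂ _ ((Finset.sum_range_one _).trans ?_) ?_)
  · refine congrArg₂ _ ?_ (inner_singleton ρ i m)
    simp [mzvReg_nil]
  · refine (congrArg (_ * ·) (inner_nil ρ m)).trans ?_
    simp [regSingle]

/-- The class of `ζ^•(i+1, j+1)` modulo `ζ(2)`. -/
noncomputable def barPair (ρ : Reg) (i j : ℕ) : MZBar := Ideal.Quotient.mk _ (regPair ρ i j)

/-- The class of `ζ^•(i+1)` modulo `ζ(2)`. -/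
noncomputable def barSingle (ρ : Reg) (i : ℕ) : MZBar := Ideal.Quotient.mk _ (regSingle ρ i)

theorem zetaMem_succPNat (ρ : Reg) (i : ℕ) : zetaMem (i + 1).succPNat = regSingle ρ (i + 1) := by
  have h : (2 : ℕ+) ≤ (i + 1).succPNat := by
    rw [← PNat.coe_le_coe]
    simp
  rw [zetaMem, dif_pos h, regSingle, mzvReg_of_admissible ρ _ (admissible_succPNat i)]

theorem coe_zetaMem_two : (zetaMem 2 : ℝ) = singleZeta 2 := by
  rw [show (2 : ℕ+) = (0 + 1 : ℕ).succPNat from rfl, zetaMem_succPNat .harmonic,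
    coe_regSingle_succ]

/-- An odd i stands for the even zeta value ζ(i+1), a rational multiple of a positive power of ζ(2),
and so divisible by ζ(2) already inside 𝒵. -/
theorem barSingle_odd (ρ : Reg) {i : ℕ} (hi : Odd i) : barSingle ρ i = 0 := by
  obtain ⟨m, rfl⟩ := hi
  obtain ⟨q, hq⟩ := exists_singleZeta_even_eq (m + 1) m.succ_ne_zero
  rw [barSingle, Ideal.Quotient.eq_zero_iff_mem, Ideal.mem_span_singleton]
  refine ⟨algebraMap ℚ MZAlg q * zetaMem 2 ^ m, Subtype.ext ?_⟩
  rw [coe_regSingle_succ, show 2 * m + 2 = 2 * (m + 1) by ring, hq]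
  push_cast
  rw [coe_zetaMem_two, pow_succ]
  change (q : ℝ) * _ = _ * (algebraMap ℚ ℝ q * _)
  rw [eq_ratCast]
  ring

theorem barSingle_zero (ρ : Reg) : barSingle ρ 0 = 0 := by
  rw [barSingle, regSingle_zero, map_zero]

/-- One of the two arguments of ζ is even. This removes the product terms from the double shuffle
relations of odd weight. -/
theorem barSingle_mul_barSingle (ρ : Reg) {i j : ℕ} (hij : Odd (i + j)) :
    barSingle ρ i * barSingle ρ j = 0 := by
  rcases Nat.even_or_odd i with h | h
  · rw [barSingle_odd ρ ((Nat.odd_add'.1 hij).2 h), mul_zero]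
  · rw [barSingle_odd ρ h, zero_mul]

theorem barPair_succ_zero (ρ : Reg) (n : ℕ) :
    barPair ρ (n + 1) 0 = -barPair ρ 0 (n + 1) - barSingle ρ (n + 2) := by
  rw [barPair, regPair_succ_zero, map_sub, map_neg]
  rfl

/-- The harmonic product relation survives for either regularization: an entry 1 is covered by the
formula for ζ^•(n+2, 1) together with ζ^•(1) = 0, and ζ^•(1, 1) vanishes modulo ζ(2). -/
theorem barPair_add_barPair (ρ : Reg) (i j : ℕ) :
    barPair ρ i j + barPair ρ j i + barSingle ρ (i + j + 1) = barSingle ρ i * barSingle ρ j := by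
  rcases i with _ | i <;> rcases j with _ | j
  · have h : (2 : ℚ) • barPair ρ 0 0 = 0 := by
      change Ideal.Quotient.mk _ ((2 : ℚ) • regPair ρ 0 0) = 0
      rcases two_smul_regPair_zero_zero ρ with h | h
      · rw [h, map_zero]
      · rw [h, map_neg]
        exact neg_eq_zero.2 (barSingle_odd ρ odd_one)
    rw [barSingle_zero, zero_mul, barSingle_odd ρ (by decide : Odd (0 + 0 + 1)), add_zero, ← h,
      two_smul]
  · rw [barPair_succ_zero, barSingle_zero, zero_mul, show 0 + (j + 1) + 1 = j + 2 by omega]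
    ring
  · rw [barPair_succ_zero, barSingle_zero, mul_zero, show i + 1 + 0 + 1 = i + 2 by omega]
    ring
  · have h : regPair ρ (i + 1) (j + 1) + regPair ρ (j + 1) (i + 1)
        + regSingle ρ (i + 1 + (j + 1) + 1) = regSingle ρ (i + 1) * regSingle ρ (j + 1) := by
      apply Subtype.ext
      push_cast
      rw [coe_regPair_succ, coe_regPair_succ, coe_regSingle_succ, coe_regSingle_succ,
        coe_regSingle_succ, singleZeta_mul_singleZeta (by omega) (by omega)]
      congr 2
      omega
    simp only [barPair, barSingle, ← map_mul, ← map_add, h]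

theorem barPair_shuffle_succ (ρ : Reg) (i j : ℕ) :
    ∑ t ∈ range (i + 1 + (j + 1) + 1), ((t.choose (i + 1) : ℚ) + t.choose (j + 1))
      • barPair ρ (i + 1 + (j + 1) - t) t = barSingle ρ (i + 1) * barSingle ρ (j + 1) := by
  have h : ∑ t ∈ range (i + 1 + (j + 1) + 1), ((t.choose (i + 1) : ℚ) + t.choose (j + 1))
      • regPair ρ (i + 1 + (j + 1) - t) t = regSingle ρ (i + 1) * regSingle ρ (j + 1) := by
    apply Subtype.ext
    rw [AddSubmonoidClass.coe_finsetSum]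
    push_cast
    rw [coe_regSingle_succ, coe_regSingle_succ,
      singleZeta_mul_singleZeta_shuffle (i := i + 1) (j := j + 1) (by omega) (by omega)]
    refine sum_congr rfl fun t ht => ?_
    rcases t with _ | t
    · simp
    · have ht := mem_range.1 ht
      rw [coe_regPair_succ, Rat.smul_def]
      push_cast
      congr 2
      omega
  rw [barSingle, barSingle, ← map_mul, ← h, map_sum]
  exact sum_congr rfl fun t _ => rfl

/-- The shuffle relation with a factor e₁. It reduces to Euler's sum formula and the value of
ζ^•(n+2, 1), and so holds for the harmonic regularization as well. -/
theorem barPair_shuffle_zero (ρ : Reg) (n : ℕ) :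
    ∑ t ∈ range (n + 1 + 1), ((t.choose 0 : ℚ) + t.choose (n + 1)) • barPair ρ (n + 1 - t) t = 0 := by
  have h : ∑ t ∈ range (n + 1), barPair ρ (n - t) (t + 1) = barSingle ρ (n + 2) := by
    rw [barSingle, ← sum_regPair, map_sum]
    rfl
  simp only [add_smul, sum_add_distrib, Nat.choose_zero_right, Nat.cast_one, one_smul]
  have h2 : ∑ t ∈ range (n + 1 + 1), (t.choose (n + 1) : ℚ) • barPair ρ (n + 1 - t) t
      = barPair ρ 0 (n + 1) := by
    rw [sum_eq_single (n + 1), Nat.sub_self, Nat.choose_self, Nat.cast_one, one_smul]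
    · intro t ht hne
      rw [Nat.choose_eq_zero_of_lt (by have := mem_range.1 ht; omega), Nat.cast_zero, zero_smul]
    · intro h'
      exact absurd (mem_range.2 (Nat.lt_succ_self _)) h'
  rw [h2, sum_range_succ']
  simp only [Nat.add_sub_add_right, Nat.sub_zero]
  rw [h, barPair_succ_zero]
  ring

theorem barPair_shuffle (ρ : Reg) {i j N : ℕ} (hij : i + j = N) (hN : Odd N) :
    ∑ t ∈ range (N + 1), ((t.choose i : ℚ) + t.choose j) • barPair ρ (N - t) t = 0 := by
  rcases i with _ | i <;> rcases j with _ | j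
  · subst hij
    exact absurd hN (by decide)
  · obtain rfl : j + 1 = N := by omega
    exact barPair_shuffle_zero ρ j
  · obtain rfl : i + 1 = N := by omega
    rw [← barPair_shuffle_zero ρ i]
    exact sum_congr rfl fun t _ => by rw [add_comm (t.choose 0 : ℚ)]
  · subst hij
    rw [barPair_shuffle_succ, barSingle_mul_barSingle ρ hN]

/-- The parity theorem for double zeta values of odd weight, modulo `ζ(2)`. -/
theorem two_mul_barPair (ρ : Reg) {i j N : ℕ} (hij : i + j = N) (hN : Odd N) :
    2 * barPair ρ i j
      = ((-1) ^ (j + 1) * ((N + 2).choose (j + 1) : MZBar) - 1) * barSingle ρ (N + 1) := by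
  have h := double_shuffle_solution_module (z := fun t => barPair ρ (N - t) t)
    (ζ := barSingle ρ (N + 1)) hN (fun t ht => by
      have h1 := barPair_add_barPair ρ (N - t) t
      rw [barSingle_mul_barSingle ρ (by rwa [Nat.sub_add_cancel ht]), Nat.sub_add_cancel ht] at h1
      simp only [Nat.sub_sub_self ht]
      exact eq_neg_of_add_eq_zero_left h1)
    (fun i hi => barPair_shuffle ρ (Nat.add_sub_cancel' hi) hN) (show j ≤ N by omega)
  have hc : ((-1) ^ (j + 1) * ((N + 2).choose (j + 1) : ℚ) - 1)
      = (((-1) ^ (j + 1) * ((N + 2).choose (j + 1) : ℤ) - 1 : ℤ) : ℚ) := by push_cast; rfl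
  simp only [show N - j = i by omega] at h
  rw [hc, Int.cast_smul_eq_zsmul, zsmul_eq_mul, two_smul] at h
  rw [two_mul, h]
  push_cast
  rfl

theorem coeff_zetaSHat (ρ : Reg) (k : Index) (m : ℕ) : PowerSeries.coeff m (zetaSHat ρ k)
    = Ideal.Quotient.mk _ (PowerSeries.coeff m (zetaSHatLift ρ k)) :=
  PowerSeries.coeff_map _ _ _

theorem neg_one_pow_of_odd {R : Type*} [CommRing R] {n : ℕ} (hn : Odd n) : (-1 : R) ^ n = -1 :=
  hn.neg_one_pow

theorem neg_one_pow_eq_of_even_add {R : Type*} [CommRing R] {i j : ℕ} (h : Even (i + j)) :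
    (-1 : R) ^ (j + 1) = (-1) ^ (i + 1) :=
  neg_one_pow_congr (by rw [Nat.even_add_one, Nat.even_add_one, Nat.even_add.1 h])

/-- For even j the sign of the product term is the one in the harmonic relation; for odd j the
product itself vanishes modulo ζ(2). -/
theorem coeff_zero_zetaSHat_pair (ρ : Reg) {i j : ℕ} (hij : Even (i + j)) :
    PowerSeries.coeff 0 (zetaSHat ρ [i.succPNat, j.succPNat]) = 0 := by
  have h : PowerSeries.coeff 0 (zetaSHat ρ [i.succPNat, j.succPNat])
      = barPair ρ j i + (-1) ^ (j + 1) * barSingle ρ i * barSingle ρ j + barPair ρ i j := by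
    rw [coeff_zetaSHat, coeff_zetaSHatLift_pair, hij.neg_one_pow]
    simp [barPair, barSingle]
  have h1 := barPair_add_barPair ρ i j
  rw [barSingle_odd ρ hij.add_one] at h1
  rw [h]
  rcases Nat.even_or_odd j with hj | hj
  · have e : (-1 : MZBar) ^ (j + 1) = -1 := neg_one_pow_of_odd (R := MZBar) hj.add_one
    rw [e]
    linear_combination h1
  · rw [barSingle_odd ρ hj] at h1 ⊢
    linear_combination h1

/-- The coefficient is k₂ ζ(k₂+1, k₁) + k₁ ζ(k₂, k₁+1) plus a product that vanishes modulo ζ(2). In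
the parity theorem the two terms -1, weighted by k₂ and k₁, add up to -k. -/
theorem two_mul_coeff_one_zetaSHat_pair (ρ : Reg) {i j : ℕ} (hij : Even (i + j)) :
    2 * PowerSeries.coeff 1 (zetaSHat ρ [i.succPNat, j.succPNat])
      = ((-1) ^ (i + 1) * ((j + 1 : ℕ) : MZBar) * ((i + j + 3).choose (i + 1) : MZBar)
        - (-1) ^ (j + 1) * ((i + 1 : ℕ) : MZBar) * ((i + j + 3).choose (j + 1) : MZBar)
        - ((i + j + 2 : ℕ) : MZBar)) * barSingle ρ (i + j + 2) := by
  have h : PowerSeries.coeff 1 (zetaSHat ρ [i.succPNat, j.succPNat])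
      = ((j + 1 : ℕ) : MZBar) * barPair ρ (j + 1) i + ((i + 1 : ℕ) : MZBar) * barPair ρ j (i + 1)
        + (-1) ^ (j + 1) * (j + 1 : ℕ) * (barSingle ρ i * barSingle ρ (j + 1)) := by
    rw [coeff_zetaSHat, coeff_zetaSHatLift_pair, hij.neg_one_pow,
      show antidiagonal 1 = {(0, 1), (1, 0)} from rfl, sum_pair (by decide)]
    simp [barPair, barSingle]
    ring
  have hN : Odd (i + j + 1) := hij.add_one
  have h1 := two_mul_barPair ρ (show j + 1 + i = i + j + 1 by omega) hN
  have h2 := two_mul_barPair ρ (show j + (i + 1) = i + j + 1 by omega) hN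
  have h3 : (-1 : MZBar) ^ (j + 1) = (-1) ^ (i + 1) :=
    neg_one_pow_eq_of_even_add (R := MZBar) hij
  rw [h, barSingle_mul_barSingle ρ (show Odd (i + (j + 1)) from hN), mul_zero, add_zero, h3]
  rw [Nat.choose_symm_of_eq_add (show i + j + 1 + 2 = (i + 1 + 1) + (j + 1) by omega)] at h2
  rw [pow_succ (-1 : MZBar) (i + 1)] at h2
  push_cast at h1 h2 ⊢
  linear_combination ((j : MZBar) + 1) * h1 + ((i : MZBar) + 1) * h2

theorem coeff_zero_zetaSHat_singleton (ρ : Reg) {i : ℕ} (hi : Odd i) :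
    PowerSeries.coeff 0 (zetaSHat ρ [i.succPNat]) = 0 := by
  have h : PowerSeries.coeff 0 (zetaSHat ρ [i.succPNat])
      = (-1) ^ (i + 1) * barSingle ρ i + barSingle ρ i := by
    rw [coeff_zetaSHat, coeff_zetaSHatLift_singleton]
    simp [barSingle]
  rw [h, barSingle_odd ρ hi, mul_zero, add_zero]

theorem coeff_one_zetaSHat_singleton (ρ : Reg) {i : ℕ} (hi : Odd i) :
    PowerSeries.coeff 1 (zetaSHat ρ [i.succPNat]) = ((i + 1 : ℕ) : MZBar) * barSingle ρ (i + 1) := by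
  rw [coeff_zetaSHat, coeff_zetaSHatLift_singleton, hi.add_one.neg_one_pow]
  simp [barSingle]

theorem merges_pair (a b : ℕ+) : merges [a, b] = [[a, b], [a + b]] := by
  rw [merges, merges, merges]
  rfl

theorem mk_X_sq_eq_half_smul {R : Type*} [CommRing R]
    [Module ℚ (PowerSeries R ⧸ Ideal.span {(PowerSeries.X : PowerSeries R) ^ 2})]
    {f : PowerSeries R} (c : ℤ) (z : R)
    (h0 : PowerSeries.coeff 0 f = 0) (h1 : 2 * PowerSeries.coeff 1 f = c * z) :
    Ideal.Quotient.mk (Ideal.span {(PowerSeries.X : PowerSeries R) ^ 2}) f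
      = ((1 / 2 : ℚ) * c) • (Ideal.Quotient.mk _ (PowerSeries.C z)
        * Ideal.Quotient.mk _ PowerSeries.X) := by
  refine eq_half_smul_of_two_mul c ?_
  rw [← map_mul, ← zsmul_eq_mul, ← map_zsmul, two_mul, ← map_add, Ideal.Quotient.eq,
    Ideal.mem_span_singleton, PowerSeries.X_pow_dvd_iff]
  intro d hd
  rw [map_sub, map_add, map_zsmul, sub_eq_zero]
  interval_cases d
  · rw [h0, PowerSeries.coeff_zero_mul_X, smul_zero, add_zero]
  · rw [← two_mul, h1, show (1 : ℕ) = 0 + 1 from rfl, PowerSeries.coeff_succ_mul_X,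
      PowerSeries.coeff_zero_C, zsmul_eq_mul]

theorem SRing_two_mk_eq {f : PowerSeries MZBar} (c : ℤ) (z : MZBar)
    (h0 : PowerSeries.coeff 0 f = 0) (h1 : 2 * PowerSeries.coeff 1 f = c * z) :
    (Ideal.Quotient.mk _ f : SRing 2) = ((1 / 2 : ℚ) * c) •
      ((Ideal.Quotient.mk _ (PowerSeries.C z) : SRing 2) * xS 2) :=
  mk_X_sq_eq_half_smul (R := MZBar) c z h0 h1

theorem zetaS_two_depth_two (k₁ k₂ k : ℕ+) (hk : k = k₁ + k₂) (heven : Even (k : ℕ)) (ρ : Reg) :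
    zetaS ρ 2 [k₁, k₂] =
        ((1 / 2 : ℚ) * ((-1) ^ (k₁ : ℕ) * (k₂ : ℚ) * (((k : ℕ) + 1).choose k₁ : ℚ)
          - (-1) ^ (k₂ : ℕ) * (k₁ : ℚ) * (((k : ℕ) + 1).choose k₂ : ℚ) - (k : ℚ))) •
          (frakZS 2 (k + 1) * xS 2) ∧
      zetaSStar ρ 2 [k₁, k₂] =
        ((1 / 2 : ℚ) * ((-1) ^ (k₁ : ℕ) * (k₂ : ℚ) * (((k : ℕ) + 1).choose k₁ : ℚ)
          - (-1) ^ (k₂ : ℕ) * (k₁ : ℚ) * (((k : ℕ) + 1).choose k₂ : ℚ) + (k : ℚ))) •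
          (frakZS 2 (k + 1) * xS 2) := by
  obtain ⟨i, rfl⟩ : ∃ i : ℕ, k₁ = i.succPNat := ⟨k₁.natPred, (PNat.succPNat_natPred k₁).symm⟩
  obtain ⟨j, rfl⟩ : ∃ j : ℕ, k₂ = j.succPNat := ⟨k₂.natPred, (PNat.succPNat_natPred k₂).symm⟩
  have hk' : k = (i + j + 1).succPNat := by
    rw [hk]
    exact PNat.eq (by change i + 1 + (j + 1) = i + j + 1 + 1; omega)
  have hk1 : k + 1 = (i + j + 1 + 1).succPNat := by rw [hk']; rfl
  have hkn : (k : ℕ) = i + j + 2 := by rw [hk']; rfl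
  have hij : Even (i + j) := by
    rw [hkn] at heven
    exact (Nat.even_add.1 heven).2 even_two
  have hz : frakZS 2 (k + 1) = Ideal.Quotient.mk _ (PowerSeries.C (barSingle ρ (i + j + 2))) := by
    rw [frakZS, hk1, zetaMem_succPNat ρ]
    rfl
  have h0 := coeff_zero_zetaSHat_pair ρ hij
  have h1 := two_mul_coeff_one_zetaSHat_pair ρ hij
  rw [hz, hkn]
  simp only [Nat.succPNat_coe, Nat.succ_eq_add_one]
  constructor
  · have h := SRing_two_mk_eq ((-1) ^ (i + 1) * ((j + 1 : ℕ) : ℤ) * ((i + j + 3).choose (i + 1) : ℤ)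
        - (-1) ^ (j + 1) * ((i + 1 : ℕ) : ℤ) * ((i + j + 3).choose (j + 1) : ℤ)
        - ((i + j + 2 : ℕ) : ℤ)) (barSingle ρ (i + j + 2)) h0 (by rw [h1]; push_cast; rfl)
    rw [zetaS, h]
    push_cast
    rfl
  -- Merging the two entries adds the depth-one value of weight k, whose class is k ζ(k+1) t; after
  -- doubling, -k becomes k.
  · have hodd : Odd (i + j + 1) := hij.add_one
    have hs : zetaSHatStar ρ [i.succPNat, j.succPNat]
        = zetaSHat ρ [i.succPNat, j.succPNat] + zetaSHat ρ [(i + j + 1).succPNat] := by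
      rw [zetaSHatStar, merges_pair, ← hk, hk']
      simp
    have h := SRing_two_mk_eq (f := zetaSHatStar ρ [i.succPNat, j.succPNat])
      ((-1) ^ (i + 1) * ((j + 1 : ℕ) : ℤ) * ((i + j + 3).choose (i + 1) : ℤ)
        - (-1) ^ (j + 1) * ((i + 1 : ℕ) : ℤ) * ((i + j + 3).choose (j + 1) : ℤ)
        + ((i + j + 2 : ℕ) : ℤ)) (barSingle ρ (i + j + 2))
      (by rw [hs, map_add, h0, coeff_zero_zetaSHat_singleton ρ hodd, add_zero])
      (by
        rw [hs, map_add, mul_add, h1, coeff_one_zetaSHat_singleton ρ hodd]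
        push_cast
        ring)
    rw [zetaSStar, h]
    push_cast
    rfl

end FMZV

end Symmetric

end

theorem mainTheorem5 (k₁ k₂ k : ℕ+) (hk : k = k₁ + k₂) (heven : Even (k : ℕ)) :
    (FMZV.zetaA 2 [k₁, k₂] =
        ((1 / 2 : ℚ) * ((-1) ^ (k₁ : ℕ) * (k₂ : ℚ) * (((k : ℕ) + 1).choose k₁ : ℚ)
          - (-1) ^ (k₂ : ℕ) * (k₁ : ℚ) * (((k : ℕ) + 1).choose k₂ : ℚ) - (k : ℚ))) •
          (FMZV.frakZA 2 (k + 1) * FMZV.xA 2) ∧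
      FMZV.zetaAStar 2 [k₁, k₂] =
        ((1 / 2 : ℚ) * ((-1) ^ (k₁ : ℕ) * (k₂ : ℚ) * (((k : ℕ) + 1).choose k₁ : ℚ)
          - (-1) ^ (k₂ : ℕ) * (k₁ : ℚ) * (((k : ℕ) + 1).choose k₂ : ℚ) + (k : ℚ))) •
          (FMZV.frakZA 2 (k + 1) * FMZV.xA 2)) ∧
    ∀ ρ : FMZV.Reg,
      (FMZV.zetaS ρ 2 [k₁, k₂] =
        ((1 / 2 : ℚ) * ((-1) ^ (k₁ : ℕ) * (k₂ : ℚ) * (((k : ℕ) + 1).choose k₁ : ℚ)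
          - (-1) ^ (k₂ : ℕ) * (k₁ : ℚ) * (((k : ℕ) + 1).choose k₂ : ℚ) - (k : ℚ))) •
          (FMZV.frakZS 2 (k + 1) * FMZV.xS 2) ∧
      FMZV.zetaSStar ρ 2 [k₁, k₂] =
        ((1 / 2 : ℚ) * ((-1) ^ (k₁ : ℕ) * (k₂ : ℚ) * (((k : ℕ) + 1).choose k₁ : ℚ)
          - (-1) ^ (k₂ : ℕ) * (k₁ : ℚ) * (((k : ℕ) + 1).choose k₂ : ℚ) + (k : ℚ))) •
          (FMZV.frakZS 2 (k + 1) * FMZV.xS 2)) := by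
  exact ⟨zetaA_two_depth_two k₁ k₂ k hk heven, FMZV.zetaS_two_depth_two k₁ k₂ k hk heven⟩
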